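/- Let $M$ be a smooth manifold of dimension $n$ and $\pi: N=TM\setminus\{0\}\to M$ its slit tangent bundle. Let $F:TM\to[0,\infty)$ be a Finsler structure: $F$ is smooth on $N$, $F(x,\lambda y)=\lambda F(x,y)$ for $\lambda>0$, and $g_{ij}(x,y)=\frac12\frac{\partial^2F^2}{\partial y^i\partial y^j}$ is positive definite on $N$. Let $$\gamma^i_{jk}=\tfrac12 g^{is}\Big(\tfrac{\partial g_{sj}}{\partial x^k}-\tfrac{\partial g_{jk}}{\partial x^s}+\tfrac{\partial g_{sk}}{\partial x^j}\Big),\quad A_{ijk}=\tfrac F2\tfrac{\partial g_{ij}}{\partial y^k},\quad A^i_{jk}=g^{il}A_{ljk},\quad N^i_j=\gamma^i_{jk}y^k-A^i_{jk}\gamma^k_{rs}\tfrac{y^ry^s}{F},$$ let $\frac{\delta}{\delta x^j}=\frac{\partial}{\partial x^j}-N^i_j\frac{\partial}{\partial y^i}$, and let $\iota_u:T_xM\to T_uN$, $\frac{\partial}{\partial x^j}\mapsto\frac{\delta}{\delta x^j}$, be the horizontal lift at $u\in\pi^{-1}(x)$. Assume that $(M,F)$ is a Berwald structure, i.e. that in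 natural coordinates the coefficients $\frac12 g^{is}\big(\frac{\delta g_{sj}}{\delta x^k}-\frac{\delta g_{jk}}{\delta x^s}+\frac{\delta g_{sk}}{\delta x^j}\big)$ of the Chern connection do not depend on $y$. Let $\nabla^b$ be the linear Berwald connection on $\pi^*TM\to N$, with connection forms ${}^b\Gamma^i_{jk}\,dx^j$, where ${}^b\Gamma^i_{jk}=\frac12\frac{\partial^2}{\partial y^j\partial y^k}\big(\gamma^i_{rs}y^ry^s\big)$. Let $I_x=\{y\in T_xM: F(x,y)=1\}$ be the indicatrix, with the volume $dvol$ induced from the Riemannian manifold $(T_xM\setminus\{0\},\,g_{ij}(x,\cdot)\,dy^i\otimes dy^j)$. The average of $\nabla^b$ is $$\langle\nabla^b\rangle_XY=\frac1{vol(I_x)}\int_{I_x}\nabla^b_{\iota_u(X)}\pi^*Y\;dvol(u),\qquad X\in T_xM,$$ for vector fields $Y$ on $M$, where $(\pi^*TM)_u$ is identified with $T_xM$. Let $h$ be a smooth Riemannian metric on $M$ with $\nabla^b\pi^*h=0$ on $N$. Then: 1. $\langle\nabla^b\rangle$ is an affine connection on $M$ and equals the Levi-Civita connection $\nabla^h$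 of $h$. 2. For every $C^1$ path $\gamma:[0,1]\to M$ from $x$ to $z$, the horizontal lifts of $\gamma$ to $N$ (the curves $t\mapsto(\gamma(t),V(t))$ in $N$ whose velocity is $\iota_{V(t)}(\gamma'(t))$) are exactly the nowhere vanishing $\nabla^h$-parallel vector fields $V$ along $\gamma$, and the parallel transport $\tau_\gamma:T_xM\to T_zM$ of $\nabla^h$ along $\gamma$ (a linear isomorphism) satisfies $\tau_\gamma(I_x)=I_z$. -/

import Mathlib

open Set MeasureTheory Bundle
open scoped Manifold ContDiff

noncomputable section

namespace FinslerBerwald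

/-! ### Natural coordinates on the tangent bundle -/

section NaturalCoordinates

/-- The coordinate space `ℝⁿ`. -/
abbrev Coord (n : ℕ) : Type := EuclideanSpace ℝ (Fin n)

/-- The natural coordinates `(xⁱ, yⁱ)` on `TM` induced by the preferred chart of `M` at `c`. -/
def natChart {n : ℕ} {M : Type*} [TopologicalSpace M] [ChartedSpace (Coord n) M]
    [IsManifold (𝓡 n) ∞ M] (c : M) :
    PartialEquiv (TangentBundle (𝓡 n) M) (Coord n × Coord n) :=
  extChartAt (𝓡 n).tangent (⟨c, 0⟩ : TangentBundle (𝓡 n) M)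

/-- The slit tangent bundle `N = TM ∖ {0}`. -/
def slit (n : ℕ) (M : Type*) [TopologicalSpace M] [ChartedSpace (Coord n) M] :
    Set (TangentBundle (𝓡 n) M) :=
  {u | u.2 ≠ 0}

/-- The partial derivative `∂f/∂xⁱ` of a function of `(x, y)`. -/
def dX {n : ℕ} (i : Fin n) (f : Coord n × Coord n → ℝ) (q : Coord n × Coord n) : ℝ :=
  fderiv ℝ f q (EuclideanSpace.single i 1, 0)

/-- The partial derivative `∂f/∂yⁱ` of a function of `(x, y)`. -/
def dY {n : ℕ} (i : Fin n) (f : Coord n × Coord n → ℝ) (q : Coord n × Coord n) : ℝ :=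
  fderiv ℝ f q (0, EuclideanSpace.single i 1)

end NaturalCoordinates

/-! ### The local formulas of Finsler geometry

Here `L : (x, y) ↦ L (x, y)` is the coordinate expression of a Finsler function. -/

section LocalFormulas

variable {n : ℕ} (L : Coord n × Coord n → ℝ)

/-- The fundamental tensor `g_ij = ½ ∂²L²/∂yⁱ∂yʲ`. -/
def gLow (q : Coord n × Coord n) : Matrix (Fin n) (Fin n) ℝ :=
  Matrix.of fun i j => (1 / 2) * dY i (dY j (fun p => L p ^ 2)) q

/-- The inverse `g^ij` of the fundamental tensor. -/
def gUp (q : Coord n × Coord n) : Matrix (Fin n) (Fin n) ℝ := (gLow L q)⁻¹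

/-- The formal Christoffel symbols
`γ^i_jk = ½ g^is (∂g_sj/∂xᵏ - ∂g_jk/∂xˢ + ∂g_sk/∂xʲ)`. -/
def formalChristoffel (q : Coord n × Coord n) (i j k : Fin n) : ℝ :=
  (1 / 2) * ∑ s, gUp L q i s *
    (dX k (fun p => gLow L p s j) q - dX s (fun p => gLow L p j k) q
      + dX j (fun p => gLow L p s k) q)

/-- The Cartan tensor `A_ijk = (L/2) ∂g_ij/∂yᵏ`. -/
def cartanLow (q : Coord n × Coord n) (i j k : Fin n) : ℝ :=
  L q / 2 * dY k (fun p => gLow L p i j) q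

/-- The Cartan tensor with its first index raised, `A^i_jk = g^il A_ljk`. -/
def cartanUp (q : Coord n × Coord n) (i j k : Fin n) : ℝ :=
  ∑ l, gUp L q i l * cartanLow L q l j k

/-- The coefficients of the non-linear connection,
`N^i_j / L = γ^i_jk yᵏ/L - A^i_jk γ^k_rs (yʳ/L) (yˢ/L)`. -/
def nonlinCoeff (q : Coord n × Coord n) (i j : Fin n) : ℝ :=
  ∑ k, formalChristoffel L q i j k * q.2 k
    - (∑ k, ∑ r, ∑ s, cartanUp L q i j k * formalChristoffel L q k r s * q.2 r * q.2 s) / L q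

/-- The horizontal derivative `δf/δxʲ = ∂f/∂xʲ - N^i_j ∂f/∂yⁱ`. -/
def dHor (j : Fin n) (f : Coord n × Coord n → ℝ) (q : Coord n × Coord n) : ℝ :=
  dX j f q - ∑ i, nonlinCoeff L q i j * dY i f q

/-- The coefficients of the Chern connection,
`Γ^i_jk = ½ g^is (δg_sj/δxᵏ - δg_jk/δxˢ + δg_sk/δxʲ)`, i.e. the unique ones which are symmetric
in `j, k` and satisfy `δg_ij/δxᵏ = g_lj Γ^l_ik + g_il Γ^l_jk`. -/
def chernCoeff (q : Coord n × Coord n) (i j k : Fin n) : ℝ :=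
  (1 / 2) * ∑ s, gUp L q i s *
    (dHor L k (fun p => gLow L p s j) q - dHor L s (fun p => gLow L p j k) q
      + dHor L j (fun p => gLow L p s k) q)

/-- The spray coefficients `Gⁱ = γ^i_sk yˢ yᵏ`. -/
def sprayCoeff (q : Coord n × Coord n) (i : Fin n) : ℝ :=
  ∑ s, ∑ k, formalChristoffel L q i s k * q.2 s * q.2 k

/-- The coefficients `½ ∂Gⁱ/∂yʲ` of the non-linear Cartan connection. -/
def cartanNonlinCoeff (q : Coord n × Coord n) (i j : Fin n) : ℝ :=
  (1 / 2) * dY j (fun p => sprayCoeff L p i) q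

/-- The coefficients of the linear Berwald connection: the derivatives along the fibre of the
coefficients of the non-linear Cartan connection. -/
def berwaldCoeff (q : Coord n × Coord n) (i j k : Fin n) : ℝ :=
  dY k (fun p => cartanNonlinCoeff L p i j) q

end LocalFormulas

section Manifold

variable {n : ℕ} {M : Type*} [TopologicalSpace M] [ChartedSpace (Coord n) M]
  [IsManifold (𝓡 n) ∞ M]

/-! ### Finsler structures and Berwald structures -/

/-- The expression `F(x, y)` of `F` in the natural coordinates given by the chart at `c`. -/
def localExpr (F : TangentBundle (𝓡 n) M → ℝ) (c : M) (q : Coord n × Coord n) : ℝ :=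
  F ((natChart c).symm q)

/-- Finsler structures: non-negative functions on `TM`, smooth on the slit tangent bundle,
positively homogeneous of degree one and strongly convex. -/
structure IsFinsler (F : TangentBundle (𝓡 n) M → ℝ) : Prop where
  nonneg : ∀ u, 0 ≤ F u
  smooth : ContMDiffOn (𝓡 n).tangent 𝓘(ℝ, ℝ) ∞ F (slit n M)
  homogeneous : ∀ (x : M) (y : TangentSpace (𝓡 n) x) (l : ℝ), 0 < l →
    F ⟨x, l • y⟩ = l * F ⟨x, y⟩
  posDef : ∀ (c : M), ∀ q ∈ (natChart (n := n) c).target, q.2 ≠ 0 →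
    (gLow (localExpr F c) q).PosDef

/-- A Berwald structure is a Finsler structure for which the coefficients of the Chern connection
in natural coordinates live on `M`, i.e. do not depend on `y`. -/
structure IsBerwald (F : TangentBundle (𝓡 n) M → ℝ) : Prop extends IsFinsler F where
  chern_indep : ∀ (c : M) (p y z : Coord n),
    (p, y) ∈ (natChart (n := n) c).target → (p, z) ∈ (natChart (n := n) c).target →
    y ≠ 0 → z ≠ 0 →
    chernCoeff (localExpr F c) (p, y) = chernCoeff (localExpr F c) (p, z)

/-- The indicatrix `I_x = {y ∈ T_xM | F(x, y) = 1}`. -/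
def indicatrix (F : TangentBundle (𝓡 n) M → ℝ) (x : M) : Set (TangentSpace (𝓡 n) x) :=
  {y | F ⟨x, y⟩ = 1}

/-! ### Connections on the pull-back bundle `π^*TM → N` -/

variable (n M) in
/-- Sections of `π^*TM`: the value at `u` is a vector in `T_{π(u)}M`. Only their restrictions to
the slit tangent bundle matter. -/
abbrev PullbackSection : Type _ :=
  (u : TangentBundle (𝓡 n) M) → TangentSpace (𝓡 n) u.proj

/-- The section `π^*Y` of `π^*TM` associated with a vector field `Y` on `M`. -/
def pullbackField (Y : (x : M) → TangentSpace (𝓡 n) x) : PullbackSection n M :=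
  fun u => Y u.proj

variable (n M) in
/-- Covariant derivative operators on `π^*TM`: `D σ u X` stands for `(∇_X σ)(u)`, where
`X ∈ T_u(TM)`. -/
abbrev PullbackConnection : Type _ :=
  PullbackSection n M → (u : TangentBundle (𝓡 n) M) →
    (TangentSpace (𝓡 n).tangent u →L[ℝ] TangentSpace (𝓡 n) u.proj)

/-- The components of a section `σ` of `π^*TM` in the frame `π^*(∂/∂xⁱ)` of the chart at `c`, as a
function of the natural coordinates. -/
def sectionExpr (σ : PullbackSection n M) (c : M) (q : Coord n × Coord n) : Coord n :=
  (trivializationAt (Coord n) (TangentSpace (𝓡 n) : M → Type _) c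
    ⟨((natChart c).symm q).proj, σ ((natChart c).symm q)⟩).2

/-- The bilinear map `(v, w) ↦ Γ^i_jk vʲ wᵏ e_i`, in the form `w ↦ v ↦ …`. -/
def coeffMap (Γ : Fin n → Fin n → Fin n → ℝ) (w : Coord n) : Coord n →L[ℝ] Coord n :=
  ∑ i, ∑ j, ∑ k, (Γ i j k * w k) •
    (EuclideanSpace.proj j : Coord n →L[ℝ] ℝ).smulRight (EuclideanSpace.single i (1 : ℝ))

/-- The connection on `π^*TM` with connection 1-forms `ω^i_k = Γ^i_jk dxʲ`:
`(∇_X σ)ⁱ = X(σⁱ) + Γ^i_jk dxʲ(X) σᵏ`. At `u` this is written in the natural coordinates given by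
the preferred chart at `π(u)`, in which `T_u(TM)` is `ℝⁿ × ℝⁿ` and `T_{π(u)}M` is `ℝⁿ`. In
particular `∇_V π^*Y = 0` for vertical `V`. -/
def connectionOfCoeff
    (Γ : M → Coord n × Coord n → Fin n → Fin n → Fin n → ℝ) : PullbackConnection n M :=
  fun σ u =>
    (fderiv ℝ (sectionExpr σ u.proj) (natChart u.proj u)
      + (coeffMap (Γ u.proj (natChart u.proj u)) (σ u)).comp
          (ContinuousLinearMap.fst ℝ (Coord n) (Coord n)) :
      Coord n × Coord n →L[ℝ] Coord n)

/-- The linear Berwald connection `∇ᵇ` of `(M, F)` on `π^*TM`. -/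
def berwaldConnection (F : TangentBundle (𝓡 n) M → ℝ) : PullbackConnection n M :=
  connectionOfCoeff fun c => berwaldCoeff (localExpr F c)

/-- The horizontal lift `ι_u : T_xM → T_u(TM)`, `∂/∂xʲ ↦ δ/δxʲ = ∂/∂xʲ - N^i_j ∂/∂yⁱ`. -/
def horizontalLift (F : TangentBundle (𝓡 n) M → ℝ) (u : TangentBundle (𝓡 n) M) :
    TangentSpace (𝓡 n) u.proj →L[ℝ] TangentSpace (𝓡 n).tangent u :=
  ((ContinuousLinearMap.id ℝ (Coord n)).prod
    (-∑ i, ∑ j, nonlinCoeff (localExpr F u.proj) (natChart u.proj u) i j •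
      (EuclideanSpace.proj j : Coord n →L[ℝ] ℝ).smulRight (EuclideanSpace.single i (1 : ℝ))) :
    Coord n →L[ℝ] Coord n × Coord n)

/-- `∇ π^*h = 0` on the slit tangent bundle, that is
`X(h(σ, τ)) = h(∇_X σ, τ) + h(σ, ∇_X τ)` for all `u ∈ N`, all `X ∈ T_uN` and all sections `σ, τ`
of `π^*TM` which are differentiable at `u`. -/
def IsParallelMetric (D : PullbackConnection n M)
    (h : ContMDiffRiemannianMetric (𝓡 n) ∞ (Coord n) (TangentSpace (𝓡 n) : M → Type _)) : Prop :=
  ∀ u ∈ slit n M, ∀ σ τ : PullbackSection n M,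
    MDifferentiableAt (𝓡 n).tangent (𝓡 n).tangent
      (fun v => (⟨v.proj, σ v⟩ : TangentBundle (𝓡 n) M)) u →
    MDifferentiableAt (𝓡 n).tangent (𝓡 n).tangent
      (fun v => (⟨v.proj, τ v⟩ : TangentBundle (𝓡 n) M)) u →
    ∀ X : TangentSpace (𝓡 n).tangent u,
      mvfderiv (𝓡 n).tangent
          (fun v : TangentBundle (𝓡 n) M => h.inner v.proj (σ v) (τ v)) u X
        = h.inner u.proj (D σ u X) (τ u) + h.inner u.proj (σ u) (D τ u X)

/-! ### The average of a connection -/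

/-- The fundamental tensor `g_{(x, y)}` as a bilinear form on `T_xM = ℝⁿ`. -/
def fundForm (F : TangentBundle (𝓡 n) M → ℝ) (x : M) (y v w : Coord n) : ℝ :=
  ∑ i, ∑ j, gLow (localExpr F x) (natChart x (⟨x, y⟩ : TangentBundle (𝓡 n) M)) i j * v i * w j

/-- The central projection `y ↦ y / F(x, y)` of `T_xM ∖ {0}` onto the indicatrix `I_x`. -/
def centralProj (F : TangentBundle (𝓡 n) M → ℝ) (x : M) (y : Coord n) : Coord n :=
  (F (⟨x, y⟩ : TangentBundle (𝓡 n) M))⁻¹ • y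

/-- The density, with respect to the surface measure of the unit sphere `S`, of the Riemannian
volume of the metric `r^*g` on `S`, where `r : S → I_x` is the central projection and `I_x` carries
the metric induced by the Riemannian metric `y ↦ g_{(x, y)}` of `T_xM ∖ {0}`. It is the square root
of the Gram determinant of `r^*g` in a Euclidean orthonormal basis of the tangent space of `S` at
`θ`. That determinant equals the `n × n` determinant below, because the differential of `r` (as a
map on `T_xM ∖ {0}`) vanishes on the line spanned by the unit vector `θ`. -/
def volumeDensity (F : TangentBundle (𝓡 n) M → ℝ) (x : M) (θ : Coord n) : ℝ :=
  Real.sqrt (Matrix.det (Matrix.of fun i j : Fin n =>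
    fundForm F x (centralProj F x θ)
        (fderiv ℝ (centralProj F x) θ (EuclideanSpace.single i 1))
        (fderiv ℝ (centralProj F x) θ (EuclideanSpace.single j 1))
      + θ i * θ j))

/-- The Riemannian volume `dvol` of the hypersurface `I_x` of the Riemannian manifold
`(T_xM ∖ {0}, g_x)`, as a measure on `T_xM = ℝⁿ` carried by `I_x`. The hypersurface is parametrized
by the unit sphere through the central projection. -/
def indicatrixVolume (F : TangentBundle (𝓡 n) M → ℝ) (x : M) : Measure (Coord n) :=
  Measure.map (α := Metric.sphere (0 : Coord n) 1) (fun θ => centralProj F x θ.1)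
    ((volume : Measure (Coord n)).toSphere.withDensity
      (fun θ => ENNReal.ofReal (volumeDensity F x θ.1)))

/-- The operator `X ↦ π₂|_u ∇_{ι_u(X)} π^*Y` on `T_xM = ℝⁿ`, for `u = (x, y)`. -/
def averageIntegrand (F : TangentBundle (𝓡 n) M → ℝ) (D : PullbackConnection n M)
    (Y : (x : M) → TangentSpace (𝓡 n) x) (x : M) (y : Coord n) : Coord n →L[ℝ] Coord n :=
  (D (pullbackField Y) (⟨x, y⟩ : TangentBundle (𝓡 n) M)).comp
    (horizontalLift F (⟨x, y⟩ : TangentBundle (𝓡 n) M))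

/-- The average `⟨∇⟩` of a connection `∇` on `π^*TM`:
`⟨∇⟩_X Y = vol(I_x)⁻¹ ∫_{I_x} π₂|_u ∇_{ι_u(X)} π^*Y dvol(u)` for `X ∈ T_xM`. -/
def averageConnection (F : TangentBundle (𝓡 n) M → ℝ) (D : PullbackConnection n M)
    (Y : (x : M) → TangentSpace (𝓡 n) x) (x : M) :
    TangentSpace (𝓡 n) x →L[ℝ] TangentSpace (𝓡 n) x :=
  average (E := Coord n →L[ℝ] Coord n) (indicatrixVolume F x) (averageIntegrand F D Y x)

/-! ### The Levi-Civita connection and parallel transport -/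

/-- `D` is the Levi-Civita connection of `h`: torsion free and compatible with `h`. -/
def IsLeviCivita
    (h : ContMDiffRiemannianMetric (𝓡 n) ∞ (Coord n) (TangentSpace (𝓡 n) : M → Type _))
    (D : CovariantDerivative (𝓡 n) (Coord n) (TangentSpace (𝓡 n) : M → Type _)) : Prop :=
  D.torsion = 0 ∧
    letI : RiemannianBundle (TangentSpace (𝓡 n) : M → Type _) := ⟨h.toRiemannianMetric⟩
    D.IsMetricCompatible

/-- The velocity `γ'(t)` of a curve `γ` defined on `[0, 1]`. -/
def velocity (γ : ℝ → M) (t : ℝ) : TangentSpace (𝓡 n) (γ t) :=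
  mfderivWithin 𝓘(ℝ, ℝ) (𝓡 n) γ (Icc 0 1) t (1 : ℝ)

/-- The curve in `TM` given by a vector field `V` along a curve `γ` in `M`. -/
def curveTM (γ : ℝ → M) (V : (t : ℝ) → TangentSpace (𝓡 n) (γ t)) (t : ℝ) :
    TangentBundle (𝓡 n) M :=
  ⟨γ t, V t⟩

/-- The velocity of `t ↦ (γ t, V t)` in `T(TM)`, for `γ` and `V` defined on `[0, 1]`. In the natural
coordinates given by the chart at `γ t` it is the pair of the velocities of `x` and `y`. -/
def velocityTM (γ : ℝ → M) (V : (t : ℝ) → TangentSpace (𝓡 n) (γ t)) (t : ℝ) :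
    TangentSpace (𝓡 n).tangent (⟨γ t, V t⟩ : TangentBundle (𝓡 n) M) :=
  mfderivWithin 𝓘(ℝ, ℝ) (𝓡 n).tangent (curveTM γ V) (Icc 0 1) t (1 : ℝ)

/-- The components `dyⁱ(ξ)` of a vector `ξ` tangent to `TM` at `(x, y)`, in the natural coordinates
given by the chart at `x`. -/
def fibreComponent {x : M} {y : TangentSpace (𝓡 n) x}
    (ξ : TangentSpace (𝓡 n).tangent (⟨x, y⟩ : TangentBundle (𝓡 n) M)) : TangentSpace (𝓡 n) x :=
  Prod.snd (α := Coord n) (β := Coord n) ξ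

/-- The vector field `V` along `γ : [0, 1] → M` is differentiable. -/
def DifferentiableAlong (γ : ℝ → M) (V : (t : ℝ) → TangentSpace (𝓡 n) (γ t)) : Prop :=
  MDifferentiableOn 𝓘(ℝ, ℝ) (𝓡 n).tangent (curveTM γ V) (Icc 0 1)

/-- `V` is parallel along `γ : [0, 1] → M` for the affine connection `D`: in the chart at `γ t`,
`dVⁱ/dt + Γ^i_jk(γ) γ'ʲ Vᵏ = 0`, where `Γ^i_jk γ'ʲ Vᵏ` are the components of `D_{γ'} W` for the local
field `W` with the constant components `Vᵏ(t)` in that chart. (The same equation says that the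
section `V` of `π^*TM` is parallel for the pull-back of `D`, along any lift of `γ` to `N`.) -/
def IsParallelAlong
    (D : CovariantDerivative (𝓡 n) (Coord n) (TangentSpace (𝓡 n) : M → Type _))
    (γ : ℝ → M) (V : (t : ℝ) → TangentSpace (𝓡 n) (γ t)) : Prop :=
  DifferentiableAlong γ V ∧ ∀ t ∈ Icc (0 : ℝ) 1,
    fibreComponent (velocityTM γ V t)
      + D (FiberBundle.extend (Coord n) (V t)) (γ t) (velocity γ t) = 0

/-- `τ` is the parallel transport of `D` along `γ : [0, 1] → M`. -/
def IsParallelTransport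
    (D : CovariantDerivative (𝓡 n) (Coord n) (TangentSpace (𝓡 n) : M → Type _))
    (γ : ℝ → M) (τ : TangentSpace (𝓡 n) (γ 0) → TangentSpace (𝓡 n) (γ 1)) : Prop :=
  (∀ v, ∃ V, IsParallelAlong D γ V ∧ V 0 = v) ∧
    ∀ V, IsParallelAlong D γ V → τ (V 0) = V 1

/-- The curve `t ↦ (γ t, V t)` is a horizontal lift of `γ : [0, 1] → M` to the slit tangent bundle:
its velocity is the horizontal lift of the velocity of `γ`. -/
def IsHorizontalLift (F : TangentBundle (𝓡 n) M → ℝ) (γ : ℝ → M)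
    (V : (t : ℝ) → TangentSpace (𝓡 n) (γ t)) : Prop :=
  DifferentiableAlong γ V ∧ ∀ t ∈ Icc (0 : ℝ) 1,
    V t ≠ 0 ∧ velocityTM γ V t = horizontalLift F ⟨γ t, V t⟩ (velocity γ t)

end Manifold

end FinslerBerwald

end

noncomputable section

namespace FinslerBerwald

/-! ### Partial derivatives on conic open sets -/

section PartialDerivatives

variable {n : ℕ} {U : Set (Coord n × Coord n)} {f g : Coord n × Coord n → ℝ}

/-! The core is a pointwise identity: for every y ≠ 0 the Berwald coefficients at (x, y) are the
Christoffel symbols of h at x. They are symmetric in the lower indices, being second fibre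
derivatives of the spray. The condition ∇ᵇπ*h = 0, tested on pulled back coordinate fields, says
that they are compatible with h (`isChristoffelAt_berwaldAt`). Symmetric metric coefficients at a
point are unique (`IsChristoffelAt.unique`).

Consequently the integrand of the average is the same for all y ≠ 0. The average equals that common
value because the volume of the indicatrix is finite and, in positive dimension, nonzero
(`average_indicatrixVolume`). So the average is the flat derivative in a chart plus the Christoffel
symbols of h, hence the Levi-Civita connection.

For the second claim, the local Finsler computation gives N^i_j = ½ ∂Gⁱ/∂yʲ, and Euler's identity
turns this into N^i_j = ᵇΓ^i_jk yᵏ (`nonlinCoeff_eq_sum_berwaldCoeff`). By the pointwise identity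
the equation of horizontal lifts is the linear equation of parallel fields, as long as V ≠ 0
(`isHorizontalLift_iff_isParallelAlong`). Moreover δF/δxʲ = 0 (`IsLocalFinsler.dHor_eq_zero`), so F
is constant along horizontal lifts.

Parallel fields have constant h-norm, which gives both uniqueness and the fact that a nonzero vector
stays nonzero. Existence is a linear ODE whose coefficients are continuous by Koszul's formula; it
is solved on short intervals and the pieces are glued. The resulting transport is linear, bijective
and preserves F. -/

theorem contDiffOn_fderiv_apply (hU : IsOpen U) (hf : ContDiffOn ℝ ∞ f U)
    (v : Coord n × Coord n) : ContDiffOn ℝ ∞ (fun q => fderiv ℝ f q v) U :=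
  (hf.fderiv_of_isOpen hU (by simp)).clm_apply contDiffOn_const

theorem contDiffOn_dX (hU : IsOpen U) (hf : ContDiffOn ℝ ∞ f U) (i : Fin n) :
    ContDiffOn ℝ ∞ (dX i f) U :=
  contDiffOn_fderiv_apply hU hf _

theorem contDiffOn_dY (hU : IsOpen U) (hf : ContDiffOn ℝ ∞ f U) (i : Fin n) :
    ContDiffOn ℝ ∞ (dY i f) U :=
  contDiffOn_fderiv_apply hU hf _

theorem differentiableAt_of_contDiffOn (hU : IsOpen U) (hf : ContDiffOn ℝ ∞ f U)
    {q : Coord n × Coord n} (hq : q ∈ U) : DifferentiableAt ℝ f q :=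
  (hf.contDiffAt (hU.mem_nhds hq)).differentiableAt (by simp)

theorem fderiv_fderiv_comm (hU : IsOpen U) (hf : ContDiffOn ℝ ∞ f U)
    {q : Coord n × Coord n} (hq : q ∈ U) (v w : Coord n × Coord n) :
    fderiv ℝ (fun p => fderiv ℝ f p v) q w = fderiv ℝ (fun p => fderiv ℝ f p w) q v := by
  have hd : DifferentiableAt ℝ (fderiv ℝ f) q :=
    ((hf.fderiv_of_isOpen (m := ∞) hU (by simp)).contDiffAt (hU.mem_nhds hq)).differentiableAt
      (by simp)
  have hs : IsSymmSndFDerivAt ℝ f q :=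
    (hf.contDiffAt (hU.mem_nhds hq)).isSymmSndFDerivAt (by
      rw [minSmoothness_of_isRCLikeNormedField]; exact WithTop.coe_le_coe.2 (le_top : (2 : ℕ∞) ≤ ⊤))
  have key : ∀ a b : Coord n × Coord n,
      fderiv ℝ (fun p => fderiv ℝ f p a) q b = fderiv ℝ (fderiv ℝ f) q b a := by
    intro a b
    rw [fderiv_clm_apply hd (differentiableAt_const _)]
    simp
  rw [key, key]
  exact hs w v

theorem dY_dY_comm (hU : IsOpen U) (hf : ContDiffOn ℝ ∞ f U)
    {q : Coord n × Coord n} (hq : q ∈ U) (i j : Fin n) :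
    dY i (dY j f) q = dY j (dY i f) q :=
  fderiv_fderiv_comm hU hf hq _ _

theorem dY_dX_comm (hU : IsOpen U) (hf : ContDiffOn ℝ ∞ f U)
    {q : Coord n × Coord n} (hq : q ∈ U) (i j : Fin n) :
    dY i (dX j f) q = dX j (dY i f) q :=
  fderiv_fderiv_comm hU hf hq _ _

theorem dX_congr (hU : IsOpen U) (h : EqOn f g U) {q : Coord n × Coord n} (hq : q ∈ U)
    (i : Fin n) : dX i f q = dX i g q := by
  unfold dX
  rw [(h.eventuallyEq_of_mem (hU.mem_nhds hq)).fderiv_eq]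

theorem dY_congr (hU : IsOpen U) (h : EqOn f g U) {q : Coord n × Coord n} (hq : q ∈ U)
    (i : Fin n) : dY i f q = dY i g q := by
  unfold dY
  rw [(h.eventuallyEq_of_mem (hU.mem_nhds hq)).fderiv_eq]

theorem dY_const_mul {q : Coord n × Coord n} (c : ℝ) (hf : DifferentiableAt ℝ f q)
    (i : Fin n) : dY i (fun p => c * f p) q = c * dY i f q := by
  unfold dY
  rw [fderiv_const_mul hf]
  simp

theorem dX_mul {q : Coord n × Coord n} (hf : DifferentiableAt ℝ f q)
    (hg : DifferentiableAt ℝ g q) (i : Fin n) :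
    dX i (fun p => f p * g p) q = f q * dX i g q + dX i f q * g q := by
  unfold dX
  rw [fderiv_fun_mul hf hg]
  simp [mul_comm]

theorem dY_mul {q : Coord n × Coord n} (hf : DifferentiableAt ℝ f q)
    (hg : DifferentiableAt ℝ g q) (i : Fin n) :
    dY i (fun p => f p * g p) q = f q * dY i g q + dY i f q * g q := by
  unfold dY
  rw [fderiv_fun_mul hf hg]
  simp [mul_comm]

theorem dX_sum {ι : Type*} (s : Finset ι) {φ : ι → Coord n × Coord n → ℝ}
    {q : Coord n × Coord n} (hφ : ∀ a ∈ s, DifferentiableAt ℝ (φ a) q) (i : Fin n) :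
    dX i (fun p => ∑ a ∈ s, φ a p) q = ∑ a ∈ s, dX i (φ a) q := by
  unfold dX
  rw [fderiv_fun_sum hφ]
  simp

theorem dY_sum {ι : Type*} (s : Finset ι) {φ : ι → Coord n × Coord n → ℝ}
    {q : Coord n × Coord n} (hφ : ∀ a ∈ s, DifferentiableAt ℝ (φ a) q) (i : Fin n) :
    dY i (fun p => ∑ a ∈ s, φ a p) q = ∑ a ∈ s, dY i (φ a) q := by
  unfold dY
  rw [fderiv_fun_sum hφ]
  simp

/-- The `k`-th fibre coordinate as a continuous linear form. -/
def fibreCoord (k : Fin n) : Coord n × Coord n →L[ℝ] ℝ :=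
  (EuclideanSpace.proj k : Coord n →L[ℝ] ℝ).comp (ContinuousLinearMap.snd ℝ (Coord n) (Coord n))

@[simp] theorem fibreCoord_apply (k : Fin n) (q : Coord n × Coord n) :
    fibreCoord k q = q.2 k := rfl

theorem contDiff_fibreCoord (k : Fin n) :
    ContDiff ℝ ∞ (fun q : Coord n × Coord n => q.2 k) :=
  (fibreCoord k).contDiff

theorem differentiableAt_fibreCoord (k : Fin n) (q : Coord n × Coord n) :
    DifferentiableAt ℝ (fun q : Coord n × Coord n => q.2 k) q :=
  (fibreCoord k).differentiableAt

theorem dX_fibreCoord (i k : Fin n) (q : Coord n × Coord n) :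
    dX i (fun p : Coord n × Coord n => p.2 k) q = 0 := by
  change fderiv ℝ (fibreCoord k) q _ = 0
  rw [ContinuousLinearMap.fderiv]
  simp

theorem dY_fibreCoord (i k : Fin n) (q : Coord n × Coord n) :
    dY i (fun p : Coord n × Coord n => p.2 k) q = if k = i then 1 else 0 := by
  change fderiv ℝ (fibreCoord k) q _ = _
  rw [ContinuousLinearMap.fderiv]
  simp

/-- `U` is stable under positive dilations of the fibre variable. -/
def IsConic (U : Set (Coord n × Coord n)) : Prop :=
  ∀ q ∈ U, ∀ l : ℝ, 0 < l → (q.1, l • q.2) ∈ U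

/-- `f` is positively homogeneous of degree `k` in the fibre variable on `U`. -/
def HomogeneousOn (k : ℕ) (f : Coord n × Coord n → ℝ) (U : Set (Coord n × Coord n)) : Prop :=
  ∀ q ∈ U, ∀ l : ℝ, 0 < l → f (q.1, l • q.2) = l ^ k * f q

/-- The fibrewise dilation as a continuous linear map. -/
def fibreDilation (l : ℝ) : Coord n × Coord n →L[ℝ] Coord n × Coord n :=
  (ContinuousLinearMap.id ℝ (Coord n)).prodMap (l • ContinuousLinearMap.id ℝ (Coord n))

/-- Differentiate f ∘ δ_l = l^k f, with δ_l the fibre dilation. Horizontal directions are fixed by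
δ_l and keep the degree k; vertical ones are scaled by l and lower it by one. -/
theorem HomogeneousOn.fderiv_comp {k : ℕ} (hU : IsOpen U) (hc : IsConic U)
    (hs : ContDiffOn ℝ ∞ f U) (hf : HomogeneousOn k f U) {q : Coord n × Coord n} (hq : q ∈ U)
    {l : ℝ} (hl : 0 < l) (v : Coord n × Coord n) :
    fderiv ℝ f (q.1, l • q.2) (v.1, l • v.2) = l ^ k * fderiv ℝ f q v := by
  have h1 : HasFDerivAt (f ∘ fibreDilation l)
      ((fderiv ℝ f (q.1, l • q.2)).comp (fibreDilation l)) q :=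
    HasFDerivAt.comp q (f := fibreDilation l) (g := f)
      (differentiableAt_of_contDiffOn hU hs (hc q hq l hl)).hasFDerivAt
      (fibreDilation l).hasFDerivAt
  have h2 : HasFDerivAt (f ∘ fibreDilation l) (l ^ k • fderiv ℝ f q) q := by
    refine ((differentiableAt_of_contDiffOn hU hs hq).hasFDerivAt.const_smul (l ^ k)
      ).congr_of_eventuallyEq ?_
    filter_upwards [hU.mem_nhds hq] with p hp
    exact hf p hp l hl
  have := congrArg (fun T => T v) (h1.unique h2)
  simpa [fibreDilation, Prod.map] using this

theorem HomogeneousOn.dX {k : ℕ} (hU : IsOpen U) (hc : IsConic U)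
    (hs : ContDiffOn ℝ ∞ f U) (hf : HomogeneousOn k f U) (i : Fin n) :
    HomogeneousOn k (dX i f) U := by
  intro q hq l hl
  have h := hf.fderiv_comp hU hc hs hq hl (EuclideanSpace.single i 1, 0)
  rwa [smul_zero] at h

theorem HomogeneousOn.dY {k : ℕ} (hU : IsOpen U) (hc : IsConic U)
    (hs : ContDiffOn ℝ ∞ f U) (hf : HomogeneousOn (k + 1) f U) (i : Fin n) :
    HomogeneousOn k (dY i f) U := by
  intro q hq l hl
  have h := hf.fderiv_comp hU hc hs hq hl (0, EuclideanSpace.single i 1)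
  have h2 : ((0 : Coord n), l • (EuclideanSpace.single i 1 : Coord n))
      = l • ((0 : Coord n), (EuclideanSpace.single i 1 : Coord n)) := by simp
  simp only [h2, map_smul, smul_eq_mul, pow_succ] at h
  have hl' := hl.ne'
  unfold FinslerBerwald.dY
  apply mul_left_cancel₀ hl'
  rw [h]
  ring

theorem fderiv_zero_snd (q : Coord n × Coord n) (v : Coord n) :
    fderiv ℝ f q (0, v) = ∑ i, v i * dY i f q := by
  have hv : ((0 : Coord n), v)
      = ∑ i, v i • ((0 : Coord n), (EuclideanSpace.single i 1 : Coord n)) := by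
    have h1 : v = ∑ i, v i • (EuclideanSpace.single i 1 : Coord n) := by
      simpa using ((EuclideanSpace.basisFun (Fin n) ℝ).sum_repr v).symm
    refine Prod.ext ?_ ?_
    · simp [Prod.fst_sum]
    · simpa [Prod.snd_sum] using h1
  rw [hv, map_sum]
  simp only [map_smul, smul_eq_mul]
  rfl

theorem fderiv_snd_zero (q : Coord n × Coord n) (v : Coord n) :
    fderiv ℝ f q (v, 0) = ∑ i, v i * dX i f q := by
  have hv : (v, (0 : Coord n))
      = ∑ i, v i • ((EuclideanSpace.single i 1 : Coord n), (0 : Coord n)) := by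
    have h1 : v = ∑ i, v i • (EuclideanSpace.single i 1 : Coord n) := by
      simpa using ((EuclideanSpace.basisFun (Fin n) ℝ).sum_repr v).symm
    refine Prod.ext ?_ ?_
    · simpa [Prod.fst_sum] using h1
    · simp [Prod.snd_sum]
  rw [hv, map_sum]
  simp only [map_smul, smul_eq_mul]
  rfl

/-- Euler's identity. -/
theorem HomogeneousOn.euler {k : ℕ} (hU : IsOpen U)
    (hs : ContDiffOn ℝ ∞ f U) (hf : HomogeneousOn k f U) {q : Coord n × Coord n} (hq : q ∈ U) :
    ∑ i, q.2 i * FinslerBerwald.dY i f q = k * f q := by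
  rw [← fderiv_zero_snd]
  -- The curve l ↦ f(x, l y) is differentiated at l = 1 in two ways: by the chain rule and from f(x,
  -- l y) = l^k f(x, y).
  have hline : HasDerivAt (fun l : ℝ => (q.1, l • q.2)) ((0 : Coord n), q.2) 1 := by
    have := (hasDerivAt_id (1 : ℝ)).smul_const q.2
    simpa using (hasDerivAt_const (1 : ℝ) q.1).prodMk this
  have h1 : HasDerivAt (fun l : ℝ => f (q.1, l • q.2)) (fderiv ℝ f q (0, q.2)) 1 := by
    have hd : HasFDerivAt f (fderiv ℝ f q) ((fun l : ℝ => (q.1, l • q.2)) 1) := by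
      simpa using (differentiableAt_of_contDiffOn hU hs hq).hasFDerivAt
    exact hd.comp_hasDerivAt (1 : ℝ) hline
  have h2 : HasDerivAt (fun l : ℝ => f (q.1, l • q.2)) (k * f q) 1 := by
    have := (hasDerivAt_pow k (1 : ℝ)).mul_const (f q)
    simp only [one_pow, mul_one] at this
    refine this.congr_of_eventuallyEq ?_
    filter_upwards [lt_mem_nhds (zero_lt_one' ℝ)] with l hl
    exact hf q hq l hl
  exact h1.unique h2

end PartialDerivatives

/-! ### Local identities of Finsler geometry -/

section LocalFinsler

variable {n : ℕ}

/-- The hypotheses on the coordinate expression of a Finsler function on an open conic set. -/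
structure IsLocalFinsler (L : Coord n × Coord n → ℝ) (U : Set (Coord n × Coord n)) : Prop where
  isOpen : IsOpen U
  isConic : IsConic U
  ne_zero : ∀ q ∈ U, q.2 ≠ 0
  nonneg : ∀ q, 0 ≤ L q
  smooth : ContDiffOn ℝ ∞ L U
  homogeneous : HomogeneousOn 1 L U
  posDef : ∀ q ∈ U, (gLow L q).PosDef

variable {L : Coord n × Coord n → ℝ} {U : Set (Coord n × Coord n)}

/-- The vertical derivative `∂g_ij/∂yᵏ` of the fundamental tensor. -/
def dgLow (L : Coord n × Coord n → ℝ) (q : Coord n × Coord n) (i j k : Fin n) : ℝ :=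
  dY k (fun p => gLow L p i j) q

/-- The formal Christoffel symbols of the first kind. -/
def christoffelLow (L : Coord n × Coord n → ℝ) (q : Coord n × Coord n) (m j k : Fin n) : ℝ :=
  (1 / 2) * (dX k (fun p => gLow L p m j) q - dX m (fun p => gLow L p j k) q
      + dX j (fun p => gLow L p m k) q)

theorem contDiffOn_matrix_det {m : Type*} [Fintype m] [DecidableEq m]
    {E : Type*} [NormedAddCommGroup E] [NormedSpace ℝ E] {s : Set E} {k : ℕ∞ω}
    {A : E → Matrix m m ℝ} (hA : ∀ i j, ContDiffOn ℝ k (fun q => A q i j) s) :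
    ContDiffOn ℝ k (fun q => (A q).det) s := by
  simp only [Matrix.det_apply]
  refine ContDiffOn.sum fun σ _ => ?_
  exact (contDiffOn_prod fun i _ => hA _ _).const_smul _

/-- Cramer's rule: the entries are polynomials in those of A, divided by det A. -/
theorem contDiffOn_matrix_inv {m : Type*} [Fintype m] [DecidableEq m]
    {E : Type*} [NormedAddCommGroup E] [NormedSpace ℝ E] {s : Set E} {k : ℕ∞ω}
    {A : E → Matrix m m ℝ} (hA : ∀ i j, ContDiffOn ℝ k (fun q => A q i j) s)
    (hdet : ∀ q ∈ s, (A q).det ≠ 0) (i j : m) :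
    ContDiffOn ℝ k (fun q => (A q)⁻¹ i j) s := by
  simp only [Matrix.inv_def, Ring.inverse_eq_inv', Matrix.smul_apply, Matrix.adjugate_apply,
    smul_eq_mul]
  refine ((contDiffOn_matrix_det hA).inv hdet).mul (contDiffOn_matrix_det fun a b => ?_)
  simp only [Matrix.updateRow_apply]
  split_ifs
  · exact contDiffOn_const
  · exact hA a b

namespace IsLocalFinsler

variable (hL : IsLocalFinsler L U)
include hL

theorem contDiffOn_sq : ContDiffOn ℝ ∞ (fun p => L p ^ 2) U := hL.smooth.pow 2

theorem homogeneousOn_sq : HomogeneousOn 2 (fun p => L p ^ 2) U := by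
  intro q hq l hl
  simp only [hL.homogeneous q hq l hl]
  ring

theorem contDiffOn_gLow (i j : Fin n) : ContDiffOn ℝ ∞ (fun p => gLow L p i j) U :=
  contDiffOn_const.mul (contDiffOn_dY hL.isOpen (contDiffOn_dY hL.isOpen hL.contDiffOn_sq j) i)

theorem homogeneousOn_gLow (i j : Fin n) : HomogeneousOn 0 (fun p => gLow L p i j) U := by
  intro q hq l hl
  have h1 := HomogeneousOn.dY hL.isOpen hL.isConic hL.contDiffOn_sq hL.homogeneousOn_sq j
  have h2 := HomogeneousOn.dY hL.isOpen hL.isConic (contDiffOn_dY hL.isOpen hL.contDiffOn_sq j)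
    h1 i q hq l hl
  simp only [gLow, Matrix.of_apply, h2]
  ring

theorem gLow_symm {q : Coord n × Coord n} (hq : q ∈ U) (i j : Fin n) :
    gLow L q i j = gLow L q j i := by
  simp only [gLow, Matrix.of_apply]
  rw [dY_dY_comm hL.isOpen hL.contDiffOn_sq hq]

theorem contDiffOn_dgLow (i j k : Fin n) : ContDiffOn ℝ ∞ (fun p => dgLow L p i j k) U :=
  contDiffOn_dY hL.isOpen (hL.contDiffOn_gLow i j) k

theorem dgLow_swap₁₂ {q : Coord n × Coord n} (hq : q ∈ U) (i j k : Fin n) :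
    dgLow L q i j k = dgLow L q j i k :=
  dY_congr hL.isOpen (fun _ hp => hL.gLow_symm hp i j) hq k

/-- ∂g_ij/∂yᵏ is half a third fibre derivative of L². With `dgLow_swap₁₂` this gives symmetry in all
three indices. -/
theorem dgLow_swap₁₃ {q : Coord n × Coord n} (hq : q ∈ U) (i j k : Fin n) :
    dgLow L q i j k = dgLow L q k j i := by
  have hs := contDiffOn_dY hL.isOpen hL.contDiffOn_sq j
  have hd : ∀ a : Fin n, DifferentiableAt ℝ (dY a (dY j (fun p => L p ^ 2))) q := fun a =>
    differentiableAt_of_contDiffOn hL.isOpen (contDiffOn_dY hL.isOpen hs a) hq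
  simp only [dgLow, gLow, Matrix.of_apply]
  rw [dY_const_mul _ (hd i), dY_const_mul _ (hd k), dY_dY_comm hL.isOpen hs hq]

theorem dgLow_swap₂₃ {q : Coord n × Coord n} (hq : q ∈ U) (i j k : Fin n) :
    dgLow L q i j k = dgLow L q i k j := by
  rw [hL.dgLow_swap₁₂ hq, hL.dgLow_swap₁₃ hq, hL.dgLow_swap₁₂ hq]

/-- Euler's identity for g_ij, which has degree 0. By total symmetry the contraction with y vanishes
in the other two slots as well. -/
theorem sum_dgLow₃ {q : Coord n × Coord n} (hq : q ∈ U) (i j : Fin n) :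
    ∑ k, dgLow L q i j k * q.2 k = 0 := by
  have := (hL.homogeneousOn_gLow i j).euler hL.isOpen (hL.contDiffOn_gLow i j) hq
  simpa [dgLow, mul_comm] using this

theorem sum_dgLow₂ {q : Coord n × Coord n} (hq : q ∈ U) (i k : Fin n) :
    ∑ j, dgLow L q i j k * q.2 j = 0 := by
  simp only [fun j => hL.dgLow_swap₂₃ hq i j k, hL.sum_dgLow₃ hq]

theorem sum_dgLow₁ {q : Coord n × Coord n} (hq : q ∈ U) (j k : Fin n) :
    ∑ i, dgLow L q i j k * q.2 i = 0 := by
  simp only [fun i => hL.dgLow_swap₁₃ hq i j k, hL.sum_dgLow₃ hq]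

theorem sum_gLow {q : Coord n × Coord n} (hq : q ∈ U) (i : Fin n) :
    ∑ j, gLow L q i j * q.2 j = (1 / 2) * dY i (fun p => L p ^ 2) q := by
  have h1 := HomogeneousOn.dY hL.isOpen hL.isConic hL.contDiffOn_sq hL.homogeneousOn_sq i
  have h2 := h1.euler hL.isOpen (contDiffOn_dY hL.isOpen hL.contDiffOn_sq i) hq
  simp only [Nat.cast_one, one_mul] at h2
  rw [← h2, Finset.mul_sum]
  refine Finset.sum_congr rfl fun j _ => ?_
  rw [hL.gLow_symm hq]
  simp only [gLow, Matrix.of_apply]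
  ring

theorem sum_sum_gLow {q : Coord n × Coord n} (hq : q ∈ U) :
    ∑ i, (∑ j, gLow L q i j * q.2 j) * q.2 i = L q ^ 2 := by
  have h2 := hL.homogeneousOn_sq.euler hL.isOpen hL.contDiffOn_sq hq
  simp only [Nat.cast_ofNat] at h2
  simp only [hL.sum_gLow hq]
  have : L q ^ 2 = (1 / 2) * (2 * L q ^ 2) := by ring
  rw [this, ← h2, Finset.mul_sum]
  refine Finset.sum_congr rfl fun j _ => ?_
  ring

/-- L² = g_ij yⁱ yʲ > 0 by positive definiteness, and L ≥ 0. -/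
theorem pos {q : Coord n × Coord n} (hq : q ∈ U) : 0 < L q := by
  have hne : (q.2 : Fin n → ℝ) ≠ 0 := fun h0 => hL.ne_zero q hq (by ext i; exact congrFun h0 i)
  have h := (hL.posDef q hq).dotProduct_mulVec_pos hne
  have h2 : 0 < L q ^ 2 := by
    rw [← hL.sum_sum_gLow hq]
    simpa [dotProduct, Matrix.mulVec, mul_comm] using h
  exact lt_of_le_of_ne (hL.nonneg q) fun h0 => by simp [← h0] at h2

theorem det_ne_zero {q : Coord n × Coord n} (hq : q ∈ U) : (gLow L q).det ≠ 0 :=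
  ((Matrix.isUnit_iff_isUnit_det _).1 (hL.posDef q hq).isUnit).ne_zero

theorem contDiffOn_gUp (i j : Fin n) : ContDiffOn ℝ ∞ (fun p => gUp L p i j) U :=
  contDiffOn_matrix_inv hL.contDiffOn_gLow (fun _ hq => hL.det_ne_zero hq) i j

theorem homogeneousOn_gUp (i j : Fin n) : HomogeneousOn 0 (fun p => gUp L p i j) U := by
  intro q hq l hl
  have : gLow L (q.1, l • q.2) = gLow L q := by
    ext a b
    simpa using hL.homogeneousOn_gLow a b q hq l hl
  simp [gUp, this]

theorem sum_gLow_gUp {q : Coord n × Coord n} (hq : q ∈ U) (i j : Fin n) :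
    ∑ s, gLow L q i s * gUp L q s j = if i = j then 1 else 0 := by
  have h := Matrix.mul_nonsing_inv (gLow L q) (isUnit_iff_ne_zero.2 (hL.det_ne_zero hq))
  have := congrFun (congrFun h i) j
  rwa [Matrix.mul_apply, Matrix.one_apply] at this

theorem sum_gUp_gLow {q : Coord n × Coord n} (hq : q ∈ U) (i j : Fin n) :
    ∑ s, gUp L q i s * gLow L q s j = if i = j then 1 else 0 := by
  have h := Matrix.nonsing_inv_mul (gLow L q) (isUnit_iff_ne_zero.2 (hL.det_ne_zero hq))
  have := congrFun (congrFun h i) j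
  rwa [Matrix.mul_apply, Matrix.one_apply] at this

theorem contDiffOn_christoffelLow (m j k : Fin n) :
    ContDiffOn ℝ ∞ (fun p => christoffelLow L p m j k) U := by
  have h := fun a b c => contDiffOn_dX hL.isOpen (hL.contDiffOn_gLow a b) c
  exact contDiffOn_const.mul (((h m j k).sub (h j k m)).add (h m k j))

theorem homogeneousOn_christoffelLow (m j k : Fin n) :
    HomogeneousOn 0 (fun p => christoffelLow L p m j k) U := by
  intro q hq l hl
  have h := fun a b c => HomogeneousOn.dX hL.isOpen hL.isConic (hL.contDiffOn_gLow a b)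
    (hL.homogeneousOn_gLow a b) c q hq l hl
  simp only [christoffelLow, h]
  ring

omit hL in
theorem formalChristoffel_eq (q : Coord n × Coord n) (i j k : Fin n) :
    formalChristoffel L q i j k = ∑ s, gUp L q i s * christoffelLow L q s j k := by
  rw [formalChristoffel, Finset.mul_sum]
  refine Finset.sum_congr rfl fun s _ => ?_
  rw [christoffelLow]
  ring

theorem contDiffOn_formalChristoffel (i j k : Fin n) :
    ContDiffOn ℝ ∞ (fun p => formalChristoffel L p i j k) U := by
  simp only [formalChristoffel_eq]
  exact ContDiffOn.sum fun s _ =>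
    (hL.contDiffOn_gUp i s).mul (hL.contDiffOn_christoffelLow s j k)

theorem contDiffOn_sprayCoeff (i : Fin n) : ContDiffOn ℝ ∞ (fun p => sprayCoeff L p i) U := by
  unfold sprayCoeff
  exact ContDiffOn.sum fun s _ => ContDiffOn.sum fun k _ =>
    ((hL.contDiffOn_formalChristoffel i s k).mul (contDiff_fibreCoord s).contDiffOn).mul
      (contDiff_fibreCoord k).contDiffOn

theorem homogeneousOn_sprayCoeff (i : Fin n) :
    HomogeneousOn 2 (fun p => sprayCoeff L p i) U := by
  intro q hq l hl
  have h1 : ∀ j k, formalChristoffel L (q.1, l • q.2) i j k = formalChristoffel L q i j k := by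
    intro j k
    simp only [formalChristoffel_eq]
    refine Finset.sum_congr rfl fun s _ => ?_
    have e1 := hL.homogeneousOn_gUp i s q hq l hl
    have e2 := hL.homogeneousOn_christoffelLow s j k q hq l hl
    simp only [pow_zero, one_mul] at e1 e2
    rw [e1, e2]
  simp only [sprayCoeff, h1, Finset.mul_sum]
  refine Finset.sum_congr rfl fun s _ => Finset.sum_congr rfl fun k _ => ?_
  simp
  ring

theorem sum_gLow_formalChristoffel {q : Coord n × Coord n} (hq : q ∈ U) (m j k : Fin n) :
    ∑ i, gLow L q m i * formalChristoffel L q i j k = christoffelLow L q m j k := by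
  simp only [formalChristoffel_eq, Finset.mul_sum]
  rw [Finset.sum_comm]
  simp only [← mul_assoc, ← Finset.sum_mul, hL.sum_gLow_gUp hq]
  simp

/-- Lowering the index removes the inverse matrix, so that differentiating the spray along the fibre
never requires the derivative of g^ij. -/
theorem sum_gLow_sprayCoeff {q : Coord n × Coord n} (hq : q ∈ U) (m : Fin n) :
    ∑ i, gLow L q m i * sprayCoeff L q i
      = ∑ j, ∑ k, christoffelLow L q m j k * q.2 j * q.2 k := by
  simp only [sprayCoeff, Finset.mul_sum]
  rw [Finset.sum_comm]
  refine Finset.sum_congr rfl fun j _ => ?_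
  rw [Finset.sum_comm]
  refine Finset.sum_congr rfl fun k _ => ?_
  rw [← hL.sum_gLow_formalChristoffel hq, Finset.sum_mul, Finset.sum_mul]
  refine Finset.sum_congr rfl fun i _ => ?_
  ring

theorem christoffelLow_symm {q : Coord n × Coord n} (hq : q ∈ U) (m j k : Fin n) :
    christoffelLow L q m j k = christoffelLow L q m k j := by
  have : dX m (fun p => gLow L p j k) q = dX m (fun p => gLow L p k j) q :=
    dX_congr hL.isOpen (fun p hp => hL.gLow_symm hp j k) hq m
  rw [christoffelLow, christoffelLow, this]
  ring

/-- The x-derivative of `sum_dgLow₂`, in which the factor yʲ is constant. -/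
theorem sum_dX_dgLow {q : Coord n × Coord n} (hq : q ∈ U) (a m l : Fin n) :
    ∑ j, dX a (fun p => dgLow L p m j l) q * q.2 j = 0 := by
  have hd := fun j => differentiableAt_of_contDiffOn hL.isOpen (hL.contDiffOn_dgLow m j l) hq
  have h0 : dX a (fun p => ∑ j, dgLow L p m j l * p.2 j) q = 0 := by
    rw [dX_congr (g := fun _ => 0) hL.isOpen (fun p hp => hL.sum_dgLow₂ hp m l) hq]
    simp [dX]
  rw [dX_sum _ fun j _ => (hd j).fun_mul (differentiableAt_fibreCoord j q)] at h0
  rw [← h0]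
  refine Finset.sum_congr rfl fun j _ => ?_
  rw [dX_mul (hd j) (differentiableAt_fibreCoord j q), dX_fibreCoord]
  ring

theorem dY_christoffelLow {q : Coord n × Coord n} (hq : q ∈ U) (m j k l : Fin n) :
    dY l (fun p => christoffelLow L p m j k) q
      = (1 / 2) * (dX k (fun p => dgLow L p m j l) q - dX m (fun p => dgLow L p j k l) q
        + dX j (fun p => dgLow L p m k l) q) := by
  have hd := fun a b c => differentiableAt_of_contDiffOn hL.isOpen
    (contDiffOn_dX hL.isOpen (hL.contDiffOn_gLow a b) c) hq
  have hc := fun a b c => dY_dX_comm hL.isOpen (hL.contDiffOn_gLow a b) hq l c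
  have h1 : dY l (fun p => christoffelLow L p m j k) q
      = (1 / 2) * (dY l (dX k fun p => gLow L p m j) q - dY l (dX m fun p => gLow L p j k) q
        + dY l (dX j fun p => gLow L p m k) q) := by
    simp only [christoffelLow]
    rw [dY_const_mul _ (((hd m j k).fun_sub (hd j k m)).fun_add (hd m k j))]
    unfold dY
    rw [fderiv_fun_add ((hd m j k).fun_sub (hd j k m)) (hd m k j),
      fderiv_fun_sub (hd m j k) (hd j k m)]
    simp
  rw [h1, hc, hc, hc]
  rfl

/-- Each of the three terms is an x-derivative of ∂g/∂y with one free index contracted with y, so it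
vanishes by `sum_dX_dgLow`. -/
theorem sum_dY_christoffelLow {q : Coord n × Coord n} (hq : q ∈ U) (m l : Fin n) :
    ∑ j, ∑ k, dY l (fun p => christoffelLow L p m j k) q * q.2 j * q.2 k = 0 := by
  have e : ∀ j k, dY l (fun p => christoffelLow L p m j k) q * q.2 j * q.2 k
      = (1 / 2) * ((dX k (fun p => dgLow L p m j l) q * q.2 j) * q.2 k
        - (dX m (fun p => dgLow L p j k l) q * q.2 k) * q.2 j
        + (dX j (fun p => dgLow L p m k l) q * q.2 k) * q.2 j) := by
    intro j k
    rw [hL.dY_christoffelLow hq]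
    ring
  simp only [e, ← Finset.mul_sum, Finset.sum_add_distrib, Finset.sum_sub_distrib,
    ← Finset.sum_mul, hL.sum_dX_dgLow hq]
  rw [Finset.sum_comm]
  simp only [← Finset.sum_mul, hL.sum_dX_dgLow hq]
  simp

/-- Differentiate `sum_gLow_sprayCoeff` along yˡ. On the right only the factors y contribute,
equally by symmetry of the Christoffel symbols, whence the 2; the derivative of g on the left gives
the subtracted term. -/
theorem sum_gLow_dY_sprayCoeff {q : Coord n × Coord n} (hq : q ∈ U) (m l : Fin n) :
    ∑ i, gLow L q m i * dY l (fun p => sprayCoeff L p i) q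
      = 2 * ∑ k, christoffelLow L q m l k * q.2 k
        - ∑ a, dgLow L q m a l * sprayCoeff L q a := by
  have hg := fun i => differentiableAt_of_contDiffOn hL.isOpen (hL.contDiffOn_gLow m i) hq
  have hG := fun i => differentiableAt_of_contDiffOn hL.isOpen (hL.contDiffOn_sprayCoeff i) hq
  have hC := fun j k =>
    differentiableAt_of_contDiffOn hL.isOpen (hL.contDiffOn_christoffelLow m j k) hq
  have hy := fun j => differentiableAt_fibreCoord (n := n) j q
  have h := dY_congr hL.isOpen (fun p hp => hL.sum_gLow_sprayCoeff hp m) hq l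
  rw [dY_sum _ fun i _ => (hg i).fun_mul (hG i)] at h
  simp only [fun i => dY_mul (hg i) (hG i) l, Finset.sum_add_distrib] at h
  have hr : dY l (fun p => ∑ j, ∑ k, christoffelLow L p m j k * p.2 j * p.2 k) q
      = 2 * ∑ k, christoffelLow L q m l k * q.2 k := by
    rw [dY_sum _ fun j _ => DifferentiableAt.fun_sum fun k _ =>
      ((hC j k).fun_mul (hy j)).fun_mul (hy k)]
    have e : ∀ j, dY l (fun p => ∑ k, christoffelLow L p m j k * p.2 j * p.2 k) q
        = ∑ k, (christoffelLow L q m j k * q.2 j * (if k = l then 1 else 0)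
          + christoffelLow L q m j k * (if j = l then 1 else 0) * q.2 k
          + dY l (fun p => christoffelLow L p m j k) q * q.2 j * q.2 k) := by
      intro j
      rw [dY_sum _ fun k _ => ((hC j k).fun_mul (hy j)).fun_mul (hy k)]
      refine Finset.sum_congr rfl fun k _ => ?_
      rw [dY_mul ((hC j k).fun_mul (hy j)) (hy k), dY_mul (hC j k) (hy j), dY_fibreCoord,
        dY_fibreCoord]
      ring
    simp only [e, Finset.sum_add_distrib, hL.sum_dY_christoffelLow hq]
    have e1 : ∑ j, ∑ k, christoffelLow L q m j k * q.2 j * (if k = l then 1 else 0)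
        = ∑ k, christoffelLow L q m l k * q.2 k := by
      simp only [mul_ite, mul_one, mul_zero, Finset.sum_ite_eq', Finset.mem_univ, if_true]
      exact Finset.sum_congr rfl fun j _ => by rw [hL.christoffelLow_symm hq]
    have e2 : ∑ j, ∑ k, christoffelLow L q m j k * (if j = l then 1 else 0) * q.2 k
        = ∑ k, christoffelLow L q m l k * q.2 k := by
      rw [Finset.sum_comm]
      simp
    rw [e1, e2]
    ring
  rw [hr] at h
  simp only [← dgLow.eq_1] at h
  linarith

theorem dY_sprayCoeff {q : Coord n × Coord n} (hq : q ∈ U) (i l : Fin n) :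
    dY l (fun p => sprayCoeff L p i) q
      = 2 * ∑ k, formalChristoffel L q i l k * q.2 k
        - ∑ m, gUp L q i m * ∑ a, dgLow L q m a l * sprayCoeff L q a := by
  have h1 : dY l (fun p => sprayCoeff L p i) q
      = ∑ m, gUp L q i m * ∑ b, gLow L q m b * dY l (fun p => sprayCoeff L p b) q := by
    simp only [Finset.mul_sum]
    rw [Finset.sum_comm]
    simp only [← mul_assoc, ← Finset.sum_mul, hL.sum_gUp_gLow hq]
    simp
  rw [h1]
  simp only [hL.sum_gLow_dY_sprayCoeff hq, mul_sub, Finset.sum_sub_distrib]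
  congr 1
  simp only [formalChristoffel_eq, Finset.mul_sum, Finset.sum_mul]
  rw [Finset.sum_comm]
  refine Finset.sum_congr rfl fun k _ => Finset.sum_congr rfl fun m _ => ?_
  ring

/-- The factor L of the Cartan tensor cancels the division by L in `nonlinCoeff`. What is left is
half the expression in `dY_sprayCoeff`. -/
theorem nonlinCoeff_eq {q : Coord n × Coord n} (hq : q ∈ U) (i j : Fin n) :
    nonlinCoeff L q i j
      = ∑ k, formalChristoffel L q i j k * q.2 k
        - (1 / 2) * ∑ m, gUp L q i m * ∑ a, dgLow L q m a j * sprayCoeff L q a := by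
  have hp := (hL.pos hq).ne'
  rw [nonlinCoeff]
  congr 1
  have e : ∀ k, ∑ r, ∑ s, cartanUp L q i j k * formalChristoffel L q k r s * q.2 r * q.2 s
      = L q * ((1 / 2) * ∑ m, gUp L q i m * (dgLow L q m k j * sprayCoeff L q k)) := by
    intro k
    have e1 : cartanUp L q i j k = L q * ((1 / 2) * ∑ m, gUp L q i m * dgLow L q m k j) := by
      simp only [cartanUp, cartanLow, Finset.mul_sum]
      refine Finset.sum_congr rfl fun m _ => ?_
      rw [hL.dgLow_swap₂₃ hq m k j, dgLow]
      ring
    have e2 : ∑ r, ∑ s, cartanUp L q i j k * formalChristoffel L q k r s * q.2 r * q.2 s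
        = cartanUp L q i j k * sprayCoeff L q k := by
      simp only [sprayCoeff, Finset.mul_sum, mul_assoc]
    rw [e2, e1]
    simp only [mul_assoc, Finset.sum_mul]
  simp only [e, ← Finset.mul_sum]
  rw [mul_div_cancel_left₀ _ hp, Finset.sum_comm]
  simp only [← Finset.mul_sum]

theorem nonlinCoeff_eq_cartanNonlinCoeff {q : Coord n × Coord n} (hq : q ∈ U) (i j : Fin n) :
    nonlinCoeff L q i j = cartanNonlinCoeff L q i j := by
  rw [cartanNonlinCoeff, hL.nonlinCoeff_eq hq, hL.dY_sprayCoeff hq]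
  ring

theorem berwaldCoeff_eq {q : Coord n × Coord n} (hq : q ∈ U) (i j k : Fin n) :
    berwaldCoeff L q i j k = (1 / 2) * dY k (dY j fun p => sprayCoeff L p i) q :=
  dY_const_mul _ (differentiableAt_of_contDiffOn hL.isOpen
    (contDiffOn_dY hL.isOpen (hL.contDiffOn_sprayCoeff i) j) hq) k

theorem berwaldCoeff_symm {q : Coord n × Coord n} (hq : q ∈ U) (i j k : Fin n) :
    berwaldCoeff L q i j k = berwaldCoeff L q i k j := by
  rw [hL.berwaldCoeff_eq hq, hL.berwaldCoeff_eq hq,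
    dY_dY_comm hL.isOpen (hL.contDiffOn_sprayCoeff i) hq]

/-- N^i_j = ½ ∂Gⁱ/∂yʲ has degree 1 in y, so Euler's identity recovers it from its fibre derivatives,
the Berwald coefficients. -/
theorem nonlinCoeff_eq_sum_berwaldCoeff {q : Coord n × Coord n} (hq : q ∈ U) (i j : Fin n) :
    nonlinCoeff L q i j = ∑ k, berwaldCoeff L q i j k * q.2 k := by
  have hs := hL.contDiffOn_sprayCoeff i
  have h := (HomogeneousOn.dY hL.isOpen hL.isConic hs (hL.homogeneousOn_sprayCoeff i) j).euler
    hL.isOpen (contDiffOn_dY hL.isOpen hs j) hq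
  rw [hL.nonlinCoeff_eq_cartanNonlinCoeff hq, cartanNonlinCoeff]
  simp only [Nat.cast_one, one_mul] at h
  rw [← h, Finset.mul_sum]
  refine Finset.sum_congr rfl fun k _ => ?_
  rw [hL.berwaldCoeff_eq hq]
  ring

/-- After contraction with yᵏ yˢ the first two terms of the Christoffel symbol cancel by symmetry,
and the third is ½ ∂/∂xʲ of g_sk yˢ yᵏ = L². -/
theorem sum_christoffelLow {q : Coord n × Coord n} (hq : q ∈ U) (j : Fin n) :
    ∑ k, ∑ s, christoffelLow L q s j k * q.2 k * q.2 s = (1 / 2) * dX j (fun p => L p ^ 2) q := by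
  have hg := fun a b => differentiableAt_of_contDiffOn hL.isOpen (hL.contDiffOn_gLow a b) hq
  have hy := fun j => differentiableAt_fibreCoord (n := n) j q
  have h1 : dX j (fun p => L p ^ 2) q
      = ∑ s, ∑ k, dX j (fun p => gLow L p s k) q * q.2 k * q.2 s := by
    rw [dX_congr hL.isOpen (fun p hp => (hL.sum_sum_gLow hp).symm) hq]
    have hin : ∀ s, DifferentiableAt ℝ (fun p => ∑ k, gLow L p s k * p.2 k) q := fun s =>
      DifferentiableAt.fun_sum fun k _ => (hg s k).fun_mul (hy k)
    rw [dX_sum _ fun s _ => (hin s).fun_mul (hy s)]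
    refine Finset.sum_congr rfl fun s _ => ?_
    rw [dX_mul (hin s) (hy s), dX_fibreCoord, dX_sum _ fun k _ => (hg s k).fun_mul (hy k),
      mul_zero, zero_add, Finset.sum_mul]
    refine Finset.sum_congr rfl fun k _ => ?_
    rw [dX_mul (hg s k) (hy k), dX_fibreCoord]
    ring
  have e : ∀ k s, christoffelLow L q s j k * q.2 k * q.2 s
      = (1 / 2) * (dX k (fun p => gLow L p s j) q * q.2 k * q.2 s
        - dX s (fun p => gLow L p k j) q * q.2 s * q.2 k
        + dX j (fun p => gLow L p s k) q * q.2 k * q.2 s) := by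
    intro k s
    rw [christoffelLow, dX_congr hL.isOpen (fun p hp => hL.gLow_symm hp k j) hq]
    ring
  simp only [e, ← Finset.mul_sum, Finset.sum_add_distrib, Finset.sum_sub_distrib]
  rw [h1]
  congr 1
  rw [Finset.sum_comm (f := fun k s => dX s (fun p => gLow L p k j) q * q.2 s * q.2 k), sub_self,
    zero_add, Finset.sum_comm]

/-- It suffices to treat L² and divide by 2L. Since ½ ∂L²/∂yⁱ = g_is yˢ, the Christoffel part of N
contributes ½ ∂L²/∂xʲ by `sum_christoffelLow`, and the Cartan part contributes nothing. -/
theorem dHor_eq_zero {q : Coord n × Coord n} (hq : q ∈ U) (j : Fin n) : dHor L j L q = 0 := by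
  have hd := differentiableAt_of_contDiffOn hL.isOpen hL.smooth hq
  have hX : dX j (fun p => L p ^ 2) q = 2 * L q * dX j L q := by
    simp only [pow_two]
    rw [dX_mul hd hd]
    ring
  have hY : ∀ i, dY i (fun p => L p ^ 2) q = 2 * L q * dY i L q := by
    intro i
    simp only [pow_two]
    rw [dY_mul hd hd]
    ring
  have h0 : ∑ i, nonlinCoeff L q i j * ((1 / 2) * dY i (fun p => L p ^ 2) q)
      = (1 / 2) * dX j (fun p => L p ^ 2) q := by
    rw [← hL.sum_christoffelLow hq j]
    simp only [← hL.sum_gLow hq, hL.nonlinCoeff_eq hq, sub_mul, Finset.sum_sub_distrib]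
    have e1 : ∑ i, (∑ k, formalChristoffel L q i j k * q.2 k) * ∑ s, gLow L q i s * q.2 s
        = ∑ k, ∑ s, christoffelLow L q s j k * q.2 k * q.2 s := by
      simp only [← hL.sum_gLow_formalChristoffel hq, Finset.sum_mul, Finset.mul_sum]
      conv_rhs => rw [Finset.sum_comm]
      rw [Finset.sum_comm]
      refine Finset.sum_congr rfl fun s _ => ?_
      rw [Finset.sum_comm]
      refine Finset.sum_congr rfl fun k _ => Finset.sum_congr rfl fun i _ => ?_
      rw [hL.gLow_symm hq s i]
      ring
    -- Raising an index with g^im and lowering it with g_is leaves T_m yᵐ. Here T_m contains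
    -- ∂g_ma/∂yʲ, whose contraction with yᵐ is zero.
    have e2 : ∑ i, 1 / 2 * (∑ m, gUp L q i m * ∑ a, dgLow L q m a j * sprayCoeff L q a)
        * ∑ s, gLow L q i s * q.2 s = 0 := by
      have e3 : ∀ T : Fin n → ℝ, ∑ i, (1 / 2 * ∑ m, gUp L q i m * T m) *
          ∑ s, gLow L q i s * q.2 s = (1 / 2) * ∑ m, T m * q.2 m := by
        intro T
        have e4 : ∀ i, (1 / 2 * ∑ m, gUp L q i m * T m) * ∑ s, gLow L q i s * q.2 s
            = ∑ m, ∑ s, (1 / 2) * T m * q.2 s * (gLow L q s i * gUp L q i m) := by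
          intro i
          simp only [Finset.mul_sum, Finset.sum_mul]
          rw [Finset.sum_comm]
          refine Finset.sum_congr rfl fun m _ => Finset.sum_congr rfl fun s _ => ?_
          rw [hL.gLow_symm hq s i]
          ring
        simp only [e4]
        rw [Finset.sum_comm, Finset.mul_sum]
        refine Finset.sum_congr rfl fun m _ => ?_
        rw [Finset.sum_comm]
        simp only [← Finset.mul_sum, hL.sum_gLow_gUp hq]
        simp [mul_assoc]
      rw [e3]
      simp only [Finset.sum_mul]
      rw [Finset.sum_comm]
      have e5 : ∀ a, ∑ m, dgLow L q m a j * sprayCoeff L q a * q.2 m = 0 := by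
        intro a
        have : ∀ m, dgLow L q m a j * sprayCoeff L q a * q.2 m
            = sprayCoeff L q a * (dgLow L q m a j * q.2 m) := fun m => by ring
        simp only [this, ← Finset.mul_sum, hL.sum_dgLow₁ hq, mul_zero]
      simp only [e5, Finset.sum_const_zero, mul_zero]
    rw [e1, e2, sub_zero]
  have hp := (hL.pos hq).ne'
  have h1 : L q * (∑ i, nonlinCoeff L q i j * dY i L q) = L q * dX j L q := by
    rw [hX] at h0
    simp only [hY] at h0
    rw [Finset.mul_sum]
    have : ∀ i, L q * (nonlinCoeff L q i j * dY i L q)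
        = nonlinCoeff L q i j * (1 / 2 * (2 * L q * dY i L q)) := fun i => by ring
    simp only [this, h0]
    ring
  rw [dHor, mul_left_cancel₀ hp h1, sub_self]

end IsLocalFinsler

end LocalFinsler

/-! ### Natural coordinates -/

section NatChart

variable {n : ℕ} {M : Type*} [TopologicalSpace M] [ChartedSpace (Coord n) M]
  [IsManifold (𝓡 n) ∞ M]

/-- The components of a tangent vector in the chart at `c`. -/
def comp (c : M) {z : M} (v : TangentSpace (𝓡 n) z) : Coord n :=
  (trivializationAt (Coord n) (TangentSpace (𝓡 n) : M → Type _) c ⟨z, v⟩).2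

/-- The vector field which has the constant components `w` in the chart at `c`. -/
def frame (c : M) (w : Coord n) (z : M) : TangentSpace (𝓡 n) z :=
  (trivializationAt (Coord n) (TangentSpace (𝓡 n) : M → Type _) c).symm z w

theorem natChart_apply (c : M) (u : TangentBundle (𝓡 n) M) :
    natChart c u = (extChartAt (𝓡 n) c u.proj, comp c u.2) := by
  rfl

theorem natChart_source (c : M) :
    (natChart (n := n) c).source = {u | u.proj ∈ (chartAt (Coord n) c).source} := by
  ext u
  simp [natChart, TangentBundle.mem_chart_source_iff]

theorem natChart_target (c : M) :
    (natChart (n := n) c).target = (extChartAt (𝓡 n) c).target ×ˢ univ := by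
  rw [natChart, FiberBundle.extChartAt_target, TangentBundle.trivializationAt_baseSet]
  congr 1
  refine inter_eq_left.2 fun p hp => ?_
  have := (extChartAt (𝓡 n) c).map_target hp
  rwa [extChartAt_source] at this

theorem isOpen_natChart_target (c : M) : IsOpen (natChart (n := n) c).target := by
  rw [natChart_target]
  exact (isOpen_extChartAt_target c).prod isOpen_univ

theorem comp_eq (c : M) {z : M} (hz : z ∈ (chartAt (Coord n) c).source)
    (v : TangentSpace (𝓡 n) z) :
    comp c v = (trivializationAt (Coord n) (TangentSpace (𝓡 n) : M → Type _) c).continuousLinearMapAt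
      ℝ z v :=
  (Bundle.Trivialization.continuousLinearMapAt_apply_of_mem (R := ℝ)
    (trivializationAt (Coord n) (TangentSpace (𝓡 n) : M → Type _) c) (by simpa using hz) v).symm

theorem comp_add (c : M) {z : M} (hz : z ∈ (chartAt (Coord n) c).source)
    (v w : TangentSpace (𝓡 n) z) : comp c (v + w) = comp c v + comp c w := by
  simp only [comp_eq c hz, map_add]

theorem comp_smul (c : M) {z : M} (hz : z ∈ (chartAt (Coord n) c).source) (a : ℝ)
    (v : TangentSpace (𝓡 n) z) : comp c (a • v) = a • comp c v := by
  simp only [comp_eq c hz, map_smul]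

/-- The fibre of `TangentSpace` over x is ℝⁿ read in the preferred chart at x, so the coordinate
change is the identity. Formulas at x thus need no transition maps. -/
theorem comp_self (x : M) (v : TangentSpace (𝓡 n) x) : comp x v = v := by
  rw [comp_eq x (mem_chart_source _ x),
    TangentBundle.continuousLinearMapAt_trivializationAt_eq_core (mem_chart_source _ x)]
  exact (tangentBundleCore (𝓡 n) M).coordChange_self _ x (mem_chart_source _ x) v

theorem comp_frame (c : M) {z : M} (hz : z ∈ (chartAt (Coord n) c).source) (w : Coord n) :
    comp c (frame c w z) = w := by
  have := Bundle.Trivialization.apply_mk_symm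
    (trivializationAt (Coord n) (TangentSpace (𝓡 n) : M → Type _) c) (b := z)
    (by simpa using hz) w
  exact congrArg Prod.snd this

theorem frame_comp (c : M) {z : M} (hz : z ∈ (chartAt (Coord n) c).source)
    (v : TangentSpace (𝓡 n) z) : frame c (comp c v) z = v :=
  Bundle.Trivialization.symm_apply_apply_mk
    (trivializationAt (Coord n) (TangentSpace (𝓡 n) : M → Type _) c) (by simpa using hz) v

theorem frame_self (x : M) (w : Coord n) : frame x w x = w := by
  rw [← comp_self x (frame x w x), comp_frame x (mem_chart_source _ x)]

theorem comp_injective (c : M) {z : M} (hz : z ∈ (chartAt (Coord n) c).source) :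
    Function.Injective (comp c : TangentSpace (𝓡 n) z → Coord n) := fun v w h => by
  rw [← frame_comp c hz v, h, frame_comp c hz]

theorem comp_zero (c : M) {z : M} (hz : z ∈ (chartAt (Coord n) c).source) :
    comp c (0 : TangentSpace (𝓡 n) z) = 0 := by
  simp only [comp_eq c hz, map_zero]

theorem comp_eq_zero_iff (c : M) {z : M} (hz : z ∈ (chartAt (Coord n) c).source)
    {v : TangentSpace (𝓡 n) z} : comp c v = 0 ↔ v = 0 :=
  ⟨fun h => comp_injective c hz (h.trans (comp_zero c hz).symm), fun h => h ▸ comp_zero c hz⟩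

theorem extend_eq_frame {x : M} (v : TangentSpace (𝓡 n) x) :
    (FiberBundle.extend (Coord n) v : (z : M) → TangentSpace (𝓡 n) z) = frame x v := by
  have h : comp x v = v := comp_self x v
  funext z
  unfold FiberBundle.extend frame
  exact congrArg _ h

theorem mdifferentiableAt_frame (c : M) {z : M} (hz : z ∈ (chartAt (Coord n) c).source)
    (w : Coord n) :
    MDifferentiableAt (𝓡 n) (𝓡 n).tangent
      (fun y => (⟨y, frame c w y⟩ : TangentBundle (𝓡 n) M)) z := by
  have h := (Bundle.Trivialization.contMDiffAt_section_iff (IB := 𝓡 n) (n := 1)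
    (e := trivializationAt (Coord n) (TangentSpace (𝓡 n) : M → Type _) c)
    (s := frame c w) (x₀ := z) (by simpa using hz)).2 ?_
  · exact h.mdifferentiableAt (by simp)
  · refine (contMDiffAt_const (c := w)).congr_of_eventuallyEq ?_
    filter_upwards [(chartAt (Coord n) c).open_source.mem_nhds hz] with y hy
    exact comp_frame c hy w

theorem symm_proj_mem (c : M) {q : Coord n × Coord n} (hq : q ∈ (natChart (n := n) c).target) :
    ((natChart c).symm q).proj ∈ (chartAt (Coord n) c).source := by
  have := (natChart c).map_target hq
  rwa [natChart_source] at this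

theorem extChartAt_symm_proj (c : M) {q : Coord n × Coord n}
    (hq : q ∈ (natChart (n := n) c).target) :
    extChartAt (𝓡 n) c ((natChart c).symm q).proj = q.1 := by
  have := (natChart c).right_inv hq
  rw [natChart_apply] at this
  exact congrArg Prod.fst this

theorem symm_proj (c : M) {q : Coord n × Coord n} (hq : q ∈ (natChart (n := n) c).target) :
    ((natChart c).symm q).proj = (extChartAt (𝓡 n) c).symm q.1 := by
  rw [← extChartAt_symm_proj c hq, (extChartAt (𝓡 n) c).left_inv]
  rw [extChartAt_source]
  exact symm_proj_mem c hq

theorem comp_symm (c : M) {q : Coord n × Coord n} (hq : q ∈ (natChart (n := n) c).target) :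
    comp c ((natChart c).symm q).2 = q.2 := by
  have := (natChart c).right_inv hq
  rw [natChart_apply] at this
  exact congrArg Prod.snd this

theorem symm_mk (c : M) {p : Coord n} (hp : p ∈ (extChartAt (𝓡 n) c).target) (w : Coord n) :
    (natChart c).symm (p, w)
      = ⟨(extChartAt (𝓡 n) c).symm p, frame c w ((extChartAt (𝓡 n) c).symm p)⟩ := by
  have hz : (extChartAt (𝓡 n) c).symm p ∈ (chartAt (Coord n) c).source := by
    rw [← extChartAt_source (𝓡 n)]
    exact (extChartAt (𝓡 n) c).map_target hp
  have h : (p, w) = natChart c (⟨(extChartAt (𝓡 n) c).symm p,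
      frame c w ((extChartAt (𝓡 n) c).symm p)⟩ : TangentBundle (𝓡 n) M) := by
    rw [natChart_apply]
    refine Prod.ext ?_ ?_
    · exact ((extChartAt (𝓡 n) c).right_inv hp).symm
    · exact (comp_frame c hz w).symm
  rw [h, (natChart c).left_inv]
  rw [natChart_source]
  exact hz

theorem natChart_self (x : M) (v : TangentSpace (𝓡 n) x) :
    natChart x (⟨x, v⟩ : TangentBundle (𝓡 n) M) = (extChartAt (𝓡 n) x x, v) := by
  rw [natChart_apply]
  exact Prod.ext rfl (comp_self x v)

theorem natChart_self_mem (x : M) (v : Coord n) :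
    (extChartAt (𝓡 n) x x, v) ∈ (natChart (n := n) x).target := by
  rw [natChart_target]
  exact ⟨mem_extChartAt_target x, trivial⟩

theorem symm_self (x : M) (v : Coord n) :
    (natChart x).symm (extChartAt (𝓡 n) x x, v) = (⟨x, v⟩ : TangentBundle (𝓡 n) M) := by
  have h : (⟨x, v⟩ : TangentBundle (𝓡 n) M) ∈ (natChart x).source := by
    rw [natChart_source]
    exact mem_chart_source _ x
  exact (congrArg (natChart x).symm (natChart_self x v)).symm.trans ((natChart x).left_inv h)

/-- The coordinate expression of the slit tangent bundle. -/
def slitTarget (c : M) : Set (Coord n × Coord n) :=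
  {q | q ∈ (natChart (n := n) c).target ∧ q.2 ≠ 0}

theorem isOpen_slitTarget (c : M) : IsOpen (slitTarget (n := n) c) :=
  (isOpen_natChart_target c).inter (isOpen_ne_fun continuous_snd continuous_const)

theorem symm_mem_slit (c : M) {q : Coord n × Coord n} (hq : q ∈ slitTarget c) :
    (natChart c).symm q ∈ slit n M := by
  intro h
  apply hq.2
  rw [← comp_symm c hq.1]
  exact (comp_eq_zero_iff c (symm_proj_mem c hq.1)).2 h

theorem self_mem_slitTarget (x : M) {v : Coord n} (hv : v ≠ 0) :
    (extChartAt (𝓡 n) x x, v) ∈ slitTarget (n := n) x :=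
  ⟨natChart_self_mem x v, hv⟩

theorem frame_smul (c : M) {z : M} (hz : z ∈ (chartAt (Coord n) c).source) (a : ℝ)
    (w : Coord n) : frame c (a • w) z = a • frame c w z :=
  comp_injective c hz (by rw [comp_frame c hz, comp_smul c hz, comp_frame c hz])

theorem IsFinsler.isLocalFinsler {F : TangentBundle (𝓡 n) M → ℝ} (hF : IsFinsler F) (c : M) :
    IsLocalFinsler (localExpr F c) (slitTarget c) where
  isOpen := isOpen_slitTarget c
  isConic := fun q hq l hl => by
    refine ⟨?_, smul_ne_zero hl.ne' hq.2⟩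
    have := hq.1
    rw [natChart_target] at this ⊢
    exact ⟨this.1, trivial⟩
  ne_zero := fun q hq => hq.2
  nonneg := fun q => hF.nonneg _
  smooth := by
    have h1 : ContMDiffOn 𝓘(ℝ, Coord n × Coord n) (𝓡 n).tangent ∞ (natChart (n := n) c).symm
        (slitTarget c) :=
      (contMDiffOn_extChartAt_symm (I := (𝓡 n).tangent) (n := ∞)
        (⟨c, 0⟩ : TangentBundle (𝓡 n) M)).mono fun q hq => hq.1
    exact (hF.smooth.comp h1 fun q hq => symm_mem_slit c hq).contDiffOn
  homogeneous := fun q hq l hl => by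
    have hp : q.1 ∈ (extChartAt (𝓡 n) c).target := by
      have := hq.1
      rw [natChart_target] at this
      exact this.1
    have hz : (extChartAt (𝓡 n) c).symm q.1 ∈ (chartAt (Coord n) c).source := by
      rw [← extChartAt_source (𝓡 n)]
      exact (extChartAt (𝓡 n) c).map_target hp
    rw [pow_one, localExpr, localExpr, symm_mk c hp, frame_smul c hz, hF.homogeneous _ _ _ hl]
    congr 2
    exact (symm_mk c hp q.2).symm
  posDef := fun q hq => hF.posDef c q hq.1 hq.2

end NatChart

/-! ### Christoffel symbols in the preferred chart at a point -/

section Christoffel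

variable {n : ℕ} {M : Type*} [TopologicalSpace M] [ChartedSpace (Coord n) M]
  {G : Type*} [NormedAddCommGroup G] [NormedSpace ℝ G]

/-- The differential at `x` of a function on `M`, in the preferred chart at `x`. -/
def chartDeriv (x : M) (f : M → G) : Coord n →L[ℝ] G :=
  fderiv ℝ (fun p => f ((extChartAt (𝓡 n) x).symm p)) (extChartAt (𝓡 n) x x)

theorem differentiableAt_chart {f : M → G} {x : M}
    (hf : MDifferentiableAt (𝓡 n) 𝓘(ℝ, G) f x) :
    DifferentiableAt ℝ (fun p => f ((extChartAt (𝓡 n) x).symm p)) (extChartAt (𝓡 n) x x) := by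
  have h := hf.differentiableWithinAt_writtenInExtChartAt
  have h' : DifferentiableWithinAt ℝ (fun p => f ((extChartAt (𝓡 n) x).symm p))
      (range (𝓡 n)) (extChartAt (𝓡 n) x x) := h
  rwa [ModelWithCorners.range_eq_univ, differentiableWithinAt_univ] at h'

theorem hasFDerivAt_chart {f : M → G} {x : M} (hf : MDifferentiableAt (𝓡 n) 𝓘(ℝ, G) f x) :
    HasFDerivAt (fun p => f ((extChartAt (𝓡 n) x).symm p)) (chartDeriv x f)
      (extChartAt (𝓡 n) x x) :=
  (differentiableAt_chart hf).hasFDerivAt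

theorem mvfderiv_eq_chartDeriv {f : M → G} {x : M} (hf : MDifferentiableAt (𝓡 n) 𝓘(ℝ, G) f x)
    (X : Coord n) : mvfderiv (𝓡 n) f x X = chartDeriv x f X := by
  have h : ∀ X : Coord n, mvfderiv (𝓡 n) f x X
      = fderivWithin ℝ (fun p => f ((extChartAt (𝓡 n) x).symm p)) (range (𝓡 n))
        (extChartAt (𝓡 n) x x) X := fun X => congrArg (fun T : Coord n →L[ℝ] G => T X) hf.mvfderiv
  rw [h, ModelWithCorners.range_eq_univ, fderivWithin_univ]
  rfl

theorem chart_symm_self (x : M) : (extChartAt (𝓡 n) x).symm (extChartAt (𝓡 n) x x) = x :=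
  extChartAt_to_inv x

theorem eventually_chart_symm {p : M → Prop} {x : M} (h : ∀ᶠ z in nhds x, p z) :
    ∀ᶠ q in nhds (extChartAt (𝓡 n) x x), p ((extChartAt (𝓡 n) x).symm q) := by
  have hc := continuousAt_extChartAt_symm (I := 𝓡 n) x
  have ht : Filter.Tendsto (extChartAt (𝓡 n) x).symm (nhds (extChartAt (𝓡 n) x x)) (nhds x) := by
    have := hc.tendsto
    rwa [chart_symm_self] at this
  exact ht.eventually h

theorem chartDeriv_congr {f g : M → G} {x : M} (h : f =ᶠ[nhds x] g) :
    chartDeriv (n := n) x f = chartDeriv x g :=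
  Filter.EventuallyEq.fderiv_eq (eventually_chart_symm h)

theorem chartDeriv_const (x : M) (w : G) : chartDeriv (n := n) x (fun _ => w) = 0 := by
  simp [chartDeriv]

variable [IsManifold (𝓡 n) ∞ M]

theorem hasFDerivAt_comp_symm_proj {f : M → G} {x : M}
    (hf : MDifferentiableAt (𝓡 n) 𝓘(ℝ, G) f x) (y : Coord n) :
    HasFDerivAt (fun q => f ((natChart x).symm q).proj)
      ((chartDeriv x f).comp (ContinuousLinearMap.fst ℝ (Coord n) (Coord n)))
      (extChartAt (𝓡 n) x x, y) := by
  have h2 := HasFDerivAt.comp (extChartAt (𝓡 n) x x, y) (f := Prod.fst) (hasFDerivAt_chart hf)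
    hasFDerivAt_fst
  refine h2.congr_of_eventuallyEq ?_
  filter_upwards [(isOpen_natChart_target x).mem_nhds (natChart_self_mem x y)] with q hq
  simp [symm_proj x hq]

theorem mvfderiv_comp_proj {f : M → ℝ} {x : M} (hf : MDifferentiableAt (𝓡 n) 𝓘(ℝ, ℝ) f x)
    (y : TangentSpace (𝓡 n) x) (X : Coord n × Coord n) :
    mvfderiv (𝓡 n).tangent (fun v : TangentBundle (𝓡 n) M => f v.proj) ⟨x, y⟩ X
      = chartDeriv x f X.1 := by
  have hm : MDifferentiableAt (𝓡 n).tangent 𝓘(ℝ, ℝ)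
      (fun v : TangentBundle (𝓡 n) M => f v.proj) ⟨x, y⟩ :=
    MDifferentiableAt.comp (I' := 𝓡 n) (⟨x, y⟩ : TangentBundle (𝓡 n) M)
      (g := f) (f := fun v : TangentBundle (𝓡 n) M => v.proj) hf
      (mdifferentiableAt_proj (TangentSpace (𝓡 n) : M → Type _))
  have h : ∀ X : Coord n × Coord n,
      mvfderiv (𝓡 n).tangent (fun v : TangentBundle (𝓡 n) M => f v.proj) ⟨x, y⟩ X
      = fderivWithin ℝ (fun q => f ((natChart x).symm q).proj) (range (𝓡 n).tangent)
        (natChart x ⟨x, y⟩) X :=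
    fun X => congrArg (fun T : Coord n × Coord n →L[ℝ] ℝ => T X) hm.mvfderiv
  have e : natChart x (⟨x, y⟩ : TangentBundle (𝓡 n) M)
      = ((extChartAt (𝓡 n) x x, y) : Coord n × Coord n) := natChart_self x y
  rw [h, e, ModelWithCorners.range_eq_univ, fderivWithin_univ,
    (hasFDerivAt_comp_symm_proj hf y).fderiv]
  rfl

theorem mdifferentiableAt_comp_section {Y : (x : M) → TangentSpace (𝓡 n) x} {x : M}
    (hY : MDifferentiableAt (𝓡 n) (𝓡 n).tangent
      (fun z => (⟨z, Y z⟩ : TangentBundle (𝓡 n) M)) x) :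
    MDifferentiableAt (𝓡 n) 𝓘(ℝ, Coord n) (fun z => comp x (Y z)) x :=
  (mdifferentiableAt_section _ _).1 hY

/-- The flat connection given by differentiating the components in the chart at `x`. -/
def flatConnection (x : M) (Y : (z : M) → TangentSpace (𝓡 n) z) (z : M) :
    TangentSpace (𝓡 n) z →L[ℝ] TangentSpace (𝓡 n) z :=
  (chartDeriv z (fun p => comp x (Y p)) : Coord n →L[ℝ] Coord n)

omit [IsManifold (𝓡 n) ∞ M] in
theorem eventually_mem_chart_source (x : M) :
    ∀ᶠ p in nhds x, p ∈ (chartAt (Coord n) x).source :=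
  (chartAt (Coord n) x).open_source.mem_nhds (mem_chart_source _ x)

theorem chartDeriv_comp_add {x : M} {Y Z : (z : M) → TangentSpace (𝓡 n) z}
    (hY : MDifferentiableAt (𝓡 n) (𝓡 n).tangent
      (fun z => (⟨z, Y z⟩ : TangentBundle (𝓡 n) M)) x)
    (hZ : MDifferentiableAt (𝓡 n) (𝓡 n).tangent
      (fun z => (⟨z, Z z⟩ : TangentBundle (𝓡 n) M)) x) :
    chartDeriv (n := n) x (fun p => comp (n := n) x ((Y + Z) p))
      = chartDeriv x (fun p => comp x (Y p)) + chartDeriv x (fun p => comp x (Z p)) := by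
  have h : (fun p => comp (n := n) x ((Y + Z) p))
      =ᶠ[nhds x] fun p => comp x (Y p) + comp x (Z p) := by
    filter_upwards [eventually_mem_chart_source (n := n) x] with p hp
    exact comp_add x hp _ _
  rw [chartDeriv_congr h]
  exact ((hasFDerivAt_chart (mdifferentiableAt_comp_section hY)).add
    (hasFDerivAt_chart (mdifferentiableAt_comp_section hZ))).fderiv

theorem chartDeriv_comp_smul {x : M} {Y : (z : M) → TangentSpace (𝓡 n) z} {g : M → ℝ}
    (hY : MDifferentiableAt (𝓡 n) (𝓡 n).tangent
      (fun z => (⟨z, Y z⟩ : TangentBundle (𝓡 n) M)) x)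
    (hg : MDifferentiableAt (𝓡 n) 𝓘(ℝ, ℝ) g x) :
    chartDeriv (n := n) x (fun p => comp (n := n) x ((g • Y) p))
      = g x • chartDeriv x (fun p => comp x (Y p)) + (chartDeriv x g).smulRight (comp x (Y x)) := by
  have h : (fun p => comp (n := n) x ((g • Y) p)) =ᶠ[nhds x] fun p => g p • comp x (Y p) := by
    filter_upwards [eventually_mem_chart_source (n := n) x] with p hp
    exact comp_smul x hp _ _
  rw [chartDeriv_congr h]
  have := ((hasFDerivAt_chart hg).fun_smul
    (hasFDerivAt_chart (mdifferentiableAt_comp_section hY))).fderiv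
  rw [congrArg (fun z => comp x (Y z)) (chart_symm_self (n := n) x),
    congrArg g (chart_symm_self (n := n) x)] at this
  exact this

/-- The statement is restricted to {x}: at another point z the value has components in the chart at
x but is read as a vector in the chart at z. One point suffices, since the axioms and the difference
tensor are pointwise. -/
theorem isCovariantDerivativeOn_flatConnection (x : M) :
    IsCovariantDerivativeOn (I := 𝓡 n) (Coord n) (flatConnection (n := n) (M := M) x) {x} where
  add {σ σ' y} hσ hσ' hy := by
    obtain rfl : y = x := hy
    exact chartDeriv_comp_add hσ hσ'
  leibniz {σ g y} hσ hg hy := by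
    obtain rfl : y = x := hy
    have h := chartDeriv_comp_smul hσ hg
    rw [comp_self] at h
    ext1 X
    have h2 := congrArg (fun T : Coord n →L[ℝ] Coord n => T X) h
    have h3 : mvfderiv (𝓡 n) g y X = chartDeriv y g X := mvfderiv_eq_chartDeriv hg X
    refine h2.trans ?_
    change g y • _ + chartDeriv y g X • _ = g y • _ + mvfderiv (𝓡 n) g y X • σ y
    rw [h3]
    rfl

theorem chartDeriv_comp_frame (x : M) (w : Coord n) :
    chartDeriv (n := n) x (fun p => comp (n := n) x (frame x w p)) = 0 := by
  rw [← chartDeriv_const x w]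
  refine chartDeriv_congr ?_
  filter_upwards [eventually_mem_chart_source (n := n) x] with p hp
  exact comp_frame x hp w

/-- In the chart at `x` a connection is the sum of the flat connection and its Christoffel
symbols. -/
theorem covariantDerivative_eq
    (D : CovariantDerivative (𝓡 n) (Coord n) (TangentSpace (𝓡 n) : M → Type _))
    {Y : (z : M) → TangentSpace (𝓡 n) z} {x : M}
    (hY : MDifferentiableAt (𝓡 n) (𝓡 n).tangent
      (fun z => (⟨z, Y z⟩ : TangentBundle (𝓡 n) M)) x) (X : TangentSpace (𝓡 n) x) :
    D Y x X = flatConnection x Y x X + D (frame x (Y x)) x X := by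
  have hD := D.isCovariantDerivativeOn (s := {x})
  -- The difference of two connections is tensorial, so Y may be replaced by the coordinate field
  -- with the same value at x, whose flat derivative vanishes.
  have h1 := IsCovariantDerivativeOn.difference_apply hD
    (isCovariantDerivativeOn_flatConnection x) (mem_singleton x) hY
  have h2 := IsCovariantDerivativeOn.difference_apply hD
    (isCovariantDerivativeOn_flatConnection x) (mem_singleton x)
    (mdifferentiableAt_frame x (mem_chart_source _ x) (Y x))
  rw [frame_self x (Y x)] at h2
  have h3 : flatConnection x (frame x (Y x)) x = 0 := chartDeriv_comp_frame x (Y x)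
  rw [h3, sub_zero] at h2
  rw [← h2, h1]
  exact (add_sub_cancel (flatConnection x Y x X) (D.toFun Y x X)).symm

/-- The scalar product `h_x` on `T_xM = ℝⁿ`. -/
def metricAt
    (h : ContMDiffRiemannianMetric (𝓡 n) ∞ (Coord n) (TangentSpace (𝓡 n) : M → Type _)) (x : M) :
    Coord n →L[ℝ] Coord n →L[ℝ] ℝ := h.inner x

/-- The components of `h` in the chart at `c`. -/
def metricComp
    (h : ContMDiffRiemannianMetric (𝓡 n) ∞ (Coord n) (TangentSpace (𝓡 n) : M → Type _)) (c : M)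
    (v w : Coord n) (z : M) : ℝ := h.inner z (frame c v z) (frame c w z)

/-- `Γ v X` are the Christoffel symbols at `x` of a torsion free metric connection. -/
structure IsChristoffelAt
    (h : ContMDiffRiemannianMetric (𝓡 n) ∞ (Coord n) (TangentSpace (𝓡 n) : M → Type _)) (x : M)
    (Γ : Coord n → Coord n → Coord n) : Prop where
  symm : ∀ v X, Γ v X = Γ X v
  compat : ∀ v w X : Coord n,
    chartDeriv x (metricComp h x v w) X
      = metricAt h x (Γ v X) w + metricAt h x v (Γ w X)

variable {h : ContMDiffRiemannianMetric (𝓡 n) ∞ (Coord n) (TangentSpace (𝓡 n) : M → Type _)}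

theorem metricAt_symm (x : M) (v w : Coord n) : metricAt h x v w = metricAt h x w v :=
  h.symm x v w

theorem metricAt_pos (x : M) {v : Coord n} (hv : v ≠ 0) : 0 < metricAt h x v v :=
  h.pos x v hv

/-- The difference B of two solutions is symmetric, while h(B(v, X), w) is skew in v and w. A
trilinear expression symmetric in one pair and skew in an overlapping pair is zero; then take w =
B(v, X). -/
theorem IsChristoffelAt.unique {x : M} {Γ₁ Γ₂ : Coord n → Coord n → Coord n}
    (h₁ : IsChristoffelAt h x Γ₁) (h₂ : IsChristoffelAt h x Γ₂) : Γ₁ = Γ₂ := by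
  set B : Coord n → Coord n → Coord n := fun v X => Γ₁ v X - Γ₂ v X with hB
  have hs : ∀ v X, B v X = B X v := fun v X => by
    simp only [hB]
    rw [h₁.symm v X, h₂.symm v X]
  have ha : ∀ v w X : Coord n, metricAt h x (B v X) w = - metricAt h x (B w X) v := by
    intro v w X
    have e1 := (h₁.compat v w X).symm.trans (h₂.compat v w X)
    rw [metricAt_symm x v, metricAt_symm x v] at e1
    simp only [hB, map_sub, sub_apply]
    linarith
  have hz : ∀ v X w : Coord n, metricAt h x (B v X) w = 0 := by
    intro v X w
    have e1 := ha v w X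
    rw [hs w X] at e1
    have e2 := ha X v w
    rw [hs v w] at e2
    have e3 := ha w X v
    rw [hs X v] at e3
    linarith
  funext v X
  by_contra hne
  exact (metricAt_pos (h := h) x (sub_ne_zero.2 hne)).ne' (hz v X (B v X))

end Christoffel

/-! ### Coordinate frames and the Levi-Civita connection of h -/

section LeviCivita

variable {n : ℕ} {M : Type*} [TopologicalSpace M] [ChartedSpace (Coord n) M]
  [IsManifold (𝓡 n) ∞ M]

/-- A constant vector field on `ℝⁿ`. -/
def constField (v : Coord n) (p : Coord n) : TangentSpace 𝓘(ℝ, Coord n) p := v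

theorem mlieBracket_constField (v w p : Coord n) :
    VectorField.mlieBracket 𝓘(ℝ, Coord n) (constField v) (constField w) p = 0 := by
  rw [← VectorField.mlieBracketWithin_univ, VectorField.mlieBracketWithin_eq_lieBracketWithin]
  change fderivWithin ℝ (fun _ : Coord n => w) univ p v
    - fderivWithin ℝ (fun _ : Coord n => v) univ p w = (0 : Coord n)
  simp

theorem mdifferentiableAt_constField (v p : Coord n) :
    MDifferentiableAt 𝓘(ℝ, Coord n) 𝓘(ℝ, Coord n).tangent
      (fun q => (⟨q, constField v q⟩ : TangentBundle 𝓘(ℝ, Coord n) (Coord n))) p :=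
  ((contMDiffAt_vectorSpace_iff_contDiffAt (n := 1) (V := constField v)).2
    (contDiffAt_const (c := v))).mdifferentiableAt (by simp)

theorem frame_eq_mpullback (c : M) (v : Coord n) {z : M}
    (hz : z ∈ (chartAt (Coord n) c).source) :
    frame c v z = VectorField.mpullback (𝓡 n) 𝓘(ℝ, Coord n) (extChartAt (𝓡 n) c) (constField v) z := by
  set e := trivializationAt (Coord n) (TangentSpace (𝓡 n) : M → Type _) c with he
  have hz' : z ∈ e.baseSet := by simpa [he] using hz
  have h := TangentBundle.continuousLinearMapAt_trivializationAt (I := 𝓡 n) hz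
  rw [VectorField.mpullback_apply]
  have h2 : (e.continuousLinearMapAt ℝ z).inverse = e.symmL ℝ z := by
    refine ContinuousLinearMap.inverse_eq ?_ ?_
    · ext1 w
      exact e.continuousLinearMapAt_symmL hz' w
    · ext1 w
      exact e.symmL_continuousLinearMapAt hz' w
  have h3 : (e.continuousLinearMapAt ℝ z).inverse v = frame c v z := by
    rw [h2, Bundle.Trivialization.symmL_apply _ hz']
    rfl
  rw [← h3, h]
  rfl

/-- Coordinate fields are pull-backs under the chart of constant fields on ℝⁿ, which commute, and
pull-back respects brackets. -/
theorem mlieBracket_frame (c : M) (v w : Coord n) {z : M}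
    (hz : z ∈ (chartAt (Coord n) c).source) :
    VectorField.mlieBracket (𝓡 n) (frame c v) (frame c w) z = 0 := by
  have hev : ∀ a : Coord n, frame c a =ᶠ[nhds z]
      VectorField.mpullback (𝓡 n) 𝓘(ℝ, Coord n) (extChartAt (𝓡 n) c) (constField a) := fun a => by
    filter_upwards [(chartAt (Coord n) c).open_source.mem_nhds hz] with p hp
    exact frame_eq_mpullback c a hp
  have : IsManifold (𝓡 n) (minSmoothness ℝ 2) M := by
    rw [minSmoothness_of_isRCLikeNormedField]
    infer_instance
  rw [(hev v).mlieBracket_vectorField_eq (hev w),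
    ← VectorField.mpullback_mlieBracket (n := ∞) (mdifferentiableAt_constField v _)
      (mdifferentiableAt_constField w _)
      (contMDiffAt_extChartAt' hz) (by
        rw [minSmoothness_of_isRCLikeNormedField]
        exact WithTop.coe_le_coe.2 (le_top : (2 : ℕ∞) ≤ ⊤)),
    VectorField.mpullback_apply, mlieBracket_constField]
  exact map_zero _

variable {h : ContMDiffRiemannianMetric (𝓡 n) ∞ (Coord n) (TangentSpace (𝓡 n) : M → Type _)}

theorem mdifferentiableAt_inner {Y Z : (z : M) → TangentSpace (𝓡 n) z} {x : M}
    (hY : MDifferentiableAt (𝓡 n) (𝓡 n).tangent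
      (fun z => (⟨z, Y z⟩ : TangentBundle (𝓡 n) M)) x)
    (hZ : MDifferentiableAt (𝓡 n) (𝓡 n).tangent
      (fun z => (⟨z, Z z⟩ : TangentBundle (𝓡 n) M)) x) :
    MDifferentiableAt (𝓡 n) 𝓘(ℝ, ℝ) (fun z => h.inner z (Y z) (Z z)) x := by
  let : RiemannianBundle (TangentSpace (𝓡 n) : M → Type _) := ⟨h.toRiemannianMetric⟩
  exact MDifferentiableAt.inner_bundle (F := Coord n) (IB := 𝓡 n)
    (E := (TangentSpace (𝓡 n) : M → Type _)) (b := fun z => z) hY hZ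

theorem contMDiffAt_frame (c : M) {z : M} (hz : z ∈ (chartAt (Coord n) c).source)
    (w : Coord n) :
    ContMDiffAt (𝓡 n) (𝓡 n).tangent ∞
      (fun y => (⟨y, frame c w y⟩ : TangentBundle (𝓡 n) M)) z := by
  refine (Bundle.Trivialization.contMDiffAt_section_iff (IB := 𝓡 n)
    (e := trivializationAt (Coord n) (TangentSpace (𝓡 n) : M → Type _) c)
    (s := frame c w) (x₀ := z) (by simpa using hz)).2 ?_
  refine (contMDiffAt_const (c := w)).congr_of_eventuallyEq ?_
  filter_upwards [(chartAt (Coord n) c).open_source.mem_nhds hz] with y hy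
  exact comp_frame c hy w

theorem contMDiffAt_metricComp (c : M) (v w : Coord n) {z : M}
    (hz : z ∈ (chartAt (Coord n) c).source) :
    ContMDiffAt (𝓡 n) 𝓘(ℝ, ℝ) ∞ (metricComp h c v w) z := by
  let : RiemannianBundle (TangentSpace (𝓡 n) : M → Type _) := ⟨h.toRiemannianMetric⟩
  exact ContMDiffAt.inner_bundle (F := Coord n) (IB := 𝓡 n)
    (E := (TangentSpace (𝓡 n) : M → Type _)) (b := fun z => z)
    (contMDiffAt_frame c hz v) (contMDiffAt_frame c hz w)

theorem mdifferentiableAt_metricComp (c : M) (v w : Coord n) {z : M}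
    (hz : z ∈ (chartAt (Coord n) c).source) :
    MDifferentiableAt (𝓡 n) 𝓘(ℝ, ℝ) (metricComp h c v w) z :=
  (contMDiffAt_metricComp c v w hz).mdifferentiableAt (by simp)

/-- Compatibility is restated with a single vector X in place of a vector field and with `h.inner`
in place of the bundle instance. Conversely X is extended by the coordinate field through it. -/
theorem isLeviCivita_iff
    (D : CovariantDerivative (𝓡 n) (Coord n) (TangentSpace (𝓡 n) : M → Type _)) :
    IsLeviCivita h D ↔ D.torsion = 0 ∧
      ∀ (x : M) (X : TangentSpace (𝓡 n) x) (Y Z : (z : M) → TangentSpace (𝓡 n) z),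
        MDifferentiableAt (𝓡 n) (𝓡 n).tangent
          (fun z => (⟨z, Y z⟩ : TangentBundle (𝓡 n) M)) x →
        MDifferentiableAt (𝓡 n) (𝓡 n).tangent
          (fun z => (⟨z, Z z⟩ : TangentBundle (𝓡 n) M)) x →
        mvfderiv (𝓡 n) (fun z => h.inner z (Y z) (Z z)) x X
          = h.inner x (D Y x X) (Z x) + h.inner x (Y x) (D Z x X) := by
  unfold IsLeviCivita
  refine and_congr_right fun _ => ?_
  let : RiemannianBundle (TangentSpace (𝓡 n) : M → Type _) := ⟨h.toRiemannianMetric⟩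
  constructor
  · intro hD x X Y Z hY hZ
    have := hD.mvfderiv_inner_eq (frame x X) (x := x) hY hZ
    have e : frame x X x = X := frame_self x X
    dsimp only at this
    rw [e] at this
    exact this
  · intro hD
    rw [CovariantDerivative.isMetricCompatible_iff]
    intro x X Y Z _ hY hZ
    exact hD x (X x) Y Z hY hZ

theorem mvfderiv_inner_eq
    {D : CovariantDerivative (𝓡 n) (Coord n) (TangentSpace (𝓡 n) : M → Type _)}
    (hD : IsLeviCivita h D) {Y Z : (z : M) → TangentSpace (𝓡 n) z} {x : M}
    (hY : MDifferentiableAt (𝓡 n) (𝓡 n).tangent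
      (fun z => (⟨z, Y z⟩ : TangentBundle (𝓡 n) M)) x)
    (hZ : MDifferentiableAt (𝓡 n) (𝓡 n).tangent
      (fun z => (⟨z, Z z⟩ : TangentBundle (𝓡 n) M)) x) (X : TangentSpace (𝓡 n) x) :
    chartDeriv x (fun z => h.inner z (Y z) (Z z)) X
      = h.inner x (D Y x X) (Z x) + h.inner x (Y x) (D Z x X) :=
  (mvfderiv_eq_chartDeriv (mdifferentiableAt_inner hY hZ) X).symm.trans
    (((isLeviCivita_iff D).1 hD).2 x X Y Z hY hZ)

theorem torsion_frame
    {D : CovariantDerivative (𝓡 n) (Coord n) (TangentSpace (𝓡 n) : M → Type _)}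
    (hD : IsLeviCivita h D) (c : M) (v w : Coord n) {z : M}
    (hz : z ∈ (chartAt (Coord n) c).source) :
    D (frame c v) z (frame c w z) = D (frame c w) z (frame c v z) := by
  have := (D.torsion_eq_zero_iff.1 hD.1) (mdifferentiableAt_frame c hz w)
    (mdifferentiableAt_frame c hz v)
  rw [mlieBracket_frame c w v hz] at this
  exact sub_eq_zero.1 this

/-- The Christoffel symbols at `x` of an affine connection, in the preferred chart at `x`. -/
def christoffelAt (D : CovariantDerivative (𝓡 n) (Coord n) (TangentSpace (𝓡 n) : M → Type _))
    (x : M) (v X : Coord n) : Coord n := D (frame x v) x X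

theorem isChristoffelAt_christoffelAt
    {D : CovariantDerivative (𝓡 n) (Coord n) (TangentSpace (𝓡 n) : M → Type _)}
    (hD : IsLeviCivita h D) (x : M) : IsChristoffelAt h x (christoffelAt D x) where
  symm v X := by
    have := torsion_frame hD x v X (mem_chart_source _ x)
    rwa [frame_self, frame_self] at this
  compat v w X := by
    have hm := fun a : Coord n => mdifferentiableAt_frame x (mem_chart_source _ x) a
    have := mvfderiv_inner_eq hD (hm v) (hm w) X
    rwa [frame_self, frame_self] at this

end LeviCivita

/-! ### The Berwald coefficients as Christoffel symbols of h -/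

section Berwald

variable {n : ℕ} {M : Type*} [TopologicalSpace M] [ChartedSpace (Coord n) M]
  [IsManifold (𝓡 n) ∞ M]

theorem coeffMap_apply (Γ : Fin n → Fin n → Fin n → ℝ) (w v : Coord n) (i : Fin n) :
    coeffMap Γ w v i = ∑ j, ∑ k, Γ i j k * w k * v j := by
  simp only [coeffMap, sum_apply, smul_apply,
    ContinuousLinearMap.smulRight_apply, WithLp.ofLp_sum, WithLp.ofLp_smul, Finset.sum_apply,
    Pi.smul_apply, PiLp.ofLp_single, smul_eq_mul, PiLp.proj_apply]
  rw [Finset.sum_eq_single i]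
  · refine Finset.sum_congr rfl fun j _ => Finset.sum_congr rfl fun k _ => ?_
    simp
  · intro b _ hb
    refine Finset.sum_eq_zero fun j _ => Finset.sum_eq_zero fun k _ => ?_
    simp [hb.symm]
  · simp

theorem sum_smulRight_apply (a : Fin n → Fin n → ℝ) (v : Coord n) (i : Fin n) :
    (∑ i, ∑ j, a i j • (EuclideanSpace.proj j : Coord n →L[ℝ] ℝ).smulRight
      (EuclideanSpace.single i (1 : ℝ)) : Coord n →L[ℝ] Coord n) v i = ∑ j, a i j * v j := by
  simp only [sum_apply, smul_apply,
    ContinuousLinearMap.smulRight_apply, WithLp.ofLp_sum, WithLp.ofLp_smul, Finset.sum_apply,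
    Pi.smul_apply, PiLp.ofLp_single, smul_eq_mul, PiLp.proj_apply]
  rw [Finset.sum_eq_single i]
  · refine Finset.sum_congr rfl fun j _ => ?_
    simp
  · intro b _ hb
    refine Finset.sum_eq_zero fun j _ => ?_
    simp [hb.symm]
  · simp

/-- The Berwald connection coefficients at `(x, y)`, as a bilinear map. -/
def berwaldAt (F : TangentBundle (𝓡 n) M → ℝ) (x : M) (y v X : Coord n) : Coord n :=
  coeffMap (berwaldCoeff (localExpr F x) (extChartAt (𝓡 n) x x, y)) v X

/-- The components of π*Y depend on the base point only, so the vertical part of X drops out. -/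
theorem connectionOfCoeff_pullbackField
    (Γ : M → Coord n × Coord n → Fin n → Fin n → Fin n → ℝ)
    {Y : (z : M) → TangentSpace (𝓡 n) z} {x : M}
    (hY : MDifferentiableAt (𝓡 n) (𝓡 n).tangent
      (fun z => (⟨z, Y z⟩ : TangentBundle (𝓡 n) M)) x)
    (y : TangentSpace (𝓡 n) x) (X : Coord n × Coord n) :
    connectionOfCoeff Γ (pullbackField Y) ⟨x, y⟩ X
      = (chartDeriv (n := n) x (fun p => comp (n := n) x (Y p)) X.1 : Coord n)
        + coeffMap (Γ x (extChartAt (𝓡 n) x x, y)) (Y x) X.1 := by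
  have e : natChart x (⟨x, y⟩ : TangentBundle (𝓡 n) M)
      = ((extChartAt (𝓡 n) x x, y) : Coord n × Coord n) := natChart_self x y
  have h := (hasFDerivAt_comp_symm_proj (mdifferentiableAt_comp_section hY) y).fderiv
  change fderiv ℝ (fun q => comp (n := n) x (Y ((natChart x).symm q).proj)) (natChart x ⟨x, y⟩) X
    + coeffMap (Γ x (natChart x ⟨x, y⟩)) (Y x) X.1 = _
  rw [e, h]
  rfl

/-- The horizontal lift at `(x, y)`, as a map between coordinate spaces. -/
def horizontalLiftMap (F : TangentBundle (𝓡 n) M → ℝ) (x : M) (y : Coord n) :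
    Coord n →L[ℝ] Coord n × Coord n :=
  horizontalLift F (⟨x, y⟩ : TangentBundle (𝓡 n) M)

theorem horizontalLiftMap_fst (F : TangentBundle (𝓡 n) M → ℝ) (x : M) (y X : Coord n) :
    (horizontalLiftMap F x y X).1 = X := rfl

/-- Since ι_u(X) projects to X, the non-linear connection disappears and y enters only through the
Berwald coefficients. -/
theorem averageIntegrand_apply (F : TangentBundle (𝓡 n) M → ℝ)
    {Y : (z : M) → TangentSpace (𝓡 n) z} {x : M}
    (hY : MDifferentiableAt (𝓡 n) (𝓡 n).tangent
      (fun z => (⟨z, Y z⟩ : TangentBundle (𝓡 n) M)) x) (y X : Coord n) :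
    averageIntegrand F (berwaldConnection F) Y x y X
      = chartDeriv (n := n) x (fun p => comp (n := n) x (Y p)) X + berwaldAt F x y (Y x) X := by
  have h := connectionOfCoeff_pullbackField (fun c => berwaldCoeff (localExpr F c)) hY y
    (horizontalLiftMap F x y X)
  rw [horizontalLiftMap_fst] at h
  exact h

theorem berwaldAt_symm {F : TangentBundle (𝓡 n) M → ℝ} (hF : IsFinsler F) (x : M) {y : Coord n}
    (hy : y ≠ 0) (v X : Coord n) : berwaldAt F x y v X = berwaldAt F x y X v := by
  ext i
  simp only [berwaldAt, coeffMap_apply]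
  rw [Finset.sum_comm]
  refine Finset.sum_congr rfl fun j _ => Finset.sum_congr rfl fun k _ => ?_
  rw [(hF.isLocalFinsler x).berwaldCoeff_symm (self_mem_slitTarget x hy)]
  ring

theorem mdifferentiableAt_pullbackField {Y : (z : M) → TangentSpace (𝓡 n) z} {x : M}
    (hY : MDifferentiableAt (𝓡 n) (𝓡 n).tangent
      (fun z => (⟨z, Y z⟩ : TangentBundle (𝓡 n) M)) x) (y : TangentSpace (𝓡 n) x) :
    MDifferentiableAt (𝓡 n).tangent (𝓡 n).tangent
      (fun v : TangentBundle (𝓡 n) M => (⟨v.proj, pullbackField Y v⟩ : TangentBundle (𝓡 n) M))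
      ⟨x, y⟩ :=
  MDifferentiableAt.comp (I' := 𝓡 n) (⟨x, y⟩ : TangentBundle (𝓡 n) M)
    (g := fun z => (⟨z, Y z⟩ : TangentBundle (𝓡 n) M))
    (f := fun v : TangentBundle (𝓡 n) M => v.proj) hY
    (mdifferentiableAt_proj (TangentSpace (𝓡 n) : M → Type _))

variable {h : ContMDiffRiemannianMetric (𝓡 n) ∞ (Coord n) (TangentSpace (𝓡 n) : M → Type _)}

/-- The hypothesis is tested on π*Y, π*Z and the vector ι_u(X); the function h(π*Y, π*Z) is lifted
from M, so its derivative is the one on M. -/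
theorem chartDeriv_inner_of_isParallelMetric {F : TangentBundle (𝓡 n) M → ℝ}
    (hpar : IsParallelMetric (berwaldConnection F) h)
    {Y Z : (z : M) → TangentSpace (𝓡 n) z} {x : M}
    (hY : MDifferentiableAt (𝓡 n) (𝓡 n).tangent
      (fun z => (⟨z, Y z⟩ : TangentBundle (𝓡 n) M)) x)
    (hZ : MDifferentiableAt (𝓡 n) (𝓡 n).tangent
      (fun z => (⟨z, Z z⟩ : TangentBundle (𝓡 n) M)) x) {y : Coord n} (hy : y ≠ 0)
    (X : Coord n) :
    chartDeriv x (fun z => h.inner z (Y z) (Z z)) X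
      = metricAt h x (averageIntegrand F (berwaldConnection F) Y x y X) (Z x)
        + metricAt h x (Y x) (averageIntegrand F (berwaldConnection F) Z x y X) := by
  have h1 := hpar (⟨x, y⟩ : TangentBundle (𝓡 n) M) hy (pullbackField Y) (pullbackField Z)
    (mdifferentiableAt_pullbackField hY y) (mdifferentiableAt_pullbackField hZ y)
    (horizontalLift F (⟨x, y⟩ : TangentBundle (𝓡 n) M) X)
  have h2 := mvfderiv_comp_proj (mdifferentiableAt_inner (h := h) hY hZ) y
    (horizontalLift F (⟨x, y⟩ : TangentBundle (𝓡 n) M) X)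
  exact h2.symm.trans h1

/-- On fields with constant components the flat term vanishes and only the Berwald coefficients
remain in the metric identity. -/
theorem isChristoffelAt_berwaldAt {F : TangentBundle (𝓡 n) M → ℝ} (hF : IsFinsler F)
    (hpar : IsParallelMetric (berwaldConnection F) h) (x : M) {y : Coord n} (hy : y ≠ 0) :
    IsChristoffelAt h x (berwaldAt F x y) where
  symm := berwaldAt_symm hF x hy
  compat v w X := by
    have hm := fun a : Coord n => mdifferentiableAt_frame x (mem_chart_source _ x) a
    have h1 := chartDeriv_inner_of_isParallelMetric hpar (hm v) (hm w) hy X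
    have h2 : ∀ a : Coord n, averageIntegrand F (berwaldConnection F) (frame x a) x y X
        = berwaldAt F x y a X := by
      intro a
      rw [averageIntegrand_apply F (hm a)]
      rw [chartDeriv_comp_frame, frame_self]
      exact zero_add _
    rw [h2, h2, frame_self, frame_self] at h1
    exact h1

theorem berwaldAt_eq_christoffelAt {F : TangentBundle (𝓡 n) M → ℝ} (hF : IsFinsler F)
    (hpar : IsParallelMetric (berwaldConnection F) h)
    {D : CovariantDerivative (𝓡 n) (Coord n) (TangentSpace (𝓡 n) : M → Type _)}
    (hD : IsLeviCivita h D) (x : M) {y : Coord n} (hy : y ≠ 0) :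
    berwaldAt F x y = christoffelAt D x :=
  (isChristoffelAt_berwaldAt hF hpar x hy).unique (isChristoffelAt_christoffelAt hD x)

/-- The fibre component of the horizontal lift is given by the Berwald coefficients. -/
theorem horizontalLift_eq {F : TangentBundle (𝓡 n) M → ℝ} (hF : IsFinsler F) (x : M)
    {y : Coord n} (hy : y ≠ 0) (X : Coord n) :
    horizontalLift F (⟨x, y⟩ : TangentBundle (𝓡 n) M) X
      = ((X, -berwaldAt F x y y X) : Coord n × Coord n) := by
  have e : natChart x (⟨x, y⟩ : TangentBundle (𝓡 n) M)
      = ((extChartAt (𝓡 n) x x, y) : Coord n × Coord n) := natChart_self x y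
  change ((X, (-∑ i, ∑ j, nonlinCoeff (localExpr F x) (natChart x ⟨x, y⟩) i j •
      (EuclideanSpace.proj j : Coord n →L[ℝ] ℝ).smulRight (EuclideanSpace.single i (1 : ℝ))
        : Coord n →L[ℝ] Coord n) X) : Coord n × Coord n) = _
  rw [e]
  refine Prod.ext rfl ?_
  change (-∑ i, ∑ j, nonlinCoeff (localExpr F x) (extChartAt (𝓡 n) x x, y) i j •
      (EuclideanSpace.proj j : Coord n →L[ℝ] ℝ).smulRight (EuclideanSpace.single i (1 : ℝ))
        : Coord n →L[ℝ] Coord n) X = -berwaldAt F x y y X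
  rw [neg_apply]
  congr 1
  ext i
  rw [sum_smulRight_apply, berwaldAt, coeffMap_apply]
  refine Finset.sum_congr rfl fun j _ => ?_
  rw [(hF.isLocalFinsler x).nonlinCoeff_eq_sum_berwaldCoeff (self_mem_slitTarget x hy),
    Finset.sum_mul]

end Berwald

/-! ### The volume of the indicatrix -/

section Volume

variable {n : ℕ} {M : Type*} [TopologicalSpace M] [ChartedSpace (Coord n) M]
  [IsManifold (𝓡 n) ∞ M]

theorem localExpr_self (F : TangentBundle (𝓡 n) M → ℝ) (x : M) (y : Coord n) :
    localExpr F x (extChartAt (𝓡 n) x x, y) = F (⟨x, y⟩ : TangentBundle (𝓡 n) M) :=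
  congrArg F (symm_self x y)

theorem fundForm_eq (F : TangentBundle (𝓡 n) M → ℝ) (x : M) (y v w : Coord n) :
    fundForm F x y v w
      = ∑ i, ∑ j, gLow (localExpr F x) (extChartAt (𝓡 n) x x, y) i j * v i * w j := by
  have e : natChart x (⟨x, y⟩ : TangentBundle (𝓡 n) M)
      = ((extChartAt (𝓡 n) x x, y) : Coord n × Coord n) := natChart_self x y
  unfold fundForm
  rw [e]

variable {F : TangentBundle (𝓡 n) M → ℝ} (hF : IsFinsler F) (x : M)
include hF

theorem IsFinsler.pos {y : Coord n} (hy : y ≠ 0) : 0 < F (⟨x, y⟩ : TangentBundle (𝓡 n) M) := by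
  have := (hF.isLocalFinsler x).pos (self_mem_slitTarget x hy)
  rwa [localExpr_self] at this

theorem IsFinsler.apply_zero : F (⟨x, 0⟩ : TangentBundle (𝓡 n) M) = 0 := by
  have h := hF.homogeneous x 0 2 two_pos
  rw [smul_zero] at h
  linarith

theorem contDiffOn_finsler :
    ContDiffOn ℝ ∞ (fun y : Coord n => F (⟨x, y⟩ : TangentBundle (𝓡 n) M)) {0}ᶜ := by
  have h := (hF.isLocalFinsler x).smooth.comp
    (f := fun y : Coord n => ((extChartAt (𝓡 n) x x : Coord n), y))
    (s := {0}ᶜ) (contDiff_const.prodMk contDiff_id).contDiffOn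
    fun y hy => self_mem_slitTarget x hy
  exact h.congr fun y _ => (localExpr_self F x y).symm

theorem contDiffOn_centralProj : ContDiffOn ℝ ∞ (centralProj F x) {0}ᶜ :=
  ((contDiffOn_finsler hF x).inv fun _ hy => (hF.pos x hy).ne').smul contDiffOn_id

theorem centralProj_ne_zero {y : Coord n} (hy : y ≠ 0) : centralProj F x y ≠ 0 :=
  smul_ne_zero (inv_ne_zero (hF.pos x hy).ne') hy

theorem continuousOn_fderiv_centralProj (v : Coord n) :
    ContinuousOn (fun θ => fderiv ℝ (centralProj F x) θ v) {0}ᶜ :=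
  (((contDiffOn_centralProj hF x).continuousOn_fderiv_of_isOpen isOpen_compl_singleton
    (by simp)).clm_apply continuousOn_const)

theorem continuousOn_gLow_centralProj (i j : Fin n) :
    ContinuousOn (fun θ => gLow (localExpr F x) (extChartAt (𝓡 n) x x, centralProj F x θ) i j)
      {0}ᶜ := by
  have h := ((hF.isLocalFinsler x).contDiffOn_gLow i j).continuousOn
  refine h.comp (f := fun θ => ((extChartAt (𝓡 n) x x : Coord n), centralProj F x θ))
    (continuousOn_const.prodMk (contDiffOn_centralProj hF x).continuousOn) ?_
  intro θ hθ
  exact self_mem_slitTarget x (centralProj_ne_zero hF x hθ)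

theorem continuous_volumeDensity :
    Continuous (fun θ : Metric.sphere (0 : Coord n) 1 => volumeDensity F x θ.1) := by
  have hsub : ∀ {f : Coord n → ℝ}, ContinuousOn f {0}ᶜ →
      Continuous (fun θ : Metric.sphere (0 : Coord n) 1 => f θ.1) := fun {f} hf =>
    hf.comp_continuous continuous_subtype_val fun θ => ne_zero_of_mem_unit_sphere θ
  have hcoord : ∀ i : Fin n, Continuous (fun v : Coord n => v i) := fun i =>
    (EuclideanSpace.proj i : Coord n →L[ℝ] ℝ).continuous
  refine Real.continuous_sqrt.comp (Continuous.matrix_det ?_)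
  refine continuous_matrix fun i j => ?_
  simp only [Matrix.of_apply, fundForm_eq]
  refine Continuous.add ?_ ?_
  · refine continuous_finsetSum _ fun a _ => continuous_finsetSum _ fun b _ => ?_
    refine Continuous.mul (Continuous.mul (hsub (continuousOn_gLow_centralProj hF x a b)) ?_) ?_
    · exact hsub ((hcoord a).comp_continuousOn (continuousOn_fderiv_centralProj hF x _))
    · exact hsub ((hcoord b).comp_continuousOn (continuousOn_fderiv_centralProj hF x _))
  · exact ((hcoord i).comp continuous_subtype_val).mul ((hcoord j).comp continuous_subtype_val)

theorem fundForm_symm {y : Coord n} (hy : y ≠ 0) (v w : Coord n) :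
    fundForm F x y v w = fundForm F x y w v := by
  rw [fundForm_eq, fundForm_eq, Finset.sum_comm]
  refine Finset.sum_congr rfl fun j _ => Finset.sum_congr rfl fun i _ => ?_
  rw [(hF.isLocalFinsler x).gLow_symm (self_mem_slitTarget x hy)]
  ring

theorem fundForm_pos {y v : Coord n} (hy : y ≠ 0) (hv : v ≠ 0) : 0 < fundForm F x y v v := by
  have hne : (v : Fin n → ℝ) ≠ 0 := fun h0 => hv (by ext i; exact congrFun h0 i)
  have h := ((hF.isLocalFinsler x).posDef _ (self_mem_slitTarget x hy)).dotProduct_mulVec_pos hne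
  rw [fundForm_eq]
  have e : ∑ i, ∑ j, gLow (localExpr F x) (extChartAt (𝓡 n) x x, y) i j * v i * v j
      = star (v : Fin n → ℝ) ⬝ᵥ (gLow (localExpr F x) (extChartAt (𝓡 n) x x, y)).mulVec v := by
    simp only [dotProduct, Matrix.mulVec, star_trivial, Finset.mul_sum]
    refine Finset.sum_congr rfl fun i _ => Finset.sum_congr rfl fun j _ => ?_
    ring
  rw [e]
  exact h

omit hF in
theorem fundForm_sum (y : Coord n) (a b : Fin n → ℝ) (f : Fin n → Coord n) :
    ∑ i, ∑ j, a i * b j * fundForm F x y (f i) (f j)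
      = fundForm F x y (∑ i, a i • f i) (∑ j, b j • f j) := by
  have h : ∀ k l : Fin n, (∑ i, a i * f i k) * (∑ j, b j * f j l)
      = ∑ i, ∑ j, a i * b j * (f i k * f j l) := fun k l => by
    rw [Finset.sum_mul_sum]
    exact Finset.sum_congr rfl fun i _ => Finset.sum_congr rfl fun j _ => by ring
  simp only [fundForm, WithLp.ofLp_sum, WithLp.ofLp_smul, Finset.sum_apply, Pi.smul_apply,
    smul_eq_mul, mul_assoc (gLow _ _ _ _), h]
  simp only [Finset.mul_sum]
  calc _ = ∑ i, ∑ k, ∑ j, ∑ l, a i * b j * (gLow (localExpr F x) (natChart x ⟨x, y⟩) k l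
          * (f i k * f j l)) := Finset.sum_congr rfl fun i _ => Finset.sum_comm
    _ = ∑ k, ∑ i, ∑ l, ∑ j, a i * b j * (gLow (localExpr F x) (natChart x ⟨x, y⟩) k l
          * (f i k * f j l)) := by
        rw [Finset.sum_comm]
        exact Finset.sum_congr rfl fun k _ => Finset.sum_congr rfl fun i _ => Finset.sum_comm
    _ = _ := by
        refine Finset.sum_congr rfl fun k _ => ?_
        rw [Finset.sum_comm]
        refine Finset.sum_congr rfl fun l _ => Finset.sum_congr rfl fun i _ =>
          Finset.sum_congr rfl fun j _ => ?_
        ring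

/-- The differential of θ ↦ θ / F(θ) sends v to a v + b θ with a = 1 / F(θ) ≠ 0. If this is zero,
pairing with θ ⟂ v gives b = 0, and then v = 0. -/
theorem fderiv_centralProj_ne_zero {θ v : Coord n} (hθ : θ ≠ 0) (hv : v ≠ 0)
    (hort : ∑ i, θ i * v i = 0) : fderiv ℝ (centralProj F x) θ v ≠ 0 := by
  have hd : DifferentiableAt ℝ (fun y : Coord n => (F (⟨x, y⟩ : TangentBundle (𝓡 n) M))⁻¹) θ :=
    (((contDiffOn_finsler hF x).contDiffAt (isOpen_compl_singleton.mem_nhds hθ)).differentiableAt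
      (by simp)).inv (hF.pos x hθ).ne'
  have h := hd.hasFDerivAt.fun_smul (hasFDerivAt_id θ)
  have h2 : HasFDerivAt (centralProj F x) _ θ := h
  rw [h2.fderiv]
  intro h0
  simp only [add_apply, smul_apply, ContinuousLinearMap.smulRight_apply,
    ContinuousLinearMap.id_apply, id_eq] at h0
  set a := (F (⟨x, θ⟩ : TangentBundle (𝓡 n) M))⁻¹ with ha
  have ha0 : a ≠ 0 := inv_ne_zero (hF.pos x hθ).ne'
  set b := fderiv ℝ (fun y : Coord n => (F (⟨x, y⟩ : TangentBundle (𝓡 n) M))⁻¹) θ v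
  have hcomp : ∀ i, a * v i + b * θ i = 0 := fun i => by
    have := congrArg (fun w : Coord n => w i) h0
    simpa using this
  have hs : ∑ i, θ i * θ i ≠ 0 := by
    intro hs
    apply hθ
    ext i
    have := (Finset.sum_eq_zero_iff_of_nonneg (fun j _ => mul_self_nonneg (θ j))).1 hs i
      (Finset.mem_univ i)
    simpa using this
  have hb : b = 0 := by
    have h1 : ∑ i, θ i * (a * v i + b * θ i) = 0 :=
      Finset.sum_eq_zero fun i _ => by rw [hcomp i, mul_zero]
    have h2 : ∑ i, θ i * (a * v i + b * θ i) = a * ∑ i, θ i * v i + b * ∑ i, θ i * θ i := by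
      rw [Finset.mul_sum, Finset.mul_sum, ← Finset.sum_add_distrib]
      exact Finset.sum_congr rfl fun i _ => by ring
    rw [h1, hort, mul_zero, zero_add] at h2
    exact (mul_eq_zero.1 h2.symm).resolve_right hs
  apply hv
  ext i
  have := hcomp i
  rw [hb, zero_mul, add_zero] at this
  exact (mul_eq_zero.1 this).resolve_left ha0

/-- The matrix under the determinant represents w ↦ g(dr w, dr w) + ⟨θ, w⟩². The second term is
positive unless w ⟂ θ, and in that case dr w ≠ 0, so the first one is. -/
theorem volumeDensity_pos {θ : Coord n} (hθ : θ ≠ 0) : 0 < volumeDensity F x θ := by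
  have hr := centralProj_ne_zero hF x hθ
  refine Real.sqrt_pos.2 (Matrix.PosDef.det_pos (Matrix.PosDef.of_dotProduct_mulVec_pos ?_ ?_))
  · refine Matrix.IsHermitian.ext fun i j => ?_
    simp only [Matrix.of_apply, star_trivial]
    rw [fundForm_symm hF x hr, mul_comm]
  · intro v hv
    set w : Coord n := WithLp.toLp 2 v with hw
    have hw0 : w ≠ 0 := fun h0 => hv (by rw [← WithLp.ofLp_toLp 2 v, ← hw, h0]; rfl)
    have hsum : ∑ i, v i • (EuclideanSpace.single i (1 : ℝ) : Coord n) = w := by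
      simpa using (EuclideanSpace.basisFun (Fin n) ℝ).sum_repr w
    have e : star v ⬝ᵥ (Matrix.of fun i j : Fin n =>
        fundForm F x (centralProj F x θ)
          (fderiv ℝ (centralProj F x) θ (EuclideanSpace.single i 1))
          (fderiv ℝ (centralProj F x) θ (EuclideanSpace.single j 1)) + θ i * θ j).mulVec v
        = fundForm F x (centralProj F x θ) (fderiv ℝ (centralProj F x) θ w)
          (fderiv ℝ (centralProj F x) θ w) + (∑ i, θ i * w i) ^ 2 := by
      rw [← hsum, map_sum]
      simp only [map_smul]
      rw [← fundForm_sum, hsum, pow_two, Finset.sum_mul_sum, ← Finset.sum_add_distrib]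
      simp only [dotProduct, Matrix.mulVec, star_trivial, Finset.mul_sum, Matrix.of_apply,
        ← Finset.sum_add_distrib]
      refine Finset.sum_congr rfl fun i _ => Finset.sum_congr rfl fun j _ => ?_
      simp only [hw]
      ring
    rw [e]
    by_cases hort : ∑ i, θ i * w i = 0
    · rw [hort]
      simpa using fundForm_pos hF x hr (fderiv_centralProj_ne_zero hF x hθ hw0 hort)
    · refine add_pos_of_nonneg_of_pos ?_ (by positivity)
      by_cases h0 : fderiv ℝ (centralProj F x) θ w = 0
      · simp [h0, fundForm]
      · exact (fundForm_pos hF x hr h0).le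

theorem measurable_centralProj_sphere :
    Measurable (fun θ : Metric.sphere (0 : Coord n) 1 => centralProj F x θ.1) :=
  ((contDiffOn_centralProj hF x).continuousOn.comp_continuous continuous_subtype_val
    fun θ => ne_zero_of_mem_unit_sphere θ).measurable

theorem isFiniteMeasure_indicatrixVolume : IsFiniteMeasure (indicatrixVolume F x) := by
  have : IsFiniteMeasure ((volume : Measure (Coord n)).toSphere.withDensity
      (fun θ => ENNReal.ofReal (volumeDensity F x θ.1))) := by
    apply isFiniteMeasure_withDensity_ofReal
    exact ((continuous_volumeDensity hF x).integrable_of_hasCompactSupport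
      (HasCompactSupport.of_compactSpace _)).2
  unfold indicatrixVolume
  infer_instance

/-- In dimension 0 the sphere is empty and the measure is zero, hence `NeZero n`. Otherwise a
positive density cannot vanish almost everywhere for the nonzero sphere measure. -/
theorem indicatrixVolume_ne_zero [NeZero n] : indicatrixVolume F x ≠ 0 := by
  unfold indicatrixVolume
  rw [Ne, Measure.map_eq_zero_iff (measurable_centralProj_sphere hF x).aemeasurable,
    withDensity_eq_zero_iff
      (continuous_volumeDensity hF x).measurable.ennreal_ofReal.aemeasurable]
  intro h0
  have hne : (volume : Measure (Coord n)).toSphere ≠ 0 := Measure.toSphere_ne_zero _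
  apply hne
  rw [← ae_eq_bot, ← Filter.empty_mem_iff_bot]
  filter_upwards [h0] with θ hθ
  exact (ENNReal.ofReal_pos.2 (volumeDensity_pos hF x (ne_zero_of_mem_unit_sphere θ))).ne' hθ

theorem ae_indicatrixVolume_ne_zero : ∀ᵐ y ∂(indicatrixVolume F x), y ≠ 0 := by
  unfold indicatrixVolume
  refine (ae_map_iff (p := fun y : Coord n => y ≠ 0)
    (measurable_centralProj_sphere hF x).aemeasurable
    (measurableSet_singleton (0 : Coord n)).compl).2 ?_
  exact Filter.Eventually.of_forall fun θ =>
    centralProj_ne_zero hF x (ne_zero_of_mem_unit_sphere θ)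

/-- Only three facts about the volume enter: it is finite, nonzero, and does not charge the origin.
-/
theorem average_indicatrixVolume [NeZero n] {E : Type*} [NormedAddCommGroup E] [NormedSpace ℝ E]
    [CompleteSpace E] {f : Coord n → E} {a : E} (hf : ∀ y, y ≠ 0 → f y = a) :
    average (indicatrixVolume F x) f = a := by
  have := isFiniteMeasure_indicatrixVolume hF x
  have : NeZero (indicatrixVolume F x) := ⟨indicatrixVolume_ne_zero hF x⟩
  have h : f =ᵐ[indicatrixVolume F x] fun _ => a := by
    filter_upwards [ae_indicatrixVolume_ne_zero hF x] with y hy using hf y hy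
  rw [average_congr h, average_const]

end Volume

/-! ### The average of the Berwald connection -/

section Average

variable {n : ℕ} {M : Type*} [TopologicalSpace M] [ChartedSpace (Coord n) M]
  [IsManifold (𝓡 n) ∞ M]
  {h : ContMDiffRiemannianMetric (𝓡 n) ∞ (Coord n) (TangentSpace (𝓡 n) : M → Type _)}
  {F : TangentBundle (𝓡 n) M → ℝ}

/-- The Berwald coefficients in two directions y, y' are Christoffel symbols of the same h at x, so
they coincide and the integrand is constant. -/
theorem averageConnection_eq [NeZero n] (hF : IsFinsler F)
    (hpar : IsParallelMetric (berwaldConnection F) h) {Y : (z : M) → TangentSpace (𝓡 n) z} {x : M}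
    (hY : MDifferentiableAt (𝓡 n) (𝓡 n).tangent
      (fun z => (⟨z, Y z⟩ : TangentBundle (𝓡 n) M)) x) {y : Coord n} (hy : y ≠ 0) :
    averageConnection F (berwaldConnection F) Y x
      = averageIntegrand F (berwaldConnection F) Y x y := by
  refine average_indicatrixVolume (E := Coord n →L[ℝ] Coord n) hF x fun y' hy' => ?_
  ext1 X
  rw [averageIntegrand_apply F hY, averageIntegrand_apply F hY,
    (isChristoffelAt_berwaldAt hF hpar x hy').unique (isChristoffelAt_berwaldAt hF hpar x hy)]

variable (F) in
/-- The Berwald connection coefficients at `(x, y)`, as a family of endomorphisms of `T_xM`. -/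
def berwaldMap (x : M) (y : Coord n) (X : TangentSpace (𝓡 n) x) :
    TangentSpace (𝓡 n) x →L[ℝ] TangentSpace (𝓡 n) x :=
  coeffMap (berwaldCoeff (localExpr F x) (extChartAt (𝓡 n) x x, y)) X

/-- Symmetry moves Y x into the slot where `coeffMap` is bundled as a linear map. The connection
axioms then reduce to those of the flat connection. -/
theorem averageConnection_apply [NeZero n] (hF : IsFinsler F)
    (hpar : IsParallelMetric (berwaldConnection F) h) {Y : (z : M) → TangentSpace (𝓡 n) z} {x : M}
    (hY : MDifferentiableAt (𝓡 n) (𝓡 n).tangent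
      (fun z => (⟨z, Y z⟩ : TangentBundle (𝓡 n) M)) x) {y : Coord n} (hy : y ≠ 0)
    (X : TangentSpace (𝓡 n) x) :
    averageConnection F (berwaldConnection F) Y x X
      = flatConnection x Y x X + berwaldMap F x y X (Y x) := by
  rw [averageConnection_eq hF hpar hY hy]
  exact (averageIntegrand_apply F hY y X).trans
    (congrArg (_ + ·) (berwaldAt_symm hF x hy (Y x) X))

theorem isCovariantDerivativeOn_averageConnection [NeZero n] (hF : IsFinsler F)
    (hpar : IsParallelMetric (berwaldConnection F) h) :
    IsCovariantDerivativeOn (I := 𝓡 n) (Coord n)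
      (averageConnection (M := M) F (berwaldConnection F)) where
  add {σ σ' x} hσ hσ' _ := by
    obtain ⟨y, hy⟩ := exists_ne (0 : Coord n)
    have hf := (isCovariantDerivativeOn_flatConnection (n := n) x).add hσ hσ' (mem_singleton x)
    ext1 X
    rw [averageConnection_apply hF hpar (mdifferentiableAt_add_section hσ hσ') hy, hf]
    refine Eq.trans ?_ (congrArg₂ (· + ·) (averageConnection_apply hF hpar hσ hy X)
      (averageConnection_apply hF hpar hσ' hy X)).symm
    refine (congrArg (_ + ·) (map_add _ (σ x : Coord n) (σ' x : Coord n))).trans ?_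
    exact add_add_add_comm _ _ _ _
  leibniz {σ g x} hσ hg _ := by
    obtain ⟨y, hy⟩ := exists_ne (0 : Coord n)
    have hf := (isCovariantDerivativeOn_flatConnection (n := n) x).leibniz hσ hg (mem_singleton x)
    ext1 X
    rw [averageConnection_apply hF hpar (hg.smul_section hσ) hy, hf]
    have h1 := averageConnection_apply hF hpar hσ hy X
    refine Eq.trans ?_ (congrArg (fun T => g x • T + mvfderiv (𝓡 n) g x X • σ x) h1).symm
    refine (congrArg (_ + ·) (map_smul _ (g x) (σ x : Coord n))).trans ?_
    refine Eq.trans ?_ (congrArg (· + mvfderiv (𝓡 n) g x X • σ x) (smul_add _ _ _).symm)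
    exact add_right_comm _ _ _

variable (F) in
theorem isLeviCivita_averageConnection [NeZero n] (hF : IsFinsler F)
    (hpar : IsParallelMetric (berwaldConnection F) h) :
    IsLeviCivita h ⟨averageConnection F (berwaldConnection F),
      isCovariantDerivativeOn_averageConnection hF hpar⟩ := by
  rw [isLeviCivita_iff]
  obtain ⟨y, hy⟩ := exists_ne (0 : Coord n)
  constructor
  · set D : CovariantDerivative (𝓡 n) (Coord n) (TangentSpace (𝓡 n) : M → Type _) :=
      ⟨averageConnection F (berwaldConnection F),
        isCovariantDerivativeOn_averageConnection hF hpar⟩ with hD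
    have hfr : ∀ (x : M) (v X : Coord n), D (frame x v) x X = berwaldAt F x y v X := by
      intro x v X
      refine (congrArg (fun T : Coord n →L[ℝ] Coord n => T X) (averageConnection_eq hF hpar
        (mdifferentiableAt_frame x (mem_chart_source _ x) v) hy)).trans ?_
      refine (averageIntegrand_apply F
        (mdifferentiableAt_frame x (mem_chart_source _ x) v) y X).trans ?_
      rw [chartDeriv_comp_frame, frame_self]
      exact zero_add _
    funext x
    ext1 v
    ext1 w
    -- Torsion is tensorial, so it may be evaluated on the coordinate extensions of v and w, whose
    -- bracket vanishes.
    refine (IsCovariantDerivativeOn.torsion_apply_eq_extend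
      D.isCovariantDerivativeOnUniv v w).trans ?_
    rw [extend_eq_frame, extend_eq_frame]
    refine (congrArg (_ - ·) (mlieBracket_frame x _ _ (mem_chart_source _ x))).trans ?_
    refine (sub_zero _).trans ((congrArg₂ (· - ·) (hfr x w v) (hfr x v w)).trans ?_)
    exact sub_eq_zero.2 (berwaldAt_symm hF x hy w v)
  · intro x X Y Z hY hZ
    refine (mvfderiv_eq_chartDeriv (mdifferentiableAt_inner hY hZ) X).trans ?_
    refine (chartDeriv_inner_of_isParallelMetric hpar hY hZ hy X).trans ?_
    rw [← averageConnection_eq hF hpar hY hy, ← averageConnection_eq hF hpar hZ hy]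
    rfl

theorem averageConnection_eq_leviCivita [NeZero n] (hF : IsFinsler F)
    (hpar : IsParallelMetric (berwaldConnection F) h)
    {D : CovariantDerivative (𝓡 n) (Coord n) (TangentSpace (𝓡 n) : M → Type _)}
    (hD : IsLeviCivita h D) {Y : (z : M) → TangentSpace (𝓡 n) z} {x : M}
    (hY : MDifferentiableAt (𝓡 n) (𝓡 n).tangent
      (fun z => (⟨z, Y z⟩ : TangentBundle (𝓡 n) M)) x) :
    averageConnection F (berwaldConnection F) Y x = D Y x := by
  obtain ⟨y, hy⟩ := exists_ne (0 : Coord n)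
  rw [averageConnection_eq hF hpar hY hy]
  refine ContinuousLinearMap.ext fun X => Eq.trans ?_ (covariantDerivative_eq D hY X).symm
  refine (averageIntegrand_apply F hY y X).trans ?_
  rw [berwaldAt_eq_christoffelAt hF hpar hD x hy]
  rfl

theorem exists_leviCivita_averageConnection (hF : IsFinsler F)
    (hpar : IsParallelMetric (berwaldConnection F) h) :
    (∃ D : CovariantDerivative (𝓡 n) (Coord n) (TangentSpace (𝓡 n) : M → Type _),
      D.toFun = averageConnection F (berwaldConnection F) ∧ IsLeviCivita h D) ∧
    ∀ D : CovariantDerivative (𝓡 n) (Coord n) (TangentSpace (𝓡 n) : M → Type _),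
      IsLeviCivita h D → ∀ (Y : (x : M) → TangentSpace (𝓡 n) x) (x : M),
          MDifferentiableAt (𝓡 n) (𝓡 n).tangent
            (fun z => (⟨z, Y z⟩ : TangentBundle (𝓡 n) M)) x →
          averageConnection F (berwaldConnection F) Y x = D Y x := by
  -- In dimension 0 there is no y ≠ 0 and the volume is zero, but tangent spaces are trivial and
  -- every identity holds for that reason.
  rcases Nat.eq_zero_or_pos n with rfl | hn
  · have hs : ∀ x : M, Subsingleton (TangentSpace (𝓡 0) x) := fun x =>
      inferInstanceAs (Subsingleton (Coord 0))
    have hss : ∀ x : M, Subsingleton (TangentSpace (𝓡 0) x →L[ℝ] TangentSpace (𝓡 0) x) := fun x =>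
      ⟨fun S T => ContinuousLinearMap.ext fun v => Subsingleton.elim _ _⟩
    refine ⟨⟨⟨_, ⟨fun _ _ _ => Subsingleton.elim _ _, fun _ _ _ => Subsingleton.elim _ _⟩⟩,
      rfl, (isLeviCivita_iff _).2 ⟨?_, ?_⟩⟩, fun D _ Y x _ => Subsingleton.elim _ _⟩
    · funext x
      ext1 v
      exact Subsingleton.elim _ _
    · intro x X Y Z _ _
      have h0 : ∀ v w : TangentSpace (𝓡 0) x, h.inner x v w = 0 := fun v w => by
        rw [Subsingleton.elim v 0, map_zero, zero_apply]
      rw [h0, h0, Subsingleton.elim X 0, map_zero, add_zero]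
  · have : NeZero n := ⟨hn.ne'⟩
    exact ⟨⟨_, rfl, isLeviCivita_averageConnection F hF hpar⟩,
      fun D hD Y x hY => averageConnection_eq_leviCivita hF hpar hD hY⟩

end Average

/-! ### Vector fields along curves -/

section Along

variable {n : ℕ} {M : Type*} [TopologicalSpace M] [ChartedSpace (Coord n) M]
  [IsManifold (𝓡 n) ∞ M] {γ : ℝ → M} {t : ℝ}

theorem preimage_extChartAt_inter_range (s : Set ℝ) (t : ℝ) :
    (extChartAt 𝓘(ℝ, ℝ) t).symm ⁻¹' s ∩ range 𝓘(ℝ, ℝ) = s := by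
  ext
  simp [chartAt_self_eq]

/-- The components of `V s` in the chart at `γ t`. -/
def compAlong (γ : ℝ → M) (V : (t : ℝ) → TangentSpace (𝓡 n) (γ t)) (t s : ℝ) : Coord n :=
  comp (γ t) (V s)

theorem compAlong_self (V : (t : ℝ) → TangentSpace (𝓡 n) (γ t)) (t : ℝ) :
    compAlong γ V t t = V t := comp_self (γ t) (V t)

/-- The velocity of `γ` as an element of the coordinate space. -/
def velocityCoord (γ : ℝ → M) (t : ℝ) : Coord n := velocity γ t

omit [IsManifold (𝓡 n) ∞ M] in
theorem hasDerivWithinAt_extChartAt (hγ : MDifferentiableWithinAt 𝓘(ℝ, ℝ) (𝓡 n) γ (Icc 0 1) t)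
    (c : M) (hc : c = γ t) :
    HasDerivWithinAt (fun s => (extChartAt (𝓡 n) c (γ s) : Coord n)) (velocityCoord γ t)
      (Icc 0 1) t := by
  subst hc
  have h1 : DifferentiableWithinAt ℝ (fun s => (extChartAt (𝓡 n) (γ t) (γ s) : Coord n))
      (Icc 0 1) t := by
    have := hγ.differentiableWithinAt_writtenInExtChartAt
    rwa [preimage_extChartAt_inter_range] at this
  have h2 : velocityCoord γ t
      = fderivWithin ℝ (fun s => (extChartAt (𝓡 n) (γ t) (γ s) : Coord n)) (Icc 0 1) t 1 := by
    have := congrArg (fun T : ℝ →L[ℝ] Coord n => T 1) hγ.mfderivWithin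
    rwa [preimage_extChartAt_inter_range] at this
  rw [h2]
  exact h1.hasFDerivWithinAt.hasDerivWithinAt

omit [IsManifold (𝓡 n) ∞ M] in
theorem hasDerivWithinAt_comp_curve {G : Type*} [NormedAddCommGroup G] [NormedSpace ℝ G]
    {f : M → G} (hf : MDifferentiableAt (𝓡 n) 𝓘(ℝ, G) f (γ t))
    (hγ : MDifferentiableWithinAt 𝓘(ℝ, ℝ) (𝓡 n) γ (Icc 0 1) t) :
    HasDerivWithinAt (fun s => f (γ s)) (chartDeriv (n := n) (γ t) f (velocityCoord γ t))
      (Icc 0 1) t := by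
  have h := (hasFDerivAt_chart hf).comp_hasDerivWithinAt t
    (hasDerivWithinAt_extChartAt (n := n) hγ (γ t) rfl)
  refine h.congr_of_eventuallyEq ?_ ?_
  · have hs := hγ.continuousWithinAt.preimage_mem_nhdsWithin
      (t := (chartAt (Coord n) (γ t)).source)
      ((chartAt (Coord n) (γ t)).open_source.mem_nhds (mem_chart_source (Coord n) (γ t)))
    filter_upwards [hs] with s hs
    have : (extChartAt (𝓡 n) (γ t)).symm (extChartAt (𝓡 n) (γ t) (γ s)) = γ s :=
      (extChartAt (𝓡 n) (γ t)).left_inv (by rwa [extChartAt_source])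
    exact congrArg f this.symm
  · exact congrArg f (chart_symm_self (n := n) (γ t)).symm

theorem mdifferentiableWithinAt_curveTM_iff {V : (t : ℝ) → TangentSpace (𝓡 n) (γ t)}
    (hγ : MDifferentiableWithinAt 𝓘(ℝ, ℝ) (𝓡 n) γ (Icc 0 1) t) :
    MDifferentiableWithinAt 𝓘(ℝ, ℝ) (𝓡 n).tangent (curveTM γ V) (Icc 0 1) t
      ↔ DifferentiableWithinAt ℝ (compAlong γ V t) (Icc 0 1) t := by
  rw [← mdifferentiableWithinAt_iff_differentiableWithinAt]
  exact (mdifferentiableWithinAt_totalSpace (IM := 𝓘(ℝ, ℝ)) (𝓡 n) (curveTM γ V)).trans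
    (and_iff_right hγ)

theorem velocityTM_eq {V : (t : ℝ) → TangentSpace (𝓡 n) (γ t)} (ht : t ∈ Icc (0 : ℝ) 1)
    (hγ : MDifferentiableWithinAt 𝓘(ℝ, ℝ) (𝓡 n) γ (Icc 0 1) t) {w : Coord n}
    (hV : HasDerivWithinAt (compAlong γ V t) w (Icc 0 1) t) :
    velocityTM γ V t = ((velocityCoord γ t, w) : Coord n × Coord n) := by
  have hm : MDifferentiableWithinAt 𝓘(ℝ, ℝ) (𝓡 n).tangent (curveTM γ V) (Icc 0 1) t :=
    (mdifferentiableWithinAt_curveTM_iff hγ).2 hV.differentiableWithinAt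
  have h2 : velocityTM γ V t
      = fderivWithin ℝ (fun s => ((extChartAt (𝓡 n) (γ t) (γ s), compAlong γ V t s) :
        Coord n × Coord n)) (Icc 0 1) t 1 := by
    have := congrArg (fun T : ℝ →L[ℝ] Coord n × Coord n => T 1) hm.mfderivWithin
    rwa [preimage_extChartAt_inter_range] at this
  rw [h2]
  have h3 := (hasDerivWithinAt_extChartAt hγ (γ t) rfl).prodMk hV
  rw [h3.hasFDerivWithinAt.fderivWithin ((uniqueDiffOn_Icc zero_lt_one) t ht)]
  exact one_smul ℝ ((velocityCoord γ t, w) : Coord n × Coord n)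

variable {V : (t : ℝ) → TangentSpace (𝓡 n) (γ t)}

/-- The equation at time t is written in the chart at γ t, which moves with t; `isParallelOn_frame`
links it to an ODE in one fixed chart. -/
theorem isParallelAlong_iff
    {D : CovariantDerivative (𝓡 n) (Coord n) (TangentSpace (𝓡 n) : M → Type _)}
    (hγ : MDifferentiableOn 𝓘(ℝ, ℝ) (𝓡 n) γ (Icc 0 1)) :
    IsParallelAlong D γ V ↔ ∀ t ∈ Icc (0 : ℝ) 1, HasDerivWithinAt (compAlong γ V t)
      (-christoffelAt D (γ t) (V t) (velocityCoord γ t)) (Icc 0 1) t := by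
  have key : ∀ t ∈ Icc (0 : ℝ) 1, ∀ w : Coord n,
      HasDerivWithinAt (compAlong γ V t) w (Icc 0 1) t →
      (fibreComponent (velocityTM γ V t)
        + D (FiberBundle.extend (Coord n) (V t)) (γ t) (velocity γ t) = 0
        ↔ w = -christoffelAt D (γ t) (V t) (velocityCoord γ t)) := by
    intro t ht w hw
    rw [velocityTM_eq ht (hγ t ht) hw, extend_eq_frame]
    exact add_eq_zero_iff_eq_neg
  constructor
  · rintro ⟨hd, he⟩ t ht
    have hw := ((mdifferentiableWithinAt_curveTM_iff (hγ t ht)).1 (hd t ht)).hasDerivWithinAt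
    rwa [← (key t ht _ hw).1 (he t ht)]
  · intro hV
    exact ⟨fun t ht =>
      (mdifferentiableWithinAt_curveTM_iff (hγ t ht)).2 (hV t ht).differentiableWithinAt,
      fun t ht => (key t ht _ (hV t ht)).2 rfl⟩

theorem isHorizontalLift_iff {F : TangentBundle (𝓡 n) M → ℝ} (hF : IsFinsler F)
    (hγ : MDifferentiableOn 𝓘(ℝ, ℝ) (𝓡 n) γ (Icc 0 1)) :
    IsHorizontalLift F γ V ↔ ∀ t ∈ Icc (0 : ℝ) 1, V t ≠ 0 ∧ HasDerivWithinAt (compAlong γ V t)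
      (-berwaldAt F (γ t) (V t) (V t) (velocityCoord γ t)) (Icc 0 1) t := by
  have key : ∀ t ∈ Icc (0 : ℝ) 1, V t ≠ 0 → ∀ w : Coord n,
      HasDerivWithinAt (compAlong γ V t) w (Icc 0 1) t →
      (velocityTM γ V t = horizontalLift F ⟨γ t, V t⟩ (velocity γ t)
        ↔ w = -berwaldAt F (γ t) (V t) (V t) (velocityCoord γ t)) := by
    intro t ht h0 w hw
    have h1 : horizontalLift F ⟨γ t, V t⟩ (velocity γ t)
        = ((velocityCoord γ t, -berwaldAt F (γ t) (V t) (V t) (velocityCoord γ t)) :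
          Coord n × Coord n) := horizontalLift_eq hF (γ t) h0 (velocityCoord γ t)
    rw [velocityTM_eq ht (hγ t ht) hw, h1]
    exact ⟨fun h => (Prod.mk.inj h).2, fun h => by rw [h]⟩
  constructor
  · rintro ⟨hd, he⟩ t ht
    have hw := ((mdifferentiableWithinAt_curveTM_iff (hγ t ht)).1 (hd t ht)).hasDerivWithinAt
    refine ⟨(he t ht).1, ?_⟩
    rwa [← (key t ht (he t ht).1 _ hw).1 (he t ht).2]
  · intro hV
    exact ⟨fun t ht =>
      (mdifferentiableWithinAt_curveTM_iff (hγ t ht)).2 (hV t ht).2.differentiableWithinAt,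
      fun t ht => ⟨(hV t ht).1, (key t ht (hV t ht).1 _ (hV t ht).2).2 rfl⟩⟩

/-- This is δF/δxʲ = 0 contracted with X, with N^i_j rewritten through the Berwald coefficients. -/
theorem fderiv_localExpr_berwaldAt {F : TangentBundle (𝓡 n) M → ℝ} (hF : IsFinsler F) (x : M)
    {y : Coord n} (hy : y ≠ 0) (X : Coord n) :
    fderiv ℝ (localExpr F x) (extChartAt (𝓡 n) x x, y) (X, -berwaldAt F x y y X) = 0 := by
  have hq := self_mem_slitTarget x hy
  have hsum : ((X, -berwaldAt F x y y X) : Coord n × Coord n)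
      = (X, 0) + (0, -berwaldAt F x y y X) := by simp
  rw [hsum, map_add, fderiv_snd_zero, fderiv_zero_snd]
  have h0 : ∀ j, dX j (localExpr F x) (extChartAt (𝓡 n) x x, y)
      = ∑ i, nonlinCoeff (localExpr F x) (extChartAt (𝓡 n) x x, y) i j
        * dY i (localExpr F x) (extChartAt (𝓡 n) x x, y) := fun j =>
    sub_eq_zero.1 ((hF.isLocalFinsler x).dHor_eq_zero hq j)
  have h1 : ∀ i, (-berwaldAt F x y y X) i
      = -∑ j, nonlinCoeff (localExpr F x) (extChartAt (𝓡 n) x x, y) i j * X j := by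
    intro i
    change -(berwaldAt F x y y X i) = _
    rw [berwaldAt, coeffMap_apply]
    congr 1
    refine Finset.sum_congr rfl fun j _ => ?_
    rw [(hF.isLocalFinsler x).nonlinCoeff_eq_sum_berwaldCoeff hq, Finset.sum_mul]
  simp only [h0, h1, Finset.mul_sum, neg_mul, Finset.sum_mul, Finset.sum_neg_distrib]
  rw [Finset.sum_comm, ← sub_eq_add_neg, ← Finset.sum_sub_distrib]
  refine Finset.sum_eq_zero fun i _ => ?_
  rw [← Finset.sum_sub_distrib]
  exact Finset.sum_eq_zero fun j _ => by ring

/-- In the chart at γ t the curve has the horizontal velocity of `fderiv_localExpr_berwaldAt`, so F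
has zero derivative along it at every t. -/
theorem finsler_eq_of_isHorizontalLift {F : TangentBundle (𝓡 n) M → ℝ} (hF : IsFinsler F)
    (hγ : MDifferentiableOn 𝓘(ℝ, ℝ) (𝓡 n) γ (Icc 0 1)) (hV : IsHorizontalLift F γ V) :
    ∀ t ∈ Icc (0 : ℝ) 1, F ⟨γ t, V t⟩ = F ⟨γ 0, V 0⟩ := by
  rw [isHorizontalLift_iff hF hγ] at hV
  have hderiv : ∀ t ∈ Icc (0 : ℝ) 1,
      HasDerivWithinAt (fun s => F ⟨γ s, V s⟩) 0 (Icc 0 1) t := by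
    intro t ht
    obtain ⟨h0, hd⟩ := hV t ht
    have hq := self_mem_slitTarget (γ t) (v := V t) h0
    have hL := (differentiableAt_of_contDiffOn (isOpen_slitTarget (γ t))
      (hF.isLocalFinsler (γ t)).smooth hq).hasFDerivAt
    have h2 := (hasDerivWithinAt_extChartAt (n := n) (hγ t ht) (γ t) rfl).prodMk hd
    rw [← compAlong_self V t] at hL
    have h3 := hL.comp_hasDerivWithinAt t h2
    rw [compAlong_self V t, fderiv_localExpr_berwaldAt hF (γ t) h0] at h3
    refine h3.congr_of_eventuallyEq ?_ ?_
    · have hs := (hγ t ht).continuousWithinAt.preimage_mem_nhdsWithin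
        (t := (chartAt (Coord n) (γ t)).source)
        ((chartAt (Coord n) (γ t)).open_source.mem_nhds (mem_chart_source (Coord n) (γ t)))
      filter_upwards [hs] with s hs
      have hs' : (⟨γ s, V s⟩ : TangentBundle (𝓡 n) M) ∈ (natChart (n := n) (γ t)).source := by
        rw [natChart_source]
        exact hs
      exact congrArg F ((natChart (n := n) (γ t)).left_inv hs').symm
    · refine congrArg F ((symm_self (γ t) (V t)).symm.trans ?_)
      rw [← compAlong_self V t]
  intro t ht
  exact constant_of_derivWithin_zero (fun s hs => (hderiv s hs).differentiableWithinAt)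
    (fun s hs => (hderiv s (Ico_subset_Icc_self hs)).derivWithin
      (uniqueDiffOn_Icc zero_lt_one s (Ico_subset_Icc_self hs))) t ht

end Along

/-! ### Parallel fields along curves -/

section Parallel

variable {n : ℕ} {M : Type*} [TopologicalSpace M] [ChartedSpace (Coord n) M]
  [IsManifold (𝓡 n) ∞ M] {γ : ℝ → M} {S : Set ℝ} {t : ℝ}
  {D : CovariantDerivative (𝓡 n) (Coord n) (TangentSpace (𝓡 n) : M → Type _)}
  {h : ContMDiffRiemannianMetric (𝓡 n) ∞ (Coord n) (TangentSpace (𝓡 n) : M → Type _)}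

/-- The standard basis vectors of `ℝⁿ`. -/
def stdVec (i : Fin n) : Coord n := EuclideanSpace.single i 1

theorem sum_smul_stdVec (v : Coord n) : ∑ i, v i • stdVec i = v := by
  simpa [stdVec] using (EuclideanSpace.basisFun (Fin n) ℝ).sum_repr v

theorem sum_mul_stdVec (B : Coord n →L[ℝ] Coord n →L[ℝ] ℝ) (a b : Coord n) :
    ∑ i, ∑ j, a i * b j * B (stdVec i) (stdVec j) = B a b := by
  conv_rhs => rw [← sum_smul_stdVec a, ← sum_smul_stdVec b]
  simp only [map_sum, map_smul, sum_apply, smul_apply, smul_eq_mul, Finset.mul_sum]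
  rw [Finset.sum_comm]
  refine Finset.sum_congr rfl fun i _ => Finset.sum_congr rfl fun j _ => ?_
  ring

theorem frame_eq_sum (c : M) {z : M} (hz : z ∈ (chartAt (Coord n) c).source) (v : Coord n) :
    frame c v z = ∑ i, v i • frame c (stdVec i) z := by
  set e := trivializationAt (Coord n) (TangentSpace (𝓡 n) : M → Type _) c with he
  have hz' : z ∈ e.baseSet := by simpa [he] using hz
  have hf : ∀ w : Coord n, frame c w z = e.symmL ℝ z w := fun w =>
    (Bundle.Trivialization.symmL_apply e hz' w).symm
  simp only [hf]
  conv_lhs => rw [← sum_smul_stdVec v]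
  rw [map_sum]
  simp only [map_smul]

theorem metricComp_eq_sum (c : M) {z : M} (hz : z ∈ (chartAt (Coord n) c).source)
    (v w : Coord n) :
    metricComp h c v w z = ∑ i, ∑ j, v i * w j * metricComp h c (stdVec i) (stdVec j) z := by
  unfold metricComp
  rw [frame_eq_sum c hz v, frame_eq_sum c hz w]
  simp only [map_sum, map_smul, sum_apply, smul_apply, smul_eq_mul, Finset.mul_sum]
  rw [Finset.sum_comm]
  refine Finset.sum_congr rfl fun i _ => Finset.sum_congr rfl fun j _ => ?_
  ring

omit [IsManifold (𝓡 n) ∞ M] in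
theorem eventually_mem_source (hγ : ContinuousWithinAt γ S t) (c : M)
    (hc : γ t ∈ (chartAt (Coord n) c).source) :
    ∀ᶠ s in nhdsWithin t S, γ s ∈ (chartAt (Coord n) c).source :=
  hγ.preimage_mem_nhdsWithin ((chartAt (Coord n) c).open_source.mem_nhds hc)

/-- The field `V` along `γ` is parallel on the set `S` of parameters. -/
def IsParallelOn (D : CovariantDerivative (𝓡 n) (Coord n) (TangentSpace (𝓡 n) : M → Type _))
    (γ : ℝ → M) (V : (t : ℝ) → TangentSpace (𝓡 n) (γ t)) (S : Set ℝ) : Prop :=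
  ∀ t ∈ S, HasDerivWithinAt (compAlong γ V t)
    (-christoffelAt D (γ t) (V t) (velocityCoord γ t)) S t

variable (D) in
/-- The Christoffel symbols `v ↦ Γ v X`, as a linear map. -/
def christoffelMap (x : M) (X : Coord n) : Coord n →L[ℝ] Coord n := D (frame x X) x

/-- Torsion-freeness exchanges the differentiated field with the direction, in which a connection is
linear by construction. This is the source of all linearity in v below. -/
theorem christoffelMap_apply (hD : IsLeviCivita h D) (x : M) (v X : Coord n) :
    christoffelMap D x X v = christoffelAt D x v X :=
  (isChristoffelAt_christoffelAt hD x).symm X v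

theorem christoffelAt_linComb (hD : IsLeviCivita h D) (x : M) (v w X : Coord n) (a b : ℝ) :
    christoffelAt D x (a • v + b • w) X
      = a • christoffelAt D x v X + b • christoffelAt D x w X := by
  simp only [← christoffelMap_apply hD, map_add, map_smul]

theorem IsParallelOn.linComb (hD : IsLeviCivita h D) {V W : (t : ℝ) → TangentSpace (𝓡 n) (γ t)}
    (hγ : ContinuousOn γ S) (hV : IsParallelOn D γ V S) (hW : IsParallelOn D γ W S) (a b : ℝ) :
    IsParallelOn D γ (fun t => a • V t + b • W t) S := by
  intro t ht
  have h1 := ((hV t ht).const_smul a).add ((hW t ht).const_smul b)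
  have h2 : a • -christoffelAt D (γ t) (V t) (velocityCoord γ t)
      + b • -christoffelAt D (γ t) (W t) (velocityCoord γ t)
      = -christoffelAt D (γ t) (a • V t + b • W t) (velocityCoord γ t) := by
    have := christoffelAt_linComb hD (γ t) (V t) (W t) (velocityCoord γ t) a b
    refine Eq.trans ?_ (congrArg Neg.neg this).symm
    rw [smul_neg, smul_neg, neg_add]
  rw [h2] at h1
  have hc := mem_chart_source (Coord n) (γ t)
  have key : ∀ s, γ s ∈ (chartAt (Coord n) (γ t)).source →
      compAlong γ (fun t => a • V t + b • W t) t s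
        = a • compAlong γ V t s + b • compAlong γ W t s := fun s hs => by
    unfold compAlong
    rw [comp_add _ hs, comp_smul _ hs, comp_smul _ hs]
  refine h1.congr_of_eventuallyEq ?_ (key t hc)
  filter_upwards [eventually_mem_source (hγ t ht) (γ t) hc] with s hs using key s hs

/-- In the chart at γ t, h(V, V) = ∑ Vⁱ Vʲ h_ij. The factors V contribute -2 h(Γ V, V), and
compatibility makes the derivative of h_ij contribute +2 h(Γ V, V). -/
theorem IsParallelOn.hasDerivWithinAt_inner (hD : IsLeviCivita h D)
    {V : (t : ℝ) → TangentSpace (𝓡 n) (γ t)}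
    (hγ : MDifferentiableOn 𝓘(ℝ, ℝ) (𝓡 n) γ (Icc 0 1)) (hV : IsParallelOn D γ V (Icc 0 1))
    (ht : t ∈ Icc (0 : ℝ) 1) :
    HasDerivWithinAt (fun s => h.inner (γ s) (V s) (V s)) 0 (Icc 0 1) t := by
  set X := velocityCoord (n := n) γ t with hX
  set v : Coord n := V t with hv
  set w : Coord n := -christoffelAt D (γ t) v X with hw
  have hc := mem_chart_source (Coord n) (γ t)
  have ha : ∀ i, HasDerivWithinAt (fun s => compAlong γ V t s i) (w i) (Icc 0 1) t := fun i =>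
    (EuclideanSpace.proj i : Coord n →L[ℝ] ℝ).hasFDerivAt.comp_hasDerivWithinAt t (hV t ht)
  have hm : ∀ i j, HasDerivWithinAt
      (fun s => metricComp h (γ t) (stdVec i) (stdVec j) (γ s))
      (chartDeriv (γ t) (metricComp h (γ t) (stdVec i) (stdVec j)) X) (Icc 0 1) t := fun i j =>
    hasDerivWithinAt_comp_curve (mdifferentiableAt_metricComp (γ t) _ _ hc) (hγ t ht)
  have hsum := HasDerivWithinAt.fun_sum (u := Finset.univ) fun i _ =>
    HasDerivWithinAt.fun_sum (u := Finset.univ) fun j _ =>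
      ((ha i).fun_mul (ha j)).fun_mul (hm i j)
  have hval : ∀ s, γ s ∈ (chartAt (Coord n) (γ t)).source →
      h.inner (γ s) (V s) (V s) = ∑ i, ∑ j, compAlong γ V t s i * compAlong γ V t s j
        * metricComp h (γ t) (stdVec i) (stdVec j) (γ s) := by
    intro s hs
    rw [← metricComp_eq_sum (γ t) hs]
    unfold metricComp compAlong
    rw [frame_comp (γ t) hs]
  refine (hsum.congr_of_eventuallyEq ?_ (hval t hc)).congr_deriv ?_
  · filter_upwards [eventually_mem_source (hγ t ht).continuousWithinAt (γ t) hc] with s hs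
      using hval s hs
  · have hg : ∀ i j : Fin n, metricComp h (γ t) (stdVec i) (stdVec j) (γ t)
        = metricAt h (γ t) (stdVec i) (stdVec j) := fun i j => by
      unfold metricComp
      rw [frame_self, frame_self]
      rfl
    have hcs : ∀ i, compAlong γ V t t i = v i := fun i => by rw [compAlong_self]
    have hΓ := fun i j : Fin n =>
      (isChristoffelAt_christoffelAt hD (γ t)).compat (stdVec i) (stdVec j) X
    simp only [← christoffelMap_apply hD] at hΓ
    simp only [hg, hcs, hΓ]
    have e1 := sum_mul_stdVec (metricAt h (γ t)) w v
    have e2 := sum_mul_stdVec (metricAt h (γ t)) v w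
    -- The two halves of the derivative of h_ij are the bilinear forms h(Γ a, b) and h(a, Γ b),
    -- evaluated at (v, v).
    have e3 := sum_mul_stdVec ((metricAt h (γ t)).comp (christoffelMap D (γ t) X)) v v
    have e4 := sum_mul_stdVec ((metricAt h (γ t)).flip.comp (christoffelMap D (γ t) X)).flip v v
    have hwv : w = -christoffelMap D (γ t) X v := by rw [christoffelMap_apply hD]
    rw [hwv] at e1 e2
    simp only [map_neg, neg_apply] at e1 e2
    simp only [ContinuousLinearMap.comp_apply, ContinuousLinearMap.flip_apply] at e3 e4
    have e5 : ∀ i j : Fin n, (w i * v j + v i * w j) * metricAt h (γ t) (stdVec i) (stdVec j)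
        + v i * v j * (metricAt h (γ t) (christoffelMap D (γ t) X (stdVec i)) (stdVec j)
          + metricAt h (γ t) (stdVec i) (christoffelMap D (γ t) X (stdVec j)))
        = w i * v j * metricAt h (γ t) (stdVec i) (stdVec j)
          + v i * w j * metricAt h (γ t) (stdVec i) (stdVec j)
          + v i * v j * metricAt h (γ t) (christoffelMap D (γ t) X (stdVec i)) (stdVec j)
          + v i * v j * metricAt h (γ t) (stdVec i) (christoffelMap D (γ t) X (stdVec j)) :=
      fun i j => by ring
    simp only [e5, Finset.sum_add_distrib]
    rw [hwv, e1, e2, e3, e4]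
    ring

theorem IsParallelOn.inner_eq (hD : IsLeviCivita h D)
    {V : (t : ℝ) → TangentSpace (𝓡 n) (γ t)}
    (hγ : MDifferentiableOn 𝓘(ℝ, ℝ) (𝓡 n) γ (Icc 0 1)) (hV : IsParallelOn D γ V (Icc 0 1))
    (ht : t ∈ Icc (0 : ℝ) 1) : h.inner (γ t) (V t) (V t) = h.inner (γ 0) (V 0) (V 0) :=
  constant_of_derivWithin_zero (f := fun s => h.inner (γ s) (V s) (V s))
    (fun _ hs => (hV.hasDerivWithinAt_inner hD hγ hs).differentiableWithinAt)
    (fun s hs => (hV.hasDerivWithinAt_inner hD hγ (Ico_subset_Icc_self hs)).derivWithin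
      (uniqueDiffOn_Icc zero_lt_one s (Ico_subset_Icc_self hs))) t ht

/-- The h-norm is constant. Applied to the difference of two parallel fields this also yields
uniqueness, without a Grönwall estimate. -/
theorem IsParallelOn.eq_zero_iff (hD : IsLeviCivita h D)
    {V : (t : ℝ) → TangentSpace (𝓡 n) (γ t)}
    (hγ : MDifferentiableOn 𝓘(ℝ, ℝ) (𝓡 n) γ (Icc 0 1)) (hV : IsParallelOn D γ V (Icc 0 1))
    (ht : t ∈ Icc (0 : ℝ) 1) : V t = 0 ↔ V 0 = 0 := by
  have hz : ∀ (x : M) (v : TangentSpace (𝓡 n) x), v = 0 ↔ h.inner x v v = 0 := fun x v =>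
    ⟨fun h0 => by rw [h0, map_zero], fun h0 => by_contra fun hne => (h.pos x v hne).ne' h0⟩
  rw [hz, hV.inner_eq hD hγ ht, ← hz]

theorem isHorizontalLift_iff_isParallelAlong {F : TangentBundle (𝓡 n) M → ℝ} (hF : IsFinsler F)
    (hpar : IsParallelMetric (berwaldConnection F) h) (hD : IsLeviCivita h D)
    (hγ : MDifferentiableOn 𝓘(ℝ, ℝ) (𝓡 n) γ (Icc 0 1))
    (V : (t : ℝ) → TangentSpace (𝓡 n) (γ t)) :
    IsHorizontalLift F γ V ↔ IsParallelAlong D γ V ∧ ∀ t ∈ Icc (0 : ℝ) 1, V t ≠ 0 := by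
  rw [isHorizontalLift_iff hF hγ, isParallelAlong_iff hγ, ← forall₂_and]
  refine forall₂_congr fun t _ => and_comm.trans (and_congr_left fun h0 => ?_)
  rw [berwaldAt_eq_christoffelAt hF hpar hD (γ t) (y := V t) h0]

end Parallel

/-! ### Continuity of the Christoffel symbols in a chart -/

section ChartChristoffel

variable {n : ℕ} {M : Type*} [TopologicalSpace M] [ChartedSpace (Coord n) M]
  [IsManifold (𝓡 n) ∞ M]
  {D : CovariantDerivative (𝓡 n) (Coord n) (TangentSpace (𝓡 n) : M → Type _)}
  {h : ContMDiffRiemannianMetric (𝓡 n) ∞ (Coord n) (TangentSpace (𝓡 n) : M → Type _)}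

/-- The derivative is the fibre component of the tangent map of f, which is continuous for f of
class C¹. -/
theorem continuousOn_mvfderiv_frame (c : M) {f : M → ℝ}
    (hf : ContMDiffOn (𝓡 n) 𝓘(ℝ, ℝ) 1 f (chartAt (Coord n) c).source) (w : Coord n) :
    ContinuousOn (fun z => mvfderiv (𝓡 n) f z (frame c w z)) (chartAt (Coord n) c).source := by
  have ho := (chartAt (Coord n) c).open_source
  have h1 := hf.continuousOn_tangentMapWithin le_rfl ho.uniqueMDiffOn
  have h2 : ContinuousOn (fun z => (⟨z, frame c w z⟩ : TangentBundle (𝓡 n) M))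
      (chartAt (Coord n) c).source := fun z hz =>
    (contMDiffAt_frame c hz w).continuousAt.continuousWithinAt
  have h3 := h1.comp h2 fun z hz => hz
  have h4 :=
    (contMDiff_snd_tangentBundle_modelSpace (n := 1) ℝ 𝓘(ℝ, ℝ)).continuous.comp_continuousOn h3
  refine h4.congr fun z hz => ?_
  change mfderiv (𝓡 n) 𝓘(ℝ, ℝ) f z (frame c w z)
    = mfderivWithin (𝓡 n) 𝓘(ℝ, ℝ) f (chartAt (Coord n) c).source z (frame c w z)
  rw [mfderivWithin_of_isOpen ho hz]

/-- The components in the chart at `c` of `D_{∂_j} ∂_i`. -/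
def chartChristoffel (D : CovariantDerivative (𝓡 n) (Coord n) (TangentSpace (𝓡 n) : M → Type _))
    (c : M) (i j : Fin n) (z : M) : Coord n :=
  comp c (D (frame c (stdVec i)) z (frame c (stdVec j) z))

/-- The bracket terms are absent because coordinate fields commute. Since D is not assumed to be
regular, the continuity of its Christoffel symbols is drawn from this formula. -/
theorem koszul (hD : IsLeviCivita h D) (c : M) (u v w : Coord n) {z : M}
    (hz : z ∈ (chartAt (Coord n) c).source) :
    2 * h.inner z (D (frame c u) z (frame c v z)) (frame c w z)
      = mvfderiv (𝓡 n) (metricComp h c u w) z (frame c v z)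
        + mvfderiv (𝓡 n) (metricComp h c v w) z (frame c u z)
        - mvfderiv (𝓡 n) (metricComp h c u v) z (frame c w z) := by
  have hm := fun a b d : Coord n => ((isLeviCivita_iff D).1 hD).2 z (frame c d z) (frame c a)
    (frame c b) (mdifferentiableAt_frame c hz a) (mdifferentiableAt_frame c hz b)
  have ht := fun a b : Coord n => torsion_frame hD c a b hz
  have e1 := hm u w v
  have e2 := hm v w u
  have e3 := hm u v w
  rw [ht u w] at e3
  rw [ht v u] at e2
  rw [ht v w, h.symm z (frame c u z)] at e3
  rw [h.symm z (D (frame c w) z (frame c u z))] at e3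
  change mvfderiv (𝓡 n) (metricComp h c u w) z (frame c v z) = _ at e1
  change mvfderiv (𝓡 n) (metricComp h c v w) z (frame c u z) = _ at e2
  change mvfderiv (𝓡 n) (metricComp h c u v) z (frame c w z) = _ at e3
  rw [e1, e2, e3, h.symm z (D (frame c w) z (frame c v z))]
  ring

variable (h) in
/-- The Gram matrix of the coordinate frame. -/
def gramMatrix (c z : M) : Matrix (Fin n) (Fin n) ℝ :=
  Matrix.of fun i j => metricComp h c (stdVec i) (stdVec j) z

theorem gramMatrix_posDef (c : M) {z : M} (hz : z ∈ (chartAt (Coord n) c).source) :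
    (gramMatrix h c z).PosDef := by
  refine Matrix.PosDef.of_dotProduct_mulVec_pos ?_ ?_
  · refine Matrix.IsHermitian.ext fun i j => ?_
    exact h.symm z _ _
  · intro v hv
    set w : Coord n := WithLp.toLp 2 v with hw
    have hw0 : w ≠ 0 := fun h0 => hv (by rw [← WithLp.ofLp_toLp 2 v, ← hw, h0]; rfl)
    have hfr : frame c w z ≠ 0 := fun h0 => hw0 (by
      rw [← comp_frame c hz w, h0, comp_zero c hz])
    have e : star v ⬝ᵥ (gramMatrix h c z).mulVec v = metricComp h c w w z := by
      rw [metricComp_eq_sum c hz]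
      simp only [dotProduct, Matrix.mulVec, star_trivial, Finset.mul_sum, gramMatrix,
        Matrix.of_apply]
      refine Finset.sum_congr rfl fun i _ => Finset.sum_congr rfl fun j _ => ?_
      simp only [hw]
      ring
    rw [e]
    exact h.pos z _ hfr

theorem continuousOn_metricComp (c : M) (v w : Coord n) :
    ContinuousOn (metricComp h c v w) (chartAt (Coord n) c).source := fun _ hz =>
  (contMDiffAt_metricComp c v w hz).continuousAt.continuousWithinAt

/-- Koszul's formula gives the scalar products K of D_{∂_j} ∂_i with the frame. They determine the
components through the Gram matrix, whose inverse is continuous. -/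
theorem continuousOn_chartChristoffel (hD : IsLeviCivita h D) (c : M) (i j : Fin n) :
    ContinuousOn (chartChristoffel D c i j) (chartAt (Coord n) c).source := by
  set K : M → Fin n → ℝ := fun z k => h.inner z (D (frame c (stdVec i)) z (frame c (stdVec j) z))
    (frame c (stdVec k) z) with hK
  have hKc : ∀ k, ContinuousOn (fun z => K z k) (chartAt (Coord n) c).source := by
    intro k
    have hd := fun a b d : Coord n => continuousOn_mvfderiv_frame c
      (f := metricComp h c a b) (fun z hz =>
        ((contMDiffAt_metricComp (h := h) c a b hz).of_le (by
          exact WithTop.coe_le_coe.2 (le_top : (1 : ℕ∞) ≤ ⊤))).contMDiffWithinAt) d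
    refine ((((hd (stdVec i) (stdVec k) (stdVec j)).add (hd (stdVec j) (stdVec k) (stdVec i))).sub
      (hd (stdVec i) (stdVec j) (stdVec k))).const_mul (1 / 2)).congr fun z hz => ?_
    have := koszul hD c (stdVec i) (stdVec j) (stdVec k) hz
    simp only [hK, Pi.add_apply, Pi.sub_apply]
    linarith
  have hsol : ∀ z ∈ (chartAt (Coord n) c).source,
      chartChristoffel D c i j z
        = WithLp.toLp 2 (Matrix.vecMul (K z) (gramMatrix h c z)⁻¹) := by
    intro z hz
    set a := chartChristoffel D c i j z with ha
    have h1 : Matrix.vecMul (a : Fin n → ℝ) (gramMatrix h c z) = K z := by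
      funext k
      have h2 : D (frame c (stdVec i)) z (frame c (stdVec j) z) = frame c a z :=
        (frame_comp c hz _).symm
      simp only [hK]
      rw [h2, frame_eq_sum c hz a]
      simp only [map_sum, map_smul, sum_apply, smul_apply, smul_eq_mul]
      rfl
    have hdet : IsUnit (gramMatrix h c z).det :=
      (gramMatrix_posDef c hz).det_pos.ne'.isUnit
    rw [← h1, Matrix.vecMul_vecMul, Matrix.mul_nonsing_inv _ hdet, Matrix.vecMul_one]
  rw [continuousOn_iff_continuous_domRestrict]
  have hG : Continuous fun z : (chartAt (Coord n) c).source => gramMatrix h c z.1 :=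
    continuous_matrix fun a b =>
      continuousOn_iff_continuous_domRestrict.1 (continuousOn_metricComp c (stdVec a) (stdVec b))
  have hGi : Continuous fun z : (chartAt (Coord n) c).source => (gramMatrix h c z.1)⁻¹ := by
    simp only [Matrix.inv_def, Ring.inverse_eq_inv']
    exact (hG.matrix_det.inv₀ fun z => (gramMatrix_posDef c z.2).det_pos.ne').smul
      hG.matrix_adjugate
  have hKr : Continuous fun z : (chartAt (Coord n) c).source => K z.1 :=
    continuous_pi fun k => continuousOn_iff_continuous_domRestrict.1 (hKc k)
  have hfin := (PiLp.continuous_toLp 2 (fun _ : Fin n => ℝ)).comp (hKr.matrix_vecMul hGi)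
  exact hfin.congr fun z => (hsol z.1 z.2).symm

end ChartChristoffel

/-! ### Existence of parallel fields -/

section LinearODE

variable {E : Type*} [NormedAddCommGroup E] [NormedSpace ℝ E] [CompleteSpace E]

/-- A linear differential equation has solutions on intervals which are short compared with the
norm of its coefficients. -/
theorem exists_linearODE_solution {A : ℝ → E →L[ℝ] E} {a b : ℝ} (hab : a ≤ b)
    (hA : ContinuousOn A (Icc a b)) {K : NNReal} (hK : ∀ t ∈ Icc a b, ‖A t‖ ≤ K)
    (hKab : K * (b - a) ≤ 1 / 2) (u : E) :
    ∃ U : ℝ → E, U a = u ∧ ∀ t ∈ Icc a b, HasDerivWithinAt U (-A t (U t)) (Icc a b) t := by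
  -- On the ball of radius ‖u‖ + 1 about u one has ‖v‖ ≤ 2‖u‖ + 1, so the speed is at most K(2‖u‖ +
  -- 1). In time b - a ≤ 1/(2K) the solution moves by at most ‖u‖ + 1/2 and stays in the ball.
  have hpl : IsPicardLindelof (fun t v => -A t v) (⟨a, left_mem_Icc.2 hab⟩ : Icc a b) u
      (‖u‖₊ + 1) 0 (K * (2 * ‖u‖₊ + 1)) K := by
    refine ⟨fun t ht => ?_, fun v _ => ?_, fun t ht v hv => ?_, ?_⟩
    · refine LipschitzWith.lipschitzOnWith (LipschitzWith.of_dist_le_mul fun v w => ?_)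
      rw [dist_neg_neg, dist_eq_norm, ← map_sub, dist_eq_norm]
      exact ((A t).le_opNorm _).trans (mul_le_mul_of_nonneg_right (hK t ht) (norm_nonneg _))
    · exact (hA.clm_apply continuousOn_const).neg
    · rw [norm_neg]
      have h1 : ‖v‖ ≤ 2 * ‖u‖ + 1 := by
        have := norm_le_norm_add_norm_sub u v
        rw [Metric.mem_closedBall, dist_eq_norm] at hv
        rw [norm_sub_rev] at this
        have hv' : ‖v - u‖ ≤ ‖u‖ + 1 := hv
        linarith
      refine ((A t).le_opNorm v).trans ?_
      push_cast
      exact mul_le_mul (hK t ht) h1 (norm_nonneg _) K.2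
    · push_cast
      simp only [sub_self, sub_zero]
      rw [max_eq_left (sub_nonneg.2 hab)]
      have := norm_nonneg u
      nlinarith
  exact hpl.exists_eq_forall_mem_Icc_hasDerivWithinAt₀

end LinearODE

/-! ### Parallel fields along a C¹ curve: local solutions and gluing -/

section Existence

variable {n : ℕ} {M : Type*} [TopologicalSpace M] [ChartedSpace (Coord n) M]
  [IsManifold (𝓡 n) ∞ M] {γ : ℝ → M} {S : Set ℝ} {t : ℝ}
  {D : CovariantDerivative (𝓡 n) (Coord n) (TangentSpace (𝓡 n) : M → Type _)}
  {h : ContMDiffRiemannianMetric (𝓡 n) ∞ (Coord n) (TangentSpace (𝓡 n) : M → Type _)}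

theorem continuousOn_comp_velocity (hγ : ContMDiffOn 𝓘(ℝ, ℝ) (𝓡 n) 1 γ (Icc 0 1)) (c : M) :
    ContinuousOn (fun t => comp (n := n) c (velocity γ t))
      (Icc 0 1 ∩ γ ⁻¹' (chartAt (Coord n) c).source) := by
  have h1 := hγ.continuousOn_tangentMapWithin le_rfl
    (uniqueDiffOn_Icc (zero_lt_one' ℝ)).uniqueMDiffOn
  have h2 : Continuous fun t : ℝ => (⟨t, (1 : ℝ)⟩ : TangentBundle 𝓘(ℝ, ℝ) ℝ) :=
    (tangentBundleModelSpaceHomeomorph 𝓘(ℝ, ℝ)).symm.continuous.comp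
      (Continuous.prodMk_left (1 : ℝ))
  have h3 : ContinuousOn (fun t => (⟨γ t, velocity γ t⟩ : TangentBundle (𝓡 n) M)) (Icc 0 1) :=
    h1.comp h2.continuousOn fun t ht => ht
  have h4 := (trivializationAt (Coord n) (TangentSpace (𝓡 n) : M → Type _) c).continuousOn
  have h5 := h4.comp (h3.mono inter_subset_left) (s := Icc 0 1 ∩ γ ⁻¹' (chartAt (Coord n) c).source)
    fun t ht => by
      rw [Bundle.Trivialization.mem_source]
      simpa using ht.2
  exact continuous_snd.comp_continuousOn h5

/-- The components in the chart at `c` of `D_{γ'} ∂_i`. -/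
def alongChristoffel (D : CovariantDerivative (𝓡 n) (Coord n) (TangentSpace (𝓡 n) : M → Type _))
    (γ : ℝ → M) (c : M) (i : Fin n) (t : ℝ) : Coord n :=
  comp c (D (frame c (stdVec i)) (γ t) (velocity γ t))

theorem continuousOn_alongChristoffel (hD : IsLeviCivita h D)
    (hγ : ContMDiffOn 𝓘(ℝ, ℝ) (𝓡 n) 1 γ (Icc 0 1)) (c : M) (i : Fin n) :
    ContinuousOn (alongChristoffel D γ c i) (Icc 0 1 ∩ γ ⁻¹' (chartAt (Coord n) c).source) := by
  have hv := continuousOn_comp_velocity hγ c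
  have hsum : ContinuousOn (fun t => ∑ j, comp (n := n) c (velocity γ t) j
      • chartChristoffel D c i j (γ t)) (Icc 0 1 ∩ γ ⁻¹' (chartAt (Coord n) c).source) := by
    refine continuousOn_finsetSum _ fun j _ => ContinuousOn.fun_smul ?_ ?_
    · exact (EuclideanSpace.proj j : Coord n →L[ℝ] ℝ).continuous.comp_continuousOn hv
    · exact (continuousOn_chartChristoffel hD c i j).comp (hγ.continuousOn.mono inter_subset_left)
        fun t ht => ht.2
  refine hsum.congr fun t ht => ?_
  have e : velocity γ t = ∑ j, comp (n := n) c (velocity γ t) j • frame c (stdVec j) (γ t) := by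
    rw [← frame_eq_sum c ht.2, frame_comp c ht.2]
  unfold alongChristoffel chartChristoffel
  conv_lhs => rw [e]
  rw [map_sum]
  simp only [map_smul]
  rw [comp_eq c ht.2, map_sum]
  refine Finset.sum_congr rfl fun j _ => ?_
  rw [map_smul, ← comp_eq c ht.2]

/-- The coefficients of the equation of parallel fields along `γ` in the chart at `c`. -/
def parallelCoeff (D : CovariantDerivative (𝓡 n) (Coord n) (TangentSpace (𝓡 n) : M → Type _))
    (γ : ℝ → M) (c : M) (t : ℝ) : Coord n →L[ℝ] Coord n :=
  ∑ i, (EuclideanSpace.proj i : Coord n →L[ℝ] ℝ).smulRight (alongChristoffel D γ c i t)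

theorem continuousOn_parallelCoeff (hD : IsLeviCivita h D)
    (hγ : ContMDiffOn 𝓘(ℝ, ℝ) (𝓡 n) 1 γ (Icc 0 1)) (c : M) :
    ContinuousOn (parallelCoeff D γ c) (Icc 0 1 ∩ γ ⁻¹' (chartAt (Coord n) c).source) :=
  continuousOn_finsetSum _ fun i _ =>
    (ContinuousLinearMap.smulRightL ℝ (Coord n) (Coord n)
      (EuclideanSpace.proj i : Coord n →L[ℝ] ℝ)).continuous.comp_continuousOn
      (continuousOn_alongChristoffel hD hγ c i)

theorem comp_frame_eq_sum {c c' z : M} (hz : z ∈ (chartAt (Coord n) c).source)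
    (hz' : z ∈ (chartAt (Coord n) c').source) (u : Coord n) :
    comp c' (frame c u z) = ∑ i, u i • comp c' (frame c (stdVec i) z) := by
  rw [frame_eq_sum c hz u, comp_eq c' hz', map_sum]
  refine Finset.sum_congr rfl fun i _ => ?_
  rw [map_smul, ← comp_eq c' hz']

/-- Write V = ∑ Uⁱ ∂_i in the frame of the chart at c and differentiate its components in the chart
at γ t. The components of ∂_i have derivative D_{γ'} ∂_i - Γ ∂_i; the ODE for U cancels the first
terms and leaves -Γ V. -/
theorem isParallelOn_frame (hγ : MDifferentiableOn 𝓘(ℝ, ℝ) (𝓡 n) γ (Icc 0 1))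
    (hD : IsLeviCivita h D)
    (hS : S ⊆ Icc 0 1) (c : M) (hSc : ∀ t ∈ S, γ t ∈ (chartAt (Coord n) c).source)
    {U : ℝ → Coord n} (hU : ∀ t ∈ S, HasDerivWithinAt U (-parallelCoeff D γ c t (U t)) S t) :
    IsParallelOn D γ (fun t => frame c (U t) (γ t)) S := by
  intro t ht
  have hc := hSc t ht
  have hm := fun i : Fin n => mdifferentiableAt_frame c hc (stdVec i)
  have hb := fun i : Fin n => (hasDerivWithinAt_comp_curve
    (mdifferentiableAt_comp_section (hm i)) (hγ t (hS ht))).mono hS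
  have hu := fun i : Fin n =>
    (EuclideanSpace.proj i : Coord n →L[ℝ] ℝ).hasFDerivAt.comp_hasDerivWithinAt t (hU t ht)
  have hsum := HasDerivWithinAt.fun_sum (u := Finset.univ) fun i _ => (hu i).fun_smul (hb i)
  set X : Coord n := velocityCoord γ t with hX
  set f : Fin n → Coord n := fun i => frame c (stdVec i) (γ t) with hf
  set a : Fin n → Coord n := fun i => D (frame c (stdVec i)) (γ t) (velocity γ t) with ha
  set w : Coord n := -parallelCoeff D γ c t (U t) with hw
  have hself := mem_chart_source (Coord n) (γ t)
  have hb' : ∀ i, chartDeriv (n := n) (γ t) (fun z => comp (n := n) (γ t) (frame c (stdVec i) z)) X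
      = a i - christoffelMap D (γ t) X (f i) := fun i => by
    rw [christoffelMap_apply hD]
    exact eq_sub_of_add_eq (covariantDerivative_eq D (hm i) X).symm
  -- T turns components in the chart at c into vectors at γ t, so it carries the ODE coefficients
  -- back to D_{γ'} ∂_i.
  have hwsum : ∑ i, w i • f i = -∑ i, U t i • a i := by
    set T : Coord n →L[ℝ] Coord n :=
      ∑ i, (EuclideanSpace.proj i : Coord n →L[ℝ] ℝ).smulRight (f i) with hT
    have hTu : ∀ u : Coord n, T u = ∑ i, u i • f i := fun u => by simp [hT]
    have hTa : ∀ i, T (alongChristoffel D γ c i t) = a i := fun i =>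
      (hTu _).trans ((frame_eq_sum c hc _).symm.trans (frame_comp c hc _))
    have hw' : w = -∑ i, U t i • alongChristoffel D γ c i t := by
      simp [hw, parallelCoeff]
    rw [← hTu, hw', map_neg, map_sum]
    simp only [map_smul, hTa]
  have hval : ∀ s ∈ S, γ s ∈ (chartAt (Coord n) (γ t)).source →
      compAlong γ (fun t => frame c (U t) (γ t)) t s
        = ∑ i, U s i • comp (n := n) (γ t) (frame c (stdVec i) (γ s)) := fun s hs hs' =>
    comp_frame_eq_sum (hSc s hs) hs' (U s)
  refine (hsum.congr_of_eventuallyEq ?_ (hval t ht hself)).congr_deriv ?_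
  · filter_upwards [eventually_mem_source ((hγ t (hS ht)).continuousWithinAt.mono hS) (γ t) hself,
      self_mem_nhdsWithin] with s hs hs' using hval s hs' hs
  · have hcomp : ∀ i, comp (n := n) (γ t) (frame c (stdVec i) (γ t)) = f i := fun i =>
      comp_self (γ t) _
    have hV : frame c (U t) (γ t) = ∑ i, U t i • f i := frame_eq_sum c hc (U t)
    have hΓ : christoffelAt D (γ t) (frame c (U t) (γ t)) X
        = ∑ i, U t i • christoffelMap D (γ t) X (f i) := by
      refine (congrArg (fun v : Coord n => christoffelAt D (γ t) v X) hV).trans ?_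
      dsimp only
      rw [← christoffelMap_apply hD, map_sum]
      simp only [map_smul]
    refine Eq.trans ?_ (congrArg Neg.neg hΓ).symm
    simp only [hb', hcomp, Function.comp_apply, PiLp.proj_apply, smul_sub]
    rw [Finset.sum_add_distrib, hwsum, Finset.sum_sub_distrib]
    abel

variable (D) in
-- By linearity δ depends neither on the initial vector nor on the subinterval, which is what gluing
-- over a finite subdivision requires.
theorem exists_isParallelOn_Icc (hD : IsLeviCivita h D)
    (hγ : ContMDiffOn 𝓘(ℝ, ℝ) (𝓡 n) 1 γ (Icc 0 1)) {t₀ : ℝ} (ht₀ : t₀ ∈ Icc (0 : ℝ) 1) :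
    ∃ δ > 0, ∀ a b : ℝ, a ≤ b → Icc a b ⊆ Icc 0 1 ∩ Metric.ball t₀ δ →
      ∀ v : TangentSpace (𝓡 n) (γ a), ∃ V, IsParallelOn D γ V (Icc a b) ∧ V a = v := by
  set c := γ t₀ with hc
  set A := parallelCoeff D γ c with hA
  have hs : ∀ᶠ t in nhdsWithin t₀ (Icc 0 1), γ t ∈ (chartAt (Coord n) c).source :=
    eventually_mem_source (hγ.continuousOn t₀ ht₀) c (mem_chart_source _ c)
  have hAc := continuousOn_parallelCoeff hD hγ c
  have hAt : ContinuousWithinAt A (Icc 0 1) t₀ :=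
    (hAc t₀ ⟨ht₀, mem_chart_source _ c⟩).mono_of_mem_nhdsWithin
      (Filter.inter_mem self_mem_nhdsWithin hs)
  have hb : ∀ᶠ t in nhdsWithin t₀ (Icc 0 1), ‖A t‖ < ‖A t₀‖ + 1 :=
    hAt.norm.eventually_lt_const (lt_add_one _)
  obtain ⟨ε, hε, hball⟩ := Metric.mem_nhdsWithin_iff.1 (hs.and hb)
  set K : NNReal := ‖A t₀‖₊ + 1 with hK
  have hKpos : (0 : ℝ) < K := by positivity
  -- The radius ε keeps γ in the chart and A bounded by K; the radius 1/(4K) gives b - a ≤ 1/(2K).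
  refine ⟨min ε (1 / (4 * K)), lt_min hε (by positivity), fun a b hab hsub v => ?_⟩
  have hgood : ∀ t ∈ Icc a b, γ t ∈ (chartAt (Coord n) c).source ∧ ‖A t‖ < ‖A t₀‖ + 1 :=
    fun t ht => hball ⟨Metric.ball_subset_ball (min_le_left _ _) (hsub ht).2, (hsub ht).1⟩
  have hlen : K * (b - a) ≤ 1 / 2 := by
    have h1 := Metric.mem_ball.1 (hsub (left_mem_Icc.2 hab)).2
    have h2 := Metric.mem_ball.1 (hsub (right_mem_Icc.2 hab)).2
    rw [Real.dist_eq] at h1 h2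
    have h3 := (abs_lt.1 (h1.trans_le (min_le_right _ _))).1
    have h4 := (abs_lt.1 (h2.trans_le (min_le_right _ _))).2
    have h5 : b - a ≤ 2 * (1 / (4 * K)) := by linarith
    calc (K : ℝ) * (b - a) ≤ K * (2 * (1 / (4 * K))) := mul_le_mul_of_nonneg_left h5 hKpos.le
      _ = 1 / 2 := by field_simp; norm_num
  obtain ⟨U, hUa, hU⟩ := exists_linearODE_solution hab
    (hAc.mono fun t ht => ⟨(hsub ht).1, (hgood t ht).1⟩)
    (K := K) (fun t ht => (hgood t ht).2.le) hlen (comp c v)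
  refine ⟨fun t => frame c (U t) (γ t), isParallelOn_frame (hγ.mdifferentiableOn one_ne_zero) hD
    (fun t ht => (hsub ht).1) c (fun t ht => (hgood t ht).1) hU, ?_⟩
  dsimp only
  rw [hUa]
  exact frame_comp c (hgood a (left_mem_Icc.2 hab)).1 v

/-- At the junction both one-sided derivatives are -Γ applied to the common value V b = W b. -/
theorem IsParallelOn.union {a b c : ℝ} (hab : a ≤ b) (hbc : b ≤ c)
    {V W : (t : ℝ) → TangentSpace (𝓡 n) (γ t)} (hV : IsParallelOn D γ V (Icc a b))
    (hW : IsParallelOn D γ W (Icc b c)) (hVW : W b = V b) :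
    IsParallelOn D γ (fun t => if t ≤ b then V t else W t) (Icc a c) := by
  set Z : (t : ℝ) → TangentSpace (𝓡 n) (γ t) := fun t => if t ≤ b then V t else W t with hZ
  have hZV : ∀ t ≤ b, Z t = V t := fun t ht => if_pos ht
  have hZW : ∀ t, b ≤ t → Z t = W t := fun t ht => by
    rcases ht.eq_or_lt with rfl | ht
    · rw [hZV _ le_rfl, hVW]
    · exact if_neg ht.not_ge
  have h1 : ∀ t ∈ Icc a b, HasDerivWithinAt (compAlong γ Z t)
      (-christoffelAt D (γ t) (Z t) (velocityCoord γ t)) (Icc a b) t := fun t ht => by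
    rw [hZV t ht.2]
    refine (hV t ht).congr (fun s hs => ?_) ?_
    · exact congrArg (comp (γ t)) (hZV s hs.2)
    · exact congrArg (comp (γ t)) (hZV t ht.2)
  have h2 : ∀ t ∈ Icc b c, HasDerivWithinAt (compAlong γ Z t)
      (-christoffelAt D (γ t) (Z t) (velocityCoord γ t)) (Icc b c) t := fun t ht => by
    rw [hZW t ht.1]
    refine (hW t ht).congr (fun s hs => ?_) ?_
    · exact congrArg (comp (γ t)) (hZW s hs.1)
    · exact congrArg (comp (γ t)) (hZW t ht.1)
  intro t ht
  rcases lt_trichotomy t b with hlt | rfl | hgt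
  · refine (h1 t ⟨ht.1, hlt.le⟩).mono_of_mem_nhdsWithin ?_
    filter_upwards [self_mem_nhdsWithin, mem_nhdsWithin_of_mem_nhds (Iio_mem_nhds hlt)] with s hs hs'
      using ⟨hs.1, le_of_lt hs'⟩
  · rw [← Icc_union_Icc_eq_Icc hab hbc]
    exact (h1 t (right_mem_Icc.2 hab)).union (h2 t (left_mem_Icc.2 hbc))
  · refine (h2 t ⟨hgt.le, ht.2⟩).mono_of_mem_nhdsWithin ?_
    filter_upwards [self_mem_nhdsWithin, mem_nhdsWithin_of_mem_nhds (Ioi_mem_nhds hgt)] with s hs hs'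
      using ⟨le_of_lt hs', hs.2⟩

variable (D) in
theorem exists_isParallelOn (hD : IsLeviCivita h D)
    (hγ : ContMDiffOn 𝓘(ℝ, ℝ) (𝓡 n) 1 γ (Icc 0 1)) (v : TangentSpace (𝓡 n) (γ 0)) :
    ∃ V, IsParallelOn D γ V (Icc 0 1) ∧ V 0 = v := by
  choose! δ hδ hloc using fun t₀ (ht₀ : t₀ ∈ Icc (0 : ℝ) 1) =>
    exists_isParallelOn_Icc D hD hγ ht₀
  obtain ⟨τ, hτ0, hτm, ⟨m, hm⟩, hτ⟩ := exists_monotone_Icc_subset_open_cover_Icc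
    (zero_le_one' ℝ) (c := fun t₀ : Icc (0 : ℝ) 1 => Metric.ball t₀ (δ t₀))
    (fun t₀ => Metric.isOpen_ball)
    (fun t₀ _ => mem_iUnion.2 ⟨t₀, Metric.mem_ball_self (hδ t₀ t₀.2)⟩)
  have key : ∀ k, ∃ V, IsParallelOn D γ V (Icc 0 (τ k)) ∧ V 0 = v := by
    intro k
    induction k with
    | zero =>
      -- Over the one-point interval [0, 0] the derivative condition is void, so any field with
      -- value v at 0 will do.
      refine ⟨fun t => frame (γ 0) v (γ t), ?_, frame_self (γ 0) v⟩
      rw [hτ0, Icc_self]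
      intro t ht
      obtain rfl : t = 0 := ht
      exact hasDerivWithinAt_iff_hasFDerivWithinAt.2 HasFDerivWithinAt.singleton
    | succ k ih =>
      obtain ⟨V, hV, hV0⟩ := ih
      obtain ⟨t₀, hsub⟩ := hτ k
      obtain ⟨W, hW, hWV⟩ := hloc t₀ t₀.2 (τ k) (τ (k + 1)) (hτm k.le_succ) (fun t ht => by
        have ht' : t ∈ Icc (0 : ℝ) 1 := ⟨(τ k).2.1.trans ht.1, ht.2.trans (τ (k + 1)).2.2⟩
        exact ⟨ht', hsub (a := ⟨t, ht'⟩) ⟨ht.1, ht.2⟩⟩) (V (τ k))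
      refine ⟨_, hV.union (τ k).2.1 (hτm k.le_succ) hW hWV, ?_⟩
      exact (if_pos (τ k).2.1).trans hV0
  obtain ⟨V, hV, hV0⟩ := key m
  rw [hm m le_rfl] at hV
  exact ⟨V, hV, hV0⟩

end Existence

/-! ### Parallel transport -/

section Transport

variable {n : ℕ} {M : Type*} [TopologicalSpace M] [ChartedSpace (Coord n) M]
  [IsManifold (𝓡 n) ∞ M] {γ : ℝ → M} {t : ℝ}
  {D : CovariantDerivative (𝓡 n) (Coord n) (TangentSpace (𝓡 n) : M → Type _)}
  {h : ContMDiffRiemannianMetric (𝓡 n) ∞ (Coord n) (TangentSpace (𝓡 n) : M → Type _)}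

theorem IsParallelOn.unique (hD : IsLeviCivita h D) {V W : (t : ℝ) → TangentSpace (𝓡 n) (γ t)}
    (hγ : MDifferentiableOn 𝓘(ℝ, ℝ) (𝓡 n) γ (Icc 0 1)) (hV : IsParallelOn D γ V (Icc 0 1))
    (hW : IsParallelOn D γ W (Icc 0 1)) (h0 : V 0 = W 0) (ht : t ∈ Icc (0 : ℝ) 1) :
    V t = W t := by
  have hZ := (hV.linComb hD hγ.continuousOn hW 1 (-1)).eq_zero_iff hD hγ ht
  simp only [one_smul, neg_smul, ← sub_eq_add_neg, sub_eq_zero] at hZ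
  exact hZ.2 h0

/-- Linearity comes from uniqueness, injectivity from the constant norm, and bijectivity from
equality of dimensions. -/
theorem exists_parallelTransport (hD : IsLeviCivita h D)
    (hγ : ContMDiffOn 𝓘(ℝ, ℝ) (𝓡 n) 1 γ (Icc 0 1)) :
    ∃ τ : TangentSpace (𝓡 n) (γ 0) ≃ₗ[ℝ] TangentSpace (𝓡 n) (γ 1), IsParallelTransport D γ τ := by
  have hγd := hγ.mdifferentiableOn one_ne_zero
  have h1 : (1 : ℝ) ∈ Icc (0 : ℝ) 1 := right_mem_Icc.2 zero_le_one
  choose V hV hV0 using exists_isParallelOn D hD hγ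
  have hlin : ∀ (a b : ℝ) (v w : TangentSpace (𝓡 n) (γ 0)),
      V (a • v + b • w) 1 = a • V v 1 + b • V w 1 := fun a b v w =>
    (hV _).unique hD hγd ((hV v).linComb hD hγd.continuousOn (hV w) a b)
      (by rw [hV0, hV0, hV0]) h1
  let L : TangentSpace (𝓡 n) (γ 0) →ₗ[ℝ] TangentSpace (𝓡 n) (γ 1) :=
    { toFun := fun v => V v 1
      map_add' := fun v w => by simpa using hlin 1 1 v w
      map_smul' := fun a v => by simpa using hlin a 0 v 0 }
  have hinj : Function.Injective L := by
    refine (injective_iff_map_eq_zero L).2 fun v hv => ?_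
    rw [← hV0 v]
    exact ((hV v).eq_zero_iff hD hγd h1).1 hv
  have : FiniteDimensional ℝ (TangentSpace (𝓡 n) (γ 0)) :=
    inferInstanceAs (FiniteDimensional ℝ (Coord n))
  have : FiniteDimensional ℝ (TangentSpace (𝓡 n) (γ 1)) :=
    inferInstanceAs (FiniteDimensional ℝ (Coord n))
  refine ⟨LinearMap.linearEquivOfInjective L hinj rfl, fun v =>
    ⟨V v, (isParallelAlong_iff hγd).2 (hV v), hV0 v⟩, fun W hW => ?_⟩
  exact (hV (W 0)).unique hD hγd ((isParallelAlong_iff hγd).1 hW) (hV0 (W 0)) h1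

/-- F(τ v) = F(v) for all v: for v ≠ 0 the parallel field through v never vanishes, hence is a
horizontal lift, along which F is constant; at v = 0 both sides are 0 by homogeneity. -/
theorem image_indicatrix {F : TangentBundle (𝓡 n) M → ℝ} (hF : IsFinsler F)
    (hpar : IsParallelMetric (berwaldConnection F) h) (hD : IsLeviCivita h D)
    (hγ : MDifferentiableOn 𝓘(ℝ, ℝ) (𝓡 n) γ (Icc 0 1))
    {τ : TangentSpace (𝓡 n) (γ 0) ≃ₗ[ℝ] TangentSpace (𝓡 n) (γ 1)}
    (hτ : IsParallelTransport D γ τ) : τ '' indicatrix F (γ 0) = indicatrix F (γ 1) := by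
  have h1 : (1 : ℝ) ∈ Icc (0 : ℝ) 1 := right_mem_Icc.2 zero_le_one
  have hFτ : ∀ v, F ⟨γ 1, τ v⟩ = F ⟨γ 0, v⟩ := by
    intro v
    rcases eq_or_ne v 0 with rfl | hv
    · rw [map_zero]
      exact (hF.apply_zero (γ 1)).trans (hF.apply_zero (γ 0)).symm
    · obtain ⟨V, hV, rfl⟩ := hτ.1 v
      rw [hτ.2 V hV]
      refine finsler_eq_of_isHorizontalLift hF hγ ((isHorizontalLift_iff_isParallelAlong hF hpar hD
        hγ V).2 ⟨hV, fun t ht => ?_⟩) 1 h1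
      have hp : IsParallelOn D γ V (Icc 0 1) := (isParallelAlong_iff hγ).1 hV
      rwa [Ne, hp.eq_zero_iff hD hγ ht]
  ext w
  constructor
  · rintro ⟨v, hv, rfl⟩
    exact (hFτ v).trans hv
  · intro hw
    refine ⟨τ.symm w, ?_, τ.apply_symm_apply w⟩
    have := hFτ (τ.symm w)
    rw [τ.apply_symm_apply] at this
    exact this.symm.trans hw

end Transport

end FinslerBerwald

end

open FinslerBerwald in
theorem proposition3p6 {n : ℕ} {M : Type*} [TopologicalSpace M] [T2Space M]
    [SecondCountableTopology M] [ChartedSpace (EuclideanSpace ℝ (Fin n)) M]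
    [IsManifold (𝓡 n) ∞ M]
    (F : TangentBundle (𝓡 n) M → ℝ) (hF : IsBerwald F)
    (h : ContMDiffRiemannianMetric (𝓡 n) ∞ (EuclideanSpace ℝ (Fin n))
      (TangentSpace (𝓡 n) : M → Type _))
    (hpar : IsParallelMetric (berwaldConnection F) h) :
    -- The average of the Berwald connection is an affine connection, and it is the
    -- Levi-Civita connection of `h`.
    (∃ D : CovariantDerivative (𝓡 n) (EuclideanSpace ℝ (Fin n)) (TangentSpace (𝓡 n) : M → Type _),
      D.toFun = averageConnection F (berwaldConnection F) ∧ IsLeviCivita h D) ∧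
    ∀ D : CovariantDerivative (𝓡 n) (EuclideanSpace ℝ (Fin n)) (TangentSpace (𝓡 n) : M → Type _),
      IsLeviCivita h D →
        (∀ (Y : (x : M) → TangentSpace (𝓡 n) x) (x : M),
          MDifferentiableAt (𝓡 n) (𝓡 n).tangent
            (fun z => (⟨z, Y z⟩ : TangentBundle (𝓡 n) M)) x →
          averageConnection F (berwaldConnection F) Y x = D Y x) ∧
        ∀ γ : ℝ → M, ContMDiffOn 𝓘(ℝ, ℝ) (𝓡 n) 1 γ (Set.Icc 0 1) →
          -- the horizontal lifts of `γ` are the nowhere zero parallel fields along `γ`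
          (∀ V : (t : ℝ) → TangentSpace (𝓡 n) (γ t),
            IsHorizontalLift F γ V ↔
              IsParallelAlong D γ V ∧ ∀ t ∈ Set.Icc (0 : ℝ) 1, V t ≠ 0) ∧
          -- parallel transport along `γ` maps the indicatrix onto the indicatrix
          ∃ τ : TangentSpace (𝓡 n) (γ 0) ≃ₗ[ℝ] TangentSpace (𝓡 n) (γ 1),
            IsParallelTransport D γ τ ∧ τ '' indicatrix F (γ 0) = indicatrix F (γ 1) := by
  have hFin := hF.toIsFinsler
  obtain ⟨hex, huniq⟩ := exists_leviCivita_averageConnection hFin hpar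
  refine ⟨hex, fun D hD => ⟨huniq D hD, fun γ hγ => ?_⟩⟩
  have hγd := hγ.mdifferentiableOn one_ne_zero
  obtain ⟨τ, hτ⟩ := exists_parallelTransport hD hγ
  exact ⟨isHorizontalLift_iff_isParallelAlong hFin hpar hD hγd, τ, hτ,
    image_indicatrix hFin hpar hD hγd hτ⟩
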